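/- Let $(\mathcal V,\otimes,I)$ be a bicomplete symmetric monoidal closed category (with hom-sets, limits and colimits all relative to a fixed universe of small sets). **Decomposing categories.** For a set $S$ and $A\in\mathcal V$, a morphism $f:A\to\coprod_{i\in S}A$ is *decomposing* if $(\coprod_{i}f)\circ f=(\coprod_{i}\iota_i)\circ f$ and $\nabla\circ f=\mathrm{id}_A$, where $\iota_i:A\to\coprod_{j\in S}A$ are the coprojections and $\nabla:\coprod_{i\in S}A\to A$ is the codiagonal. A *decomposing equalizer* is the equalizer of a decomposing morphism $f$ and a coprojection $\iota_j$, $j\in S$. Assume that $\mathcal V$ is *decomposing*: (a) coproducts commute with decomposing equalizers: for all sets $T,S$, all families of decomposing morphisms $f_t:A_t\to\coprod_{i\in S}A_t$ $(t\in T)$ and all $j\in S$, the coproduct over $t$ of the equalizers of $f_t$ and $\iota_j$ is the equalizer of $\coprod_tf_t$ and $\coprod_t\iota_j$; (b) coproducts are disjoint: in every coproduct $\coprod_{t\in T}A_t$ the coprojections are monomorphisms, and the pullback of two coprojections with distinct indices is initial; (c) for every $W\in\mathcal V$, the functors $W\otimes-$ and $-\otimes W$ preserve decomposing equalizers. **Templicial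 objects.** Let $\mathbf{Fint}$ be the category with objects $[n]=\{0<\dots<n\}$, $n\ge0$, and the order preserving maps that preserve both endpoints as morphisms, with the monoidal structure $[m]+[n]=[m+n]$ and unit $[0]$. For a set $S$, let $\mathcal V\mathrm{Quiv}_S$ be the category of families $Q=(Q(a,b))_{a,b\in S}$ of objects of $\mathcal V$, monoidal with $(Q\otimes_SP)(a,b)=\coprod_{c\in S}Q(a,c)\otimes P(c,b)$ and $I_S(a,b)=I$ if $a=b$, $I_S(a,b)=0$ otherwise. For $f:S\to T$, the functor $f^*:\mathcal V\mathrm{Quiv}_T\to\mathcal V\mathrm{Quiv}_S$, $f^*(Q)(a,b)=Q(f(a),f(b))$, is lax monoidal, so its left adjoint $f_!$ is colax monoidal. A *templicial object* is a pair $(X,S)$ of a set $S$ and a colax monoidal functor $X:\mathbf{Fint}^{op}\to\mathcal V\mathrm{Quiv}_S$ whose counit $X_0\to I_S$ is an isomorphism; a morphism $(X,S)\to(Y,T)$ is a map $f:S\to T$ with a monoidal natural transformation $f_!X\to Y$. They form the category $\mathrm{ts}\mathcal V$. **Based colax monoidal functors.** If $X:\mathbf{Fint}^{op}\to\mathcal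 V$ is colax monoidal with comultiplication $\mu$ and counit $\epsilon$, then $X_0$ is a comonoid via $\mu_{0,0}$ and $\epsilon$. For a set $S$, $F(S)=\coprod_{a\in S}I$ is a comonoid via the diagonal and the terminal map of $S$. The category $\mathrm{Colax}_b(\mathbf{Fint}^{op},\mathcal V)$ is the 2-pullback of $(-)_0:\mathrm{Colax}(\mathbf{Fint}^{op},\mathcal V)\to\mathrm{Comon}(\mathcal V)$ and $F:\mathrm{Set}\to\mathrm{Comon}(\mathcal V)$: its objects are triples $(X,S,\varphi)$ with $X$ a colax monoidal functor, $S$ a set and $\varphi:X_0\cong F(S)$ an isomorphism of comonoids, and its morphisms are pairs $(\alpha,f)$ of a monoidal natural transformation and a map of sets that are compatible with the isomorphisms $\varphi$. **The functors.** The comparison functor $\mathfrak c:\mathrm{ts}\mathcal V\to\mathrm{Colax}_b(\mathbf{Fint}^{op},\mathcal V)$ sends $(X,S)$ to the functor $n\mapsto\coprod_{a,b\in S}X_n(a,b)$ with base $S$, with the colax monoidal structure and the isomorphism $\coprod_{a,b}X_0(a,b)\cong F(S)$ induced by those of $X$, and it sends a morphism $(\alpha,f):(X,S)\to(Y,T)$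 to $f$ and the transformation induced on coproducts by the components $X_n(a,b)\to Y_n(f(a),f(b))$. For a based colax monoidal functor $(X,S,\varphi)$ and $n\ge 0$, let $e_{a,b}:X_n(a,b)\to X_n$ be the equalizer of $\mu_{0,n,0}:X_n\to X_0\otimes X_n\otimes X_0\cong\coprod_{a,b\in S}X_n$ and the $(a,b)$-th coprojection. The functor $\mathfrak d:\mathrm{Colax}_b(\mathbf{Fint}^{op},\mathcal V)\to\mathrm{ts}\mathcal V$ sends $(X,S,\varphi)$ to $(\tilde X,S)$, where $\tilde X_n=(X_n(a,b))_{a,b\in S}$, the counit $X_0(a,b)\to I_S(a,b)$ followed by the canonical map $I_S(a,b)\to I$ is $\epsilon\circ e_{a,b}$, and the comultiplication $X_{m+n}(a,b)\to\coprod_{c}X_m(a,c)\otimes X_n(c,b)$ followed by $(e_{a,c}\otimes e_{c,b})_c$ is $\mu_{m,n}\circ e_{a,b}$; it sends $(\alpha,f)$ to the morphism given by $f$ on vertices and by the maps $X_n(a,b)\to Y_n(f(a),f(b))$ whose composite with $e_{f(a),f(b)}$ is $\alpha_n\circ e_{a,b}$. **Theorem.** Such a functor $\mathfrak d$ exists,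 and $\mathfrak c$ and $\mathfrak d$ form an adjoint equivalence $$\mathfrak c:\mathrm{ts}\mathcal V\;\simeq\;\mathrm{Colax}_b(\mathbf{Fint}^{op},\mathcal V):\mathfrak d.$$ More precisely, for any choice of structure maps for $\mathfrak d$ as described, there is an adjunction $\mathfrak c\dashv\mathfrak d$ whose unit and counit are isomorphisms and whose counit at $(X,S,\varphi)$ is the identity on $S$ and the morphism $(e_{a,b})_{a,b}:\coprod_{a,b\in S}X_n(a,b)\to X_n$ for every $n\geq 0$. -/

import Mathlib

open CategoryTheory MonoidalCategory Limits Opposite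

universe v u v₁ v₂ u₁ u₂

namespace Templicial

set_option linter.unusedSectionVars false

/-- Objects `[n]`, `n ≥ 0`, of the category of finite intervals. -/
structure FinInt where
  /-- the number `n` in `[n] = {0 < 1 < ⋯ < n}` -/
  len : ℕ

namespace FinInt

/-- A morphism `[m] ⟶ [n]` of finite intervals: an order preserving map which preserves
both endpoints. -/
@[ext]
structure Hom (m n : FinInt) where
  /-- the underlying order preserving map -/
  toFun : Fin (m.len + 1) →o Fin (n.len + 1)
  map_zero : toFun 0 = 0
  map_last : toFun (Fin.last m.len) = Fin.last n.len

instance : Category FinInt where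
  Hom := Hom
  id _ := ⟨OrderHom.id, rfl, rfl⟩
  comp f g := ⟨g.toFun.comp f.toFun, by simp [f.map_zero, g.map_zero],
    by simp [f.map_last, g.map_last]⟩

theorem hom_ext {m n : FinInt} {f g : m ⟶ n}
    (h : ∀ i : Fin (m.len + 1), (f.toFun i : ℕ) = g.toFun i) : f = g := by
  apply Hom.ext
  ext i
  exact h i

@[simp] theorem id_toFun (m : FinInt) (i : Fin (m.len + 1)) : (𝟙 m : m ⟶ m).toFun i = i := rfl

@[simp] theorem comp_toFun {m n p : FinInt} (f : m ⟶ n) (g : n ⟶ p) (i : Fin (m.len + 1)) :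
    (f ≫ g).toFun i = g.toFun (f.toFun i) := rfl

/-- The sum `[m] + [n] = [m + n]`. -/
def add (m n : FinInt) : FinInt := ⟨m.len + n.len⟩

@[simp] theorem add_len (m n : FinInt) : (add m n).len = m.len + n.len := rfl

theorem toFun_le {m n : FinInt} (f : m ⟶ n) (i : Fin (m.len + 1)) :
    (f.toFun i : ℕ) ≤ n.len := Nat.lt_succ_iff.1 (f.toFun i).isLt

/-- The values of the sum of two morphisms: `f` on the first summand, `g` on the second one. -/
def addVal {m n m' n' : FinInt} (f : m ⟶ n) (g : m' ⟶ n') (i : Fin ((add m m').len + 1)) : ℕ :=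
  if h : (i : ℕ) ≤ m.len then f.toFun ⟨i, Nat.lt_succ_iff.2 h⟩
  else n.len + g.toFun ⟨i - m.len, by have := i.isLt; simp only [add_len] at this; omega⟩

theorem addVal_left {m n m' n' : FinInt} (f : m ⟶ n) (g : m' ⟶ n')
    (i : Fin ((add m m').len + 1)) (j : Fin (m.len + 1)) (h : (i : ℕ) = j) :
    addVal f g i = f.toFun j := by
  have hj := j.isLt
  rw [addVal, dif_pos (by omega)]
  congr 2
  exact Fin.ext h

theorem addVal_right {m n m' n' : FinInt} (f : m ⟶ n) (g : m' ⟶ n')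
    (i : Fin ((add m m').len + 1)) (j : Fin (m'.len + 1)) (h : (i : ℕ) = m.len + j) :
    addVal f g i = n.len + g.toFun j := by
  by_cases hj : (j : ℕ) = 0
  · have h0 : j = 0 := Fin.ext hj
    rw [addVal_left f g i (Fin.last _) (by simp; omega), f.map_last, h0, g.map_zero]
    simp
  · rw [addVal, dif_neg (by omega)]
    congr 3
    exact Fin.ext (by simp; omega)

theorem add_cases {m m' : FinInt} (i : Fin ((add m m').len + 1)) :
    (∃ j : Fin (m.len + 1), (i : ℕ) = j) ∨ ∃ j : Fin (m'.len + 1), (i : ℕ) = m.len + j := by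
  have hi := i.isLt
  simp only [add_len] at hi
  by_cases h : (i : ℕ) ≤ m.len
  · exact Or.inl ⟨⟨i, by omega⟩, rfl⟩
  · exact Or.inr ⟨⟨i - m.len, by omega⟩, by simp; omega⟩

/-- The sum `f + g` of two morphisms. -/
def addHom {m n m' n' : FinInt} (f : m ⟶ n) (g : m' ⟶ n') : add m m' ⟶ add n n' where
  toFun :=
    { toFun := fun i => ⟨addVal f g i, by
        have := toFun_le f
        have := toFun_le g
        rcases add_cases i with ⟨j, hj⟩ | ⟨j, hj⟩
        · rw [addVal_left f g i j hj]
          have := toFun_le f j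
          simp only [add_len]; omega
        · rw [addVal_right f g i j hj]
          have := toFun_le g j
          simp only [add_len]; omega⟩
      monotone' := by
        intro i i' hii
        have hii' : (i : ℕ) ≤ i' := hii
        simp only [Fin.mk_le_mk]
        rcases add_cases i with ⟨j, hj⟩ | ⟨j, hj⟩ <;> rcases add_cases i' with ⟨k, hk⟩ | ⟨k, hk⟩
        · rw [addVal_left f g i j hj, addVal_left f g i' k hk]
          exact f.toFun.monotone (show (j : ℕ) ≤ k by omega)
        · rw [addVal_left f g i j hj, addVal_right f g i' k hk]
          have := toFun_le f j
          omega
        · have h1 : (k : ℕ) = m.len := by have := k.isLt; omega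
          have h2 : (j : ℕ) = 0 := by have := k.isLt; omega
          rw [addVal_right f g i j hj, addVal_left f g i' k hk,
            show k = Fin.last _ from Fin.ext h1, show j = 0 from Fin.ext h2, f.map_last,
            g.map_zero]
          simp
        · rw [addVal_right f g i j hj, addVal_right f g i' k hk]
          have := g.toFun.monotone (show j ≤ k from (show (j : ℕ) ≤ k by omega))
          have h3 : (g.toFun j : ℕ) ≤ g.toFun k := this
          omega }
  map_zero := Fin.ext (by
    change addVal f g 0 = 0
    rw [addVal_left f g 0 0 rfl, f.map_zero]; rfl)
  map_last := Fin.ext (by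
    change addVal f g (Fin.last _) = n.len + n'.len
    rw [addVal_right f g (Fin.last _) (Fin.last _) rfl, g.map_last]; rfl)

theorem addHom_left {m n m' n' : FinInt} (f : m ⟶ n) (g : m' ⟶ n')
    (i : Fin ((add m m').len + 1)) (j : Fin (m.len + 1)) (h : (i : ℕ) = j) :
    ((addHom f g).toFun i : ℕ) = f.toFun j := addVal_left f g i j h

theorem addHom_right {m n m' n' : FinInt} (f : m ⟶ n) (g : m' ⟶ n')
    (i : Fin ((add m m').len + 1)) (j : Fin (m'.len + 1)) (h : (i : ℕ) = m.len + j) :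
    ((addHom f g).toFun i : ℕ) = n.len + g.toFun j := addVal_right f g i j h

/-- The isomorphism `[m] ≅ [n]` for `m = n`. -/
def castIso (m n : FinInt) (h : m.len = n.len) : m ≅ n where
  hom := ⟨(Fin.castOrderIso (by rw [h])).toOrderEmbedding.toOrderHom, rfl, Fin.ext h⟩
  inv := ⟨(Fin.castOrderIso (by rw [h])).toOrderEmbedding.toOrderHom, rfl, Fin.ext h.symm⟩
  hom_inv_id := rfl
  inv_hom_id := rfl

@[simp] theorem castIso_hom_val {m n : FinInt} (h : m.len = n.len) (i : Fin (m.len + 1)) :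
    ((castIso m n h).hom.toFun i : ℕ) = i := rfl

@[simp] theorem castIso_inv_val {m n : FinInt} (h : m.len = n.len) (i : Fin (n.len + 1)) :
    ((castIso m n h).inv.toFun i : ℕ) = i := rfl

theorem id_add_id (m n : FinInt) : addHom (𝟙 m) (𝟙 n) = 𝟙 (add m n) := by
  refine hom_ext fun i => ?_
  rcases add_cases i with ⟨j, hj⟩ | ⟨j, hj⟩
  · rw [addHom_left _ _ i j hj]; exact hj.symm
  · rw [addHom_right _ _ i j hj]; exact hj.symm

theorem addHom_comp {m n p m' n' p' : FinInt} (f : m ⟶ n) (f' : n ⟶ p) (g : m' ⟶ n')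
    (g' : n' ⟶ p') : addHom f g ≫ addHom f' g' = addHom (f ≫ f') (g ≫ g') := by
  refine hom_ext fun i => ?_
  rw [comp_toFun]
  rcases add_cases i with ⟨j, hj⟩ | ⟨j, hj⟩
  · rw [addHom_left _ _ i j hj, addHom_left _ _ _ _ (addHom_left f g i j hj)]; rfl
  · rw [addHom_right _ _ i j hj, addHom_right _ _ _ _ (addHom_right f g i j hj)]; rfl

theorem addHom_val_id {m n m' n' : FinInt} (h : m.len = n.len) (f : m ⟶ n) (g : m' ⟶ n')
    (hf : ∀ i, (f.toFun i : ℕ) = i) (hg : ∀ i, (g.toFun i : ℕ) = i)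
    (i : Fin ((add m m').len + 1)) : ((addHom f g).toFun i : ℕ) = i := by
  rcases add_cases i with ⟨j, hj⟩ | ⟨j, hj⟩
  · rw [addHom_left _ _ i j hj, hf, hj]
  · rw [addHom_right _ _ i j hj, hg, hj, h]

/-- `([m] + [n]) + [p] = [m] + ([n] + [p])`. -/
def assocIso (m n p : FinInt) : add (add m n) p ≅ add m (add n p) :=
  castIso _ _ (by simp only [add_len]; omega)

/-- `[0] + [m] = [m]`. -/
def leftIso (m : FinInt) : add ⟨0⟩ m ≅ m := castIso _ _ (by simp only [add_len]; omega)

/-- `[m] + [0] = [m]`. -/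
def rightIso (m : FinInt) : add m ⟨0⟩ ≅ m := castIso _ _ (by simp only [add_len]; omega)

@[simp] theorem assocIso_val (m n p : FinInt) (i : Fin ((add (add m n) p).len + 1)) :
    ((assocIso m n p).hom.toFun i : ℕ) = i := rfl

@[simp] theorem leftIso_val (m : FinInt) (i : Fin ((add ⟨0⟩ m).len + 1)) :
    ((leftIso m).hom.toFun i : ℕ) = i := rfl

@[simp] theorem rightIso_val (m : FinInt) (i : Fin ((add m ⟨0⟩).len + 1)) :
    ((rightIso m).hom.toFun i : ℕ) = i := rfl

theorem assocIso_natural {m n p m' n' p' : FinInt} (f : m ⟶ m') (g : n ⟶ n') (h : p ⟶ p') :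
    addHom (addHom f g) h ≫ (assocIso m' n' p').hom =
      (assocIso m n p).hom ≫ addHom f (addHom g h) := by
  refine hom_ext fun i => ?_
  rw [comp_toFun, comp_toFun, assocIso_val]
  rcases add_cases i with ⟨j, hj⟩ | ⟨j, hj⟩
  · rw [addHom_left _ _ i j hj]
    rcases add_cases j with ⟨k, hk⟩ | ⟨k, hk⟩
    · rw [addHom_left _ _ j k hk, addHom_left _ _ _ k]
      rw [assocIso_val, hj, hk]
    · rw [addHom_right _ _ j k hk, addHom_right _ _ _ (⟨k, by
        have := k.isLt; simp only [add_len]; omega⟩ : Fin ((add n p).len + 1)),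
        addHom_left _ _ _ k]
      · rfl
      · rw [assocIso_val, hj, hk]
  · rw [addHom_right _ _ i j hj, addHom_right _ _ _ (⟨n.len + j, by
        have := j.isLt; simp only [add_len]; omega⟩ : Fin ((add n p).len + 1)),
        addHom_right _ _ _ j]
    · simp only [add_len]; omega
    · rfl
    · rw [assocIso_val, hj]; simp only [add_len]; omega

theorem leftIso_natural {m n : FinInt} (f : m ⟶ n) :
    addHom (𝟙 ⟨0⟩) f ≫ (leftIso n).hom = (leftIso m).hom ≫ f := by
  refine hom_ext fun i => ?_
  rw [comp_toFun, comp_toFun, leftIso_val, addHom_right _ _ i ((leftIso m).hom.toFun i)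
    (Nat.zero_add (i : ℕ)).symm]
  simp

theorem rightIso_natural {m n : FinInt} (f : m ⟶ n) :
    addHom f (𝟙 ⟨0⟩) ≫ (rightIso n).hom = (rightIso m).hom ≫ f := by
  refine hom_ext fun i => ?_
  rw [comp_toFun, comp_toFun, rightIso_val, addHom_left _ _ i ((rightIso m).hom.toFun i) rfl]

/-- The monoidal structure `(+, [0])` on finite intervals. -/
instance : MonoidalCategory FinInt where
  tensorObj := add
  tensorHom := addHom
  whiskerLeft m _ _ f := addHom (𝟙 m) f
  whiskerRight f m := addHom f (𝟙 m)
  tensorUnit := ⟨0⟩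
  associator := assocIso
  leftUnitor := leftIso
  rightUnitor := rightIso
  tensorHom_def f g := by rw [addHom_comp, Category.id_comp, Category.comp_id]
  id_tensorHom_id := id_add_id
  tensorHom_comp_tensorHom f g f' g' := addHom_comp _ _ _ _
  whiskerLeft_id m n := id_add_id m n
  id_whiskerRight m n := id_add_id m n
  associator_naturality := assocIso_natural
  leftUnitor_naturality := leftIso_natural
  rightUnitor_naturality := rightIso_natural
  pentagon m n p q := by
    refine hom_ext fun i => ?_
    rw [comp_toFun, comp_toFun, comp_toFun,
      addHom_val_id rfl _ _ (fun _ => rfl) (assocIso_val _ _ _), assocIso_val, assocIso_val,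
      assocIso_val, addHom_val_id (by simp only [add_len]; omega) _ _ (assocIso_val _ _ _)
        (fun _ => rfl)]
  triangle m n := by
    refine hom_ext fun i => ?_
    rw [comp_toFun, addHom_val_id rfl _ _ (fun _ => rfl) (leftIso_val _), assocIso_val,
      addHom_val_id (by simp only [add_len]; omega) _ _ (rightIso_val _) (fun _ => rfl)]

end FinInt

section Sigma

variable {V : Type u} [Category.{v} V] [MonoidalCategory V] [HasColimits V]

section

variable [MonoidalClosed V] {T : Type v} (W : V) (A : T → V) {Z : V}

/-- Tensoring on the left preserves coproducts: a morphism out of `W ⊗ ∐ A`. -/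
noncomputable def leftDesc (k : ∀ c, W ⊗ A c ⟶ Z) : W ⊗ ∐ A ⟶ Z :=
  MonoidalClosed.uncurry (Sigma.desc fun c => MonoidalClosed.curry (k c))

@[simp]
theorem ι_leftDesc (k : ∀ c, W ⊗ A c ⟶ Z) (c : T) : W ◁ Sigma.ι A c ≫ leftDesc W A k = k c := by
  rw [leftDesc, ← MonoidalClosed.uncurry_natural_left]
  simp

@[simp]
theorem ι_leftDesc_assoc : type_of% (reassoc_of% @ι_leftDesc.{v, u}) :=
  @(reassoc_of% @ι_leftDesc.{v, u})

variable {W A} in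
theorem left_hom_ext {f g : W ⊗ ∐ A ⟶ Z} (h : ∀ c, W ◁ Sigma.ι A c ≫ f = W ◁ Sigma.ι A c ≫ g) :
    f = g := by
  apply MonoidalClosed.curry_injective
  apply Sigma.hom_ext
  intro c
  rw [← MonoidalClosed.curry_natural_left, ← MonoidalClosed.curry_natural_left, h]

variable [SymmetricCategory V]

/-- Tensoring on the right preserves coproducts: a morphism out of `∐ A ⊗ W`. -/
noncomputable def rightDesc (k : ∀ c, A c ⊗ W ⟶ Z) : (∐ A) ⊗ W ⟶ Z :=
  (β_ _ _).hom ≫ leftDesc W A fun c => (β_ _ _).hom ≫ k c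

@[simp]
theorem ι_rightDesc (k : ∀ c, A c ⊗ W ⟶ Z) (c : T) :
    Sigma.ι A c ▷ W ≫ rightDesc W A k = k c := by
  simp [rightDesc]

@[simp]
theorem ι_rightDesc_assoc : type_of% (reassoc_of% @ι_rightDesc.{v, u}) :=
  @(reassoc_of% @ι_rightDesc.{v, u})

variable {W A} in
theorem right_hom_ext {f g : (∐ A) ⊗ W ⟶ Z}
    (h : ∀ c, Sigma.ι A c ▷ W ≫ f = Sigma.ι A c ▷ W ≫ g) : f = g := by
  rw [← cancel_epi (β_ W (∐ A)).hom]
  apply left_hom_ext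
  intro c
  simp [h]

end

end Sigma

/-- A `V`-enriched quiver with vertex set `S`. -/
structure Quiv (V : Type u) (S : Type v) where
  /-- the object of edges from one vertex to another one -/
  obj : S → S → V

namespace Quiv

variable {V : Type u} [Category.{v} V] {S : Type v}

/-- A morphism of quivers with the same vertex set. -/
@[ext]
structure Hom (Q P : Quiv.{v} V S) where
  /-- the components -/
  app : ∀ a b, Q.obj a b ⟶ P.obj a b

instance : Category.{v} (Quiv.{v} V S) where
  Hom := Hom
  id _ := ⟨fun _ _ => 𝟙 _⟩
  comp f g := ⟨fun a b => f.app a b ≫ g.app a b⟩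

@[ext]
theorem hom_ext {Q P : Quiv.{v} V S} {f g : Q ⟶ P} (h : ∀ a b, f.app a b = g.app a b) : f = g :=
  Hom.ext (funext fun a => funext fun b => h a b)

@[simp] theorem id_app (Q : Quiv.{v} V S) (a b : S) : (𝟙 Q : Q ⟶ Q).app a b = 𝟙 _ := rfl

@[simp]
theorem comp_app {Q P R : Quiv.{v} V S} (f : Q ⟶ P) (g : P ⟶ R) (a b : S) :
    (f ≫ g).app a b = f.app a b ≫ g.app a b := rfl

@[simp]
theorem comp_app_assoc : type_of% (reassoc_of% @comp_app.{v, u}) :=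
  @(reassoc_of% @comp_app.{v, u})

/-- Isomorphisms of quivers are given by components. -/
@[simps]
def isoMk {Q P : Quiv.{v} V S} (e : ∀ a b, Q.obj a b ≅ P.obj a b) : Q ≅ P where
  hom := ⟨fun a b => (e a b).hom⟩
  inv := ⟨fun a b => (e a b).inv⟩

variable [MonoidalCategory V] [HasColimits V]

/-- The tensor product `(Q ⊗ P)(a, b) = ∐ c, Q(a, c) ⊗ P(c, b)`. -/
noncomputable def tensor (Q P : Quiv.{v} V S) : Quiv.{v} V S :=
  ⟨fun a b => ∐ fun c => Q.obj a c ⊗ P.obj c b⟩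

/-- The unit quiver: `I_S(a, b)` is the coproduct of copies of `I` indexed by the proofs of
`a = b`, that is, `I` if `a = b` and the initial object otherwise. -/
noncomputable def unit (V : Type u) [Category.{v} V] [MonoidalCategory V] [HasColimits V]
    (S : Type v) : Quiv.{v} V S :=
  ⟨fun a b => ∐ fun _ : ULift.{v} (PLift (a = b)) => 𝟙_ V⟩

/-- The summand inclusions of the tensor product. -/
noncomputable def inc (Q P : Quiv.{v} V S) (a c b : S) :
    Q.obj a c ⊗ P.obj c b ⟶ (tensor Q P).obj a b :=
  Sigma.ι (fun c => Q.obj a c ⊗ P.obj c b) c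

/-- Morphisms out of the tensor product. -/
noncomputable def tensorDesc {Q P : Quiv.{v} V S} {a b : S} {Z : V}
    (k : ∀ c, Q.obj a c ⊗ P.obj c b ⟶ Z) : (tensor Q P).obj a b ⟶ Z :=
  Sigma.desc k

@[simp]
theorem inc_tensorDesc {Q P : Quiv.{v} V S} {a b : S} {Z : V}
    (k : ∀ c, Q.obj a c ⊗ P.obj c b ⟶ Z) (c : S) :
    inc Q P a c b ≫ tensorDesc k = k c := by
  exact Sigma.ι_desc _ _

@[simp]
theorem inc_tensorDesc_assoc : type_of% (reassoc_of% @inc_tensorDesc.{v, u}) :=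
  @(reassoc_of% @inc_tensorDesc.{v, u})

theorem tensor_ext {Q P : Quiv.{v} V S} {a b : S} {Z : V} {f g : (tensor Q P).obj a b ⟶ Z}
    (h : ∀ c, inc Q P a c b ≫ f = inc Q P a c b ≫ g) : f = g :=
  Sigma.hom_ext _ _ h

/-- The summand inclusion `I ⟶ I_S(a, b)` for `a = b`. -/
noncomputable def unitInc (V : Type u) [Category.{v} V] [MonoidalCategory V] [HasColimits V]
    {S : Type v} {a b : S} (h : a = b) : 𝟙_ V ⟶ (unit V S).obj a b :=
  Sigma.ι (fun _ : ULift.{v} (PLift (a = b)) => 𝟙_ V) ⟨⟨h⟩⟩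

/-- Morphisms out of the unit quiver. -/
noncomputable def unitDesc {a b : S} {Z : V} (k : a = b → (𝟙_ V ⟶ Z)) :
    (unit V S).obj a b ⟶ Z :=
  Sigma.desc fun h => k h.down.down

@[simp]
theorem unitInc_unitDesc {a b : S} {Z : V} (k : a = b → (𝟙_ V ⟶ Z)) (h : a = b) :
    unitInc V h ≫ unitDesc k = k h := by
  exact Sigma.ι_desc _ _

@[simp]
theorem unitInc_unitDesc_assoc : type_of% (reassoc_of% @unitInc_unitDesc.{v, u}) :=
  @(reassoc_of% @unitInc_unitDesc.{v, u})

theorem unit_ext {a b : S} {Z : V} {f g : (unit V S).obj a b ⟶ Z}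
    (w : ∀ h : a = b, unitInc V h ≫ f = unitInc V h ≫ g) : f = g :=
  Sigma.hom_ext _ _ fun h => w h.down.down

/-- The tensor product of morphisms of quivers. -/
noncomputable def tensorMap {Q Q' P P' : Quiv.{v} V S} (f : Q ⟶ Q') (g : P ⟶ P') :
    tensor Q P ⟶ tensor Q' P' :=
  ⟨fun a b => tensorDesc fun c => (f.app a c ⊗ₘ g.app c b) ≫ inc Q' P' a c b⟩

@[simp]
theorem inc_tensorMap {Q Q' P P' : Quiv.{v} V S} (f : Q ⟶ Q') (g : P ⟶ P') (a c b : S) :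
    inc Q P a c b ≫ (tensorMap f g).app a b = (f.app a c ⊗ₘ g.app c b) ≫ inc Q' P' a c b := by
  simp [tensorMap]

@[simp]
theorem inc_tensorMap_assoc : type_of% (reassoc_of% @inc_tensorMap.{v, u}) :=
  @(reassoc_of% @inc_tensorMap.{v, u})

variable [MonoidalClosed V]

/-- Morphisms out of `W ⊗ (Q ⊗ P)(a, b)`. -/
noncomputable def leftTensorDesc {W : V} {Q P : Quiv.{v} V S} {a b : S} {Z : V}
    (k : ∀ c, W ⊗ (Q.obj a c ⊗ P.obj c b) ⟶ Z) : W ⊗ (tensor Q P).obj a b ⟶ Z :=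
  leftDesc W _ k

@[simp]
theorem inc_leftTensorDesc {W : V} {Q P : Quiv.{v} V S} {a b : S} {Z : V}
    (k : ∀ c, W ⊗ (Q.obj a c ⊗ P.obj c b) ⟶ Z) (c : S) :
    W ◁ inc Q P a c b ≫ leftTensorDesc k = k c :=
  ι_leftDesc _ _ _ _

@[simp]
theorem inc_leftTensorDesc_assoc : type_of% (reassoc_of% @inc_leftTensorDesc.{v, u}) :=
  @(reassoc_of% @inc_leftTensorDesc.{v, u})

theorem left_tensor_ext {W : V} {Q P : Quiv.{v} V S} {a b : S} {Z : V}
    {f g : W ⊗ (tensor Q P).obj a b ⟶ Z}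
    (h : ∀ c, W ◁ inc Q P a c b ≫ f = W ◁ inc Q P a c b ≫ g) : f = g :=
  left_hom_ext h

/-- Morphisms out of `W ⊗ I_S(a, b)`. -/
noncomputable def leftUnitDesc {W : V} {a b : S} {Z : V}
    (k : a = b → (W ⊗ 𝟙_ V ⟶ Z)) : W ⊗ (unit V S).obj a b ⟶ Z :=
  leftDesc W _ fun h => k h.down.down

@[simp]
theorem unitInc_leftUnitDesc {W : V} {a b : S} {Z : V}
    (k : a = b → (W ⊗ 𝟙_ V ⟶ Z)) (h : a = b) :
    W ◁ unitInc V h ≫ leftUnitDesc k = k h :=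
  ι_leftDesc _ _ _ _

@[simp]
theorem unitInc_leftUnitDesc_assoc : type_of% (reassoc_of% @unitInc_leftUnitDesc.{v, u}) :=
  @(reassoc_of% @unitInc_leftUnitDesc.{v, u})

theorem left_unit_ext {W : V} {a b : S} {Z : V} {f g : W ⊗ (unit V S).obj a b ⟶ Z}
    (w : ∀ h : a = b, W ◁ unitInc V h ≫ f = W ◁ unitInc V h ≫ g) : f = g :=
  left_hom_ext fun h => w h.down.down

variable [SymmetricCategory V]

/-- Morphisms out of `(Q ⊗ P)(a, b) ⊗ W`. -/
noncomputable def rightTensorDesc {W : V} {Q P : Quiv.{v} V S} {a b : S} {Z : V}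
    (k : ∀ c, (Q.obj a c ⊗ P.obj c b) ⊗ W ⟶ Z) : (tensor Q P).obj a b ⊗ W ⟶ Z :=
  rightDesc W _ k

@[simp]
theorem inc_rightTensorDesc {W : V} {Q P : Quiv.{v} V S} {a b : S} {Z : V}
    (k : ∀ c, (Q.obj a c ⊗ P.obj c b) ⊗ W ⟶ Z) (c : S) :
    inc Q P a c b ▷ W ≫ rightTensorDesc k = k c :=
  ι_rightDesc _ _ _ _

@[simp]
theorem inc_rightTensorDesc_assoc : type_of% (reassoc_of% @inc_rightTensorDesc.{v, u}) :=
  @(reassoc_of% @inc_rightTensorDesc.{v, u})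

theorem right_tensor_ext {W : V} {Q P : Quiv.{v} V S} {a b : S} {Z : V}
    {f g : (tensor Q P).obj a b ⊗ W ⟶ Z}
    (h : ∀ c, inc Q P a c b ▷ W ≫ f = inc Q P a c b ▷ W ≫ g) : f = g :=
  right_hom_ext h

/-- Morphisms out of `I_S(a, b) ⊗ W`. -/
noncomputable def rightUnitDesc {W : V} {a b : S} {Z : V}
    (k : a = b → (𝟙_ V ⊗ W ⟶ Z)) : (unit V S).obj a b ⊗ W ⟶ Z :=
  rightDesc W _ fun h => k h.down.down

@[simp]
theorem unitInc_rightUnitDesc {W : V} {a b : S} {Z : V}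
    (k : a = b → (𝟙_ V ⊗ W ⟶ Z)) (h : a = b) :
    unitInc V h ▷ W ≫ rightUnitDesc k = k h :=
  ι_rightDesc _ _ _ _

@[simp]
theorem unitInc_rightUnitDesc_assoc : type_of% (reassoc_of% @unitInc_rightUnitDesc.{v, u}) :=
  @(reassoc_of% @unitInc_rightUnitDesc.{v, u})

theorem right_unit_ext {W : V} {a b : S} {Z : V} {f g : (unit V S).obj a b ⊗ W ⟶ Z}
    (w : ∀ h : a = b, unitInc V h ▷ W ≫ f = unitInc V h ▷ W ≫ g) : f = g :=
  right_hom_ext fun h => w h.down.down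

/-- The associator of quivers. -/
noncomputable def assocIso (Q P R : Quiv.{v} V S) :
    tensor (tensor Q P) R ≅ tensor Q (tensor P R) where
  hom := ⟨fun a b => tensorDesc fun c => rightTensorDesc fun d =>
    (α_ _ _ _).hom ≫ Q.obj a d ◁ inc P R d c b ≫ inc Q (tensor P R) a d b⟩
  inv := ⟨fun a b => tensorDesc fun d => leftTensorDesc fun c =>
    (α_ _ _ _).inv ≫ inc Q P a d c ▷ R.obj c b ≫ inc (tensor Q P) R a c b⟩
  hom_inv_id := by
    ext a b
    refine tensor_ext fun c => right_tensor_ext fun d => ?_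
    simp
  inv_hom_id := by
    ext a b
    refine tensor_ext fun c => left_tensor_ext fun d => ?_
    simp

@[simp]
theorem inc_assocIso (Q P R : Quiv.{v} V S) (a d c b : S) :
    inc Q P a d c ▷ R.obj c b ≫ inc (tensor Q P) R a c b ≫ (assocIso Q P R).hom.app a b =
      (α_ _ _ _).hom ≫ Q.obj a d ◁ inc P R d c b ≫ inc Q (tensor P R) a d b := by
  simp [assocIso]

@[simp]
theorem inc_assocIso_assoc : type_of% (reassoc_of% @inc_assocIso.{v, u}) :=
  @(reassoc_of% @inc_assocIso.{v, u})

/-- The left unitor of quivers. -/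
noncomputable def leftIso (Q : Quiv.{v} V S) : tensor (unit V S) Q ≅ Q where
  hom := ⟨fun a b => tensorDesc fun _ => rightUnitDesc fun h =>
    (λ_ _).hom ≫ eqToHom (by rw [h])⟩
  inv := ⟨fun a b => (λ_ _).inv ≫ unitInc V rfl ▷ Q.obj a b ≫ inc (unit V S) Q a a b⟩
  hom_inv_id := by
    ext a b
    refine tensor_ext fun c => right_unit_ext fun h => ?_
    subst h
    simp
  inv_hom_id := by
    ext a b
    simp

@[simp]
theorem inc_leftIso (Q : Quiv.{v} V S) (a b : S) :
    unitInc V rfl ▷ Q.obj a b ≫ inc (unit V S) Q a a b ≫ (leftIso Q).hom.app a b =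
      (λ_ _).hom := by
  simp [leftIso]

@[simp]
theorem inc_leftIso_assoc : type_of% (reassoc_of% @inc_leftIso.{v, u}) :=
  @(reassoc_of% @inc_leftIso.{v, u})

/-- The right unitor of quivers. -/
noncomputable def rightIso (Q : Quiv.{v} V S) : tensor Q (unit V S) ≅ Q where
  hom := ⟨fun a b => tensorDesc fun _ => leftUnitDesc fun h =>
    (ρ_ _).hom ≫ eqToHom (by rw [h])⟩
  inv := ⟨fun a b => (ρ_ _).inv ≫ Q.obj a b ◁ unitInc V rfl ≫ inc Q (unit V S) a b b⟩
  hom_inv_id := by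
    ext a b
    refine tensor_ext fun c => left_unit_ext fun h => ?_
    subst h
    simp
  inv_hom_id := by
    ext a b
    simp

@[simp]
theorem inc_rightIso (Q : Quiv.{v} V S) (a b : S) :
    Q.obj a b ◁ unitInc V rfl ≫ inc Q (unit V S) a b b ≫ (rightIso Q).hom.app a b =
      (ρ_ _).hom := by
  simp [rightIso]

@[simp]
theorem inc_rightIso_assoc : type_of% (reassoc_of% @inc_rightIso.{v, u}) :=
  @(reassoc_of% @inc_rightIso.{v, u})

@[simp]
theorem inc_whiskerRight_tensorHom {Q Q' P P' : Quiv.{v} V S} (f : Q ⟶ Q') (g : P ⟶ P')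
    (a d c : S) {W W' : V} (h : W ⟶ W') :
    inc Q P a d c ▷ W ≫ ((tensorMap f g).app a c ⊗ₘ h) =
      ((f.app a d ⊗ₘ g.app d c) ⊗ₘ h) ≫ inc Q' P' a d c ▷ W' := by
  rw [← tensorHom_id, ← tensorHom_id, tensorHom_comp_tensorHom, tensorHom_comp_tensorHom]
  simp

@[simp]
theorem inc_whiskerRight_tensorHom_assoc : type_of% (reassoc_of% @inc_whiskerRight_tensorHom.{v, u}) :=
  @(reassoc_of% @inc_whiskerRight_tensorHom.{v, u})

@[simp]
theorem inc_whiskerLeft_tensorHom {Q Q' P P' : Quiv.{v} V S} (f : Q ⟶ Q') (g : P ⟶ P')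
    (a d c : S) {W W' : V} (h : W ⟶ W') :
    W ◁ inc Q P a d c ≫ (h ⊗ₘ (tensorMap f g).app a c) =
      (h ⊗ₘ (f.app a d ⊗ₘ g.app d c)) ≫ W' ◁ inc Q' P' a d c := by
  rw [← id_tensorHom, ← id_tensorHom, tensorHom_comp_tensorHom, tensorHom_comp_tensorHom]
  simp

@[simp]
theorem inc_whiskerLeft_tensorHom_assoc : type_of% (reassoc_of% @inc_whiskerLeft_tensorHom.{v, u}) :=
  @(reassoc_of% @inc_whiskerLeft_tensorHom.{v, u})

theorem assocIso_natural {Q Q' P P' R R' : Quiv.{v} V S} (f : Q ⟶ Q') (g : P ⟶ P')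
    (h : R ⟶ R') : tensorMap (tensorMap f g) h ≫ (assocIso Q' P' R').hom =
      (assocIso Q P R).hom ≫ tensorMap f (tensorMap g h) := by
  ext a b
  refine tensor_ext fun c => right_tensor_ext fun d => ?_
  simp

theorem leftIso_natural {Q P : Quiv.{v} V S} (f : Q ⟶ P) :
    tensorMap (𝟙 (unit V S)) f ≫ (leftIso P).hom = (leftIso Q).hom ≫ f := by
  ext a b
  refine tensor_ext fun c => right_unit_ext fun h => ?_
  subst h
  simp [← whisker_exchange_assoc]

theorem rightIso_natural {Q P : Quiv.{v} V S} (f : Q ⟶ P) :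
    tensorMap f (𝟙 (unit V S)) ≫ (rightIso P).hom = (rightIso Q).hom ≫ f := by
  ext a b
  refine tensor_ext fun c => left_unit_ext fun h => ?_
  subst h
  simp [whisker_exchange_assoc]

theorem tensorMap_id (Q P : Quiv.{v} V S) : tensorMap (𝟙 Q) (𝟙 P) = 𝟙 (tensor Q P) := by
  ext a b
  exact tensor_ext fun c => by simp

theorem tensorMap_comp {Q Q' Q'' P P' P'' : Quiv.{v} V S} (f : Q ⟶ Q') (g : P ⟶ P')
    (f' : Q' ⟶ Q'') (g' : P' ⟶ P'') :
    tensorMap f g ≫ tensorMap f' g' = tensorMap (f ≫ f') (g ≫ g') := by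
  ext a b
  exact tensor_ext fun c => by simp

theorem right_right_tensor_ext {W W' : V} {Q P : Quiv.{v} V S} {a b : S} {Z : V}
    {f g : ((tensor Q P).obj a b ⊗ W) ⊗ W' ⟶ Z}
    (h : ∀ c, inc Q P a c b ▷ W ▷ W' ≫ f = inc Q P a c b ▷ W ▷ W' ≫ g) : f = g := by
  rw [← cancel_epi (α_ _ _ _).inv]
  refine right_tensor_ext fun c => ?_
  simp [h]

theorem inc_assocIso_whiskerRight (Q P R : Quiv.{v} V S) (a d c b : S) (W : V) {Z : V}
    (k : (tensor Q (tensor P R)).obj a b ⊗ W ⟶ Z) :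
    inc Q P a d c ▷ R.obj c b ▷ W ≫ inc (tensor Q P) R a c b ▷ W ≫
      (assocIso Q P R).hom.app a b ▷ W ≫ k =
      (α_ _ _ _).hom ▷ W ≫ (Q.obj a d ◁ inc P R d c b) ▷ W ≫
        inc Q (tensor P R) a d b ▷ W ≫ k := by
  simp only [← comp_whiskerRight_assoc]
  simp

theorem inc_assocIso_whiskerLeft (Q P R : Quiv.{v} V S) (a d c b : S) (W : V) {Z : V}
    (k : W ⊗ (tensor Q (tensor P R)).obj a b ⟶ Z) :
    W ◁ inc Q P a d c ▷ R.obj c b ≫ W ◁ inc (tensor Q P) R a c b ≫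
      W ◁ (assocIso Q P R).hom.app a b ≫ k =
      W ◁ (α_ _ _ _).hom ≫ W ◁ Q.obj a d ◁ inc P R d c b ≫
        W ◁ inc Q (tensor P R) a d b ≫ k := by
  simp only [← whiskerLeft_comp_assoc]
  simp

theorem pentagon (Q P R U : Quiv.{v} V S) :
    tensorMap (assocIso Q P R).hom (𝟙 U) ≫ (assocIso Q (tensor P R) U).hom ≫
      tensorMap (𝟙 Q) (assocIso P R U).hom =
    (assocIso (tensor Q P) R U).hom ≫ (assocIso Q P (tensor R U)).hom := by
  ext a b
  refine tensor_ext fun c => right_tensor_ext fun d => right_right_tensor_ext fun e => ?_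
  simp only [comp_app, inc_tensorMap_assoc, id_app, tensorHom_id, id_tensorHom,
    inc_assocIso_whiskerRight, inc_assocIso_assoc, inc_tensorMap]
  simp only [whisker_assoc, Category.assoc, Iso.inv_hom_id_assoc, inc_assocIso_whiskerLeft]
  rw [associator_naturality_left_assoc, ← whisker_exchange_assoc, inc_assocIso]
  simp

theorem middle_unit_ext {W W' : V} {a b : S} {Z : V} {f g : (W ⊗ (unit V S).obj a b) ⊗ W' ⟶ Z}
    (w : ∀ h : a = b, (W ◁ unitInc V h) ▷ W' ≫ f = (W ◁ unitInc V h) ▷ W' ≫ g) : f = g := by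
  rw [← cancel_epi ((β_ _ _).hom ▷ W'), ← cancel_epi (α_ _ _ _).inv]
  refine right_unit_ext fun h => ?_
  have key : ∀ k : (W ⊗ (unit V S).obj a b) ⊗ W' ⟶ Z,
      unitInc V h ▷ (W ⊗ W') ≫ (α_ _ _ _).inv ≫ (β_ _ _).hom ▷ W' ≫ k =
        (α_ _ _ _).inv ≫ (β_ _ _).hom ▷ W' ≫ (W ◁ unitInc V h) ▷ W' ≫ k := by
    intro k
    rw [associator_inv_naturality_left_assoc, ← comp_whiskerRight_assoc,
      BraidedCategory.braiding_naturality_left, comp_whiskerRight_assoc]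
  rw [key, key, w]

theorem triangle (Q P : Quiv.{v} V S) :
    (assocIso Q (unit V S) P).hom ≫ tensorMap (𝟙 Q) (leftIso P).hom =
      tensorMap (rightIso Q).hom (𝟙 P) := by
  ext a b
  refine tensor_ext fun c => right_tensor_ext fun d => middle_unit_ext fun h => ?_
  subst h
  have h1 : (Q.obj a d ◁ unitInc V rfl) ▷ P.obj d b ≫ inc Q (unit V S) a d d ▷ P.obj d b ≫
      (rightIso Q).hom.app a d ▷ P.obj d b = (ρ_ _).hom ▷ _ := by
    simp only [← comp_whiskerRight]
    simp
  have h2 : Q.obj a d ◁ unitInc V rfl ▷ P.obj d b ≫ Q.obj a d ◁ inc (unit V S) P d d b ≫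
      Q.obj a d ◁ (leftIso P).hom.app d b = _ ◁ (λ_ _).hom := by
    simp only [← whiskerLeft_comp]
    simp
  simp only [comp_app, inc_tensorMap, id_app, tensorHom_id, id_tensorHom, inc_assocIso_assoc,
    whisker_assoc, Category.assoc, Iso.inv_hom_id_assoc]
  rw [reassoc_of% h2]
  rw [whisker_assoc] at h1
  simp only [Category.assoc] at h1
  rw [reassoc_of% h1]
  simp

/-- The monoidal structure `(⊗_S, I_S)` on quivers with vertex set `S`. -/
noncomputable instance : MonoidalCategory (Quiv.{v} V S) where
  tensorObj := tensor
  tensorHom := tensorMap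
  whiskerLeft Q _ _ f := tensorMap (𝟙 Q) f
  whiskerRight f P := tensorMap f (𝟙 P)
  tensorUnit := unit V S
  associator := assocIso
  leftUnitor := leftIso
  rightUnitor := rightIso
  tensorHom_def f g := by rw [tensorMap_comp, Category.id_comp, Category.comp_id]
  id_tensorHom_id := tensorMap_id
  tensorHom_comp_tensorHom f g f' g' := tensorMap_comp _ _ _ _
  whiskerLeft_id := tensorMap_id
  id_whiskerRight := tensorMap_id
  associator_naturality := assocIso_natural
  leftUnitor_naturality := leftIso_natural
  rightUnitor_naturality := rightIso_natural
  pentagon := pentagon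
  triangle := triangle

end Quiv

section

open Functor.OplaxMonoidal Functor.LaxMonoidal

namespace Quiv

variable {V : Type u} [Category.{v} V] [MonoidalCategory V] [HasColimits V]
  [MonoidalClosed V] [SymmetricCategory V] {S T : Type v}

theorem tensorHom_eq {Q Q' P P' : Quiv.{v} V S} (f : Q ⟶ Q') (g : P ⟶ P') :
    (f ⊗ₘ g) = tensorMap f g := rfl

theorem whiskerLeft_eq (Q : Quiv.{v} V S) {P P' : Quiv.{v} V S} (g : P ⟶ P') :
    Q ◁ g = tensorMap (𝟙 Q) g := rfl

theorem whiskerRight_eq {Q Q' : Quiv.{v} V S} (f : Q ⟶ Q') (P : Quiv.{v} V S) :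
    f ▷ P = tensorMap f (𝟙 P) := rfl

theorem associator_eq (Q P R : Quiv.{v} V S) : α_ Q P R = assocIso Q P R := rfl

theorem leftUnitor_eq (Q : Quiv.{v} V S) : λ_ Q = leftIso Q := rfl

theorem rightUnitor_eq (Q : Quiv.{v} V S) : ρ_ Q = rightIso Q := rfl

theorem leftIso_inv_app (Q : Quiv.{v} V S) (a b : S) : (leftIso Q).inv.app a b =
    (λ_ _).inv ≫ unitInc V rfl ▷ Q.obj a b ≫ inc (unit V S) Q a a b := rfl

theorem rightIso_inv_app (Q : Quiv.{v} V S) (a b : S) : (rightIso Q).inv.app a b =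
    (ρ_ _).inv ≫ Q.obj a b ◁ unitInc V rfl ≫ inc Q (unit V S) a b b := rfl

/-- The functor `f^*`, with `f^*(Q)(a, b) = Q(f a, f b)`. -/
@[simps]
def pullback (f : S → T) : Quiv.{v} V T ⥤ Quiv.{v} V S where
  obj Q := ⟨fun a b => Q.obj (f a) (f b)⟩
  map g := ⟨fun a b => g.app (f a) (f b)⟩

/-- The unit map of `f^*`. -/
noncomputable def pullbackε (f : S → T) : unit V S ⟶ (pullback f).obj (unit V T) :=
  ⟨fun _ _ => unitDesc fun h => unitInc V (congrArg f h)⟩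

/-- The tensor map of `f^*`. -/
noncomputable def pullbackμ (f : S → T) (Q P : Quiv.{v} V T) :
    tensor ((pullback f).obj Q) ((pullback f).obj P) ⟶ (pullback f).obj (tensor Q P) :=
  ⟨fun a b => tensorDesc fun c => inc Q P (f a) (f c) (f b)⟩

@[simp]
theorem unitInc_pullbackε (f : S → T) {a b : S} (h : a = b) :
    unitInc V h ≫ (pullbackε f).app a b = unitInc V (congrArg f h) := by
  exact unitInc_unitDesc (Z := (unit V T).obj (f a) (f b)) (fun h => unitInc V (congrArg f h)) h

@[simp]
theorem unitInc_pullbackε_assoc : type_of% (reassoc_of% @unitInc_pullbackε.{v, u}) :=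
  @(reassoc_of% @unitInc_pullbackε.{v, u})

@[simp]
theorem inc_pullbackμ (f : S → T) (Q P : Quiv.{v} V T) (a c b : S) :
    inc ((pullback f).obj Q) ((pullback f).obj P) a c b ≫ (pullbackμ f Q P).app a b =
      inc Q P (f a) (f c) (f b) :=
  inc_tensorDesc _ _

@[simp]
theorem inc_pullbackμ_assoc : type_of% (reassoc_of% @inc_pullbackμ.{v, u}) :=
  @(reassoc_of% @inc_pullbackμ.{v, u})

/-- The lax monoidal structure of `f^*`. -/
noncomputable instance (f : S → T) : (pullback (V := V) f).LaxMonoidal where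
  ε := pullbackε f
  μ := pullbackμ f
  μ_natural_left {Q Q'} g P := by
    ext a b
    refine tensor_ext fun c => ?_
    erw [inc_tensorMap_assoc, inc_pullbackμ, inc_pullbackμ_assoc, inc_tensorMap]
    rfl
  μ_natural_right {Q Q'} P g := by
    ext a b
    refine tensor_ext fun c => ?_
    erw [inc_tensorMap_assoc, inc_pullbackμ, inc_pullbackμ_assoc, inc_tensorMap]
    rfl
  associativity Q P R := by
    ext a b
    refine tensor_ext fun c => right_tensor_ext fun d => ?_
    have h1 : inc ((pullback f).obj Q) ((pullback f).obj P) a d c ▷ R.obj (f c) (f b) ≫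
        (pullbackμ f Q P).app a c ▷ R.obj (f c) (f b) =
          inc Q P (f a) (f d) (f c) ▷ R.obj (f c) (f b) := by
      rw [← comp_whiskerRight, inc_pullbackμ]; rfl
    have h2 : Q.obj (f a) (f d) ◁ inc ((pullback f).obj P) ((pullback f).obj R) d c b ≫
        Q.obj (f a) (f d) ◁ (pullbackμ f P R).app d b =
          Q.obj (f a) (f d) ◁ inc P R (f d) (f c) (f b) := by
      rw [← MonoidalCategory.whiskerLeft_comp, inc_pullbackμ]; rfl
    erw [inc_tensorMap_assoc, tensorHom_id, inc_pullbackμ_assoc, reassoc_of% h1,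
      inc_assocIso, inc_assocIso_assoc, inc_tensorMap_assoc, inc_pullbackμ, id_tensorHom,
      reassoc_of% h2]
    rfl
  left_unitality Q := by
    ext a b
    refine tensor_ext fun c => right_unit_ext fun h => ?_
    subst h
    have h1 : unitInc V rfl ▷ Q.obj (f a) (f b) ≫ (pullbackε f).app a a ▷ Q.obj (f a) (f b) =
        unitInc V rfl ▷ Q.obj (f a) (f b) := by
      rw [← comp_whiskerRight, unitInc_pullbackε]; rfl
    erw [inc_leftIso, inc_tensorMap_assoc, tensorHom_id, inc_pullbackμ_assoc, reassoc_of% h1,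
      inc_leftIso]
    rfl
  right_unitality Q := by
    ext a b
    refine tensor_ext fun c => left_unit_ext fun h => ?_
    subst h
    have h1 : Q.obj (f a) (f c) ◁ unitInc V rfl ≫ Q.obj (f a) (f c) ◁ (pullbackε f).app c c =
        Q.obj (f a) (f c) ◁ unitInc V rfl := by
      rw [← MonoidalCategory.whiskerLeft_comp, unitInc_pullbackε]; rfl
    erw [inc_rightIso, inc_tensorMap_assoc, id_tensorHom, inc_pullbackμ_assoc, reassoc_of% h1,
      inc_rightIso]
    rfl

/-- The functor `(t_S)_!` to the base category: the coproduct of all the components. -/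
noncomputable def total (V : Type u) [Category.{v} V] [HasColimits V]
    (S : Type v) : Quiv.{v} V S ⥤ V where
  obj Q := ∐ fun p : S × S => Q.obj p.1 p.2
  map {Q P} f := Limits.Sigma.map (f := fun p : S × S => Q.obj p.1 p.2)
    (g := fun p : S × S => P.obj p.1 p.2) fun p => f.app p.1 p.2

/-- The summand inclusions of the total coproduct. -/
noncomputable def totalInc (Q : Quiv.{v} V S) (a b : S) : Q.obj a b ⟶ (total V S).obj Q :=
  Sigma.ι (fun p : S × S => Q.obj p.1 p.2) (a, b)

theorem total_ext {Q : Quiv.{v} V S} {Z : V} {f g : (total V S).obj Q ⟶ Z}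
    (h : ∀ a b, totalInc Q a b ≫ f = totalInc Q a b ≫ g) : f = g :=
  Sigma.hom_ext _ _ fun p => h p.1 p.2

/-- Morphisms out of the total coproduct. -/
noncomputable def totalDesc {Q : Quiv.{v} V S} {Z : V} (k : ∀ a b, Q.obj a b ⟶ Z) :
    (total V S).obj Q ⟶ Z :=
  Limits.Sigma.desc fun p => k p.1 p.2

@[simp]
theorem totalInc_totalDesc {Q : Quiv.{v} V S} {Z : V} (k : ∀ a b, Q.obj a b ⟶ Z) (a b : S) :
    totalInc Q a b ≫ totalDesc k = k a b :=
  Sigma.ι_desc _ _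

@[simp]
theorem totalInc_totalDesc_assoc : type_of% (reassoc_of% @totalInc_totalDesc.{v, u}) :=
  @(reassoc_of% @totalInc_totalDesc.{v, u})

@[simp]
theorem totalInc_map {Q P : Quiv.{v} V S} (f : Q ⟶ P) (a b : S) :
    totalInc Q a b ≫ (total V S).map f = f.app a b ≫ totalInc P a b := by
  simp [totalInc, total]

@[simp]
theorem totalInc_map_assoc : type_of% (reassoc_of% @totalInc_map.{v, u}) :=
  @(reassoc_of% @totalInc_map.{v, u})

/-- The counit of the total coproduct functor. -/
noncomputable def totalη (V : Type u) [Category.{v} V] [MonoidalCategory V] [HasColimits V]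
    (S : Type v) : (total V S).obj (unit V S) ⟶ 𝟙_ V :=
  totalDesc fun _ _ => unitDesc fun _ => 𝟙 _

/-- The comultiplication of the total coproduct functor. -/
noncomputable def totalδ (Q P : Quiv.{v} V S) :
    (total V S).obj (tensor Q P) ⟶ (total V S).obj Q ⊗ (total V S).obj P :=
  totalDesc fun a b => tensorDesc fun c => totalInc Q a c ⊗ₘ totalInc P c b

@[simp]
theorem unitInc_totalInc_totalη {a b : S} (h : a = b) :
    unitInc V h ≫ totalInc (unit V S) a b ≫ totalη V S = 𝟙 _ := by
  simp [totalη]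

@[simp]
theorem unitInc_totalInc_totalη_assoc : type_of% (reassoc_of% @unitInc_totalInc_totalη.{v, u}) :=
  @(reassoc_of% @unitInc_totalInc_totalη.{v, u})

@[simp]
theorem inc_totalInc_totalδ (Q P : Quiv.{v} V S) (a c b : S) :
    inc Q P a c b ≫ totalInc (tensor Q P) a b ≫ totalδ Q P =
      totalInc Q a c ⊗ₘ totalInc P c b := by
  simp [totalδ]

@[simp]
theorem inc_totalInc_totalδ_assoc : type_of% (reassoc_of% @inc_totalInc_totalδ.{v, u}) :=
  @(reassoc_of% @inc_totalInc_totalδ.{v, u})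

/-- The colax monoidal structure of the total coproduct functor. -/
noncomputable instance : (total V S).OplaxMonoidal where
  η := totalη V S
  δ := totalδ
  δ_natural_left {Q Q'} f P := by
    refine total_ext fun a b => tensor_ext fun c => ?_
    rw [whiskerRight_eq, totalInc_map_assoc, inc_tensorMap_assoc]
    erw [inc_totalInc_totalδ, inc_totalInc_totalδ_assoc]
    simp [← tensorHom_id]
  δ_natural_right {P P'} Q f := by
    refine total_ext fun a b => tensor_ext fun c => ?_
    rw [whiskerLeft_eq, totalInc_map_assoc, inc_tensorMap_assoc]
    erw [inc_totalInc_totalδ, inc_totalInc_totalδ_assoc]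
    simp [← id_tensorHom]
  oplax_associativity Q P R := by
    refine total_ext fun a b => tensor_ext fun c => right_tensor_ext fun d => ?_
    have h1 : inc Q P a d c ▷ R.obj c b ≫ (totalInc (tensor Q P) a c ⊗ₘ totalInc R c b) ≫
        totalδ Q P ▷ _ = (totalInc Q a d ⊗ₘ totalInc P d c) ⊗ₘ totalInc R c b := by
      rw [← tensorHom_id, ← tensorHom_id, tensorHom_comp_tensorHom, tensorHom_comp_tensorHom]
      simp
    have h2 : Q.obj a d ◁ inc P R d c b ≫ (totalInc Q a d ⊗ₘ totalInc (tensor P R) d b) ≫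
        _ ◁ totalδ P R = totalInc Q a d ⊗ₘ (totalInc P d c ⊗ₘ totalInc R c b) := by
      rw [← id_tensorHom, ← id_tensorHom, tensorHom_comp_tensorHom, tensorHom_comp_tensorHom]
      simp
    rw [associator_eq, totalInc_map_assoc]
    erw [inc_assocIso_assoc, inc_totalInc_totalδ_assoc, inc_totalInc_totalδ_assoc, reassoc_of% h1, h2]
    simp
  oplax_left_unitality Q := by
    refine total_ext fun a b => ?_
    have h1 : unitInc V rfl ▷ Q.obj a b ≫ (totalInc (unit V S) a a ⊗ₘ totalInc Q a b) ≫
        totalη V S ▷ _ = 𝟙_ V ◁ totalInc Q a b := by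
      rw [← tensorHom_id, ← tensorHom_id, tensorHom_comp_tensorHom, tensorHom_comp_tensorHom]
      simp
    rw [leftUnitor_eq, totalInc_map_assoc, leftIso_inv_app, Category.assoc, Category.assoc]
    erw [inc_totalInc_totalδ_assoc, h1]
    exact leftUnitor_inv_naturality _
  oplax_right_unitality Q := by
    refine total_ext fun a b => ?_
    have h1 : Q.obj a b ◁ unitInc V rfl ≫ (totalInc Q a b ⊗ₘ totalInc (unit V S) b b) ≫
        _ ◁ totalη V S = totalInc Q a b ▷ 𝟙_ V := by
      rw [← id_tensorHom, ← id_tensorHom, tensorHom_comp_tensorHom, tensorHom_comp_tensorHom]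
      simp
    rw [rightUnitor_eq, totalInc_map_assoc, rightIso_inv_app, Category.assoc, Category.assoc]
    erw [inc_totalInc_totalδ_assoc, h1]
    exact rightUnitor_inv_naturality _

/-- The pairs of vertices lying above a given pair of vertices. -/
abbrev Fib (f : S → T) (x y : T) : Type v := {p : S × S // f p.1 = x ∧ f p.2 = y}

/-- The functor `f_!`, with `f_!(Q)(x, y)` the coproduct of `Q(a, b)` over all `a`, `b` with
`f a = x` and `f b = y`. -/
noncomputable def pushforward (f : S → T) : Quiv.{v} V S ⥤ Quiv.{v} V T where
  obj Q := ⟨fun x y => ∐ fun p : Fib f x y => Q.obj p.1.1 p.1.2⟩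
  map {Q P} g := ⟨fun x y => Limits.Sigma.map (f := fun p : Fib f x y => Q.obj p.1.1 p.1.2)
    (g := fun p : Fib f x y => P.obj p.1.1 p.1.2) fun p => g.app p.1.1 p.1.2⟩

/-- The summand inclusions of `f_!(Q)`. -/
noncomputable def pushInc (f : S → T) (Q : Quiv.{v} V S) (a b : S) :
    Q.obj a b ⟶ ((pushforward f).obj Q).obj (f a) (f b) :=
  Sigma.ι (fun p : Fib f (f a) (f b) => Q.obj p.1.1 p.1.2) ⟨(a, b), rfl, rfl⟩

/-- Morphisms out of `f_!(Q)`. -/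
noncomputable def pushDesc {f : S → T} {Q : Quiv.{v} V S} {P : Quiv.{v} V T}
    (k : ∀ a b, Q.obj a b ⟶ P.obj (f a) (f b)) : (pushforward f).obj Q ⟶ P :=
  ⟨fun x y => Limits.Sigma.desc fun p : Fib f x y => k p.1.1 p.1.2 ≫
    eqToHom (congrArg₂ P.obj p.2.1 p.2.2)⟩

@[simp]
theorem pushInc_pushDesc {f : S → T} {Q : Quiv.{v} V S} {P : Quiv.{v} V T}
    (k : ∀ a b, Q.obj a b ⟶ P.obj (f a) (f b)) (a b : S) :
    pushInc f Q a b ≫ (pushDesc k).app (f a) (f b) = k a b := by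
  refine (Sigma.ι_desc _ _).trans ?_
  simp

@[simp]
theorem pushInc_pushDesc_assoc : type_of% (reassoc_of% @pushInc_pushDesc.{v, u}) :=
  @(reassoc_of% @pushInc_pushDesc.{v, u})

@[simp]
theorem pushInc_map {f : S → T} {Q P : Quiv.{v} V S} (g : Q ⟶ P) (a b : S) :
    pushInc f Q a b ≫ ((pushforward f).map g).app (f a) (f b) = g.app a b ≫ pushInc f P a b :=
  Sigma.ι_map (f := fun p : Fib f (f a) (f b) => Q.obj p.1.1 p.1.2)
    (g := fun p : Fib f (f a) (f b) => P.obj p.1.1 p.1.2) (fun p => g.app p.1.1 p.1.2)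
    ⟨(a, b), rfl, rfl⟩

@[simp]
theorem pushInc_map_assoc : type_of% (reassoc_of% @pushInc_map.{v, u}) :=
  @(reassoc_of% @pushInc_map.{v, u})

theorem push_ext {f : S → T} {Q : Quiv.{v} V S} {P : Quiv.{v} V T}
    {g h : (pushforward f).obj Q ⟶ P}
    (w : ∀ a b, pushInc f Q a b ≫ g.app (f a) (f b) = pushInc f Q a b ≫ h.app (f a) (f b)) :
    g = h := by
  ext x y
  refine Sigma.hom_ext _ _ ?_
  rintro ⟨⟨a, b⟩, rfl, rfl⟩
  exact w a b

/-- The adjunction between `f_!` and `f^*`. -/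
noncomputable def pushforwardAdj (f : S → T) : pushforward (V := V) f ⊣ pullback f :=
  Adjunction.mkOfHomEquiv
    { homEquiv := fun Q P =>
        { toFun := fun g => ⟨fun a b => pushInc f Q a b ≫ g.app (f a) (f b)⟩
          invFun := fun g => pushDesc g.app
          left_inv := fun g => push_ext fun a b => pushInc_pushDesc _ a b
          right_inv := fun g => hom_ext fun a b => pushInc_pushDesc _ a b }
      homEquiv_naturality_left_symm := fun g h => push_ext fun a b => by
        refine (pushInc_pushDesc _ a b).trans ?_
        rw [comp_app, comp_app, pushInc_map_assoc]
        exact congrArg (g.app a b ≫ ·) (pushInc_pushDesc (f := f) h.app a b).symm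
      homEquiv_naturality_right := fun g h => hom_ext fun a b => (Category.assoc _ _ _).symm }

/-- The colax monoidal structure of `f_!` induced by the lax monoidal structure of its right
adjoint `f^*`. -/
noncomputable instance (f : S → T) : (pushforward (V := V) f).OplaxMonoidal :=
  (pushforwardAdj f).leftAdjointOplaxMonoidal

end Quiv

section Colax

variable (C : Type u₁) [Category.{v₁} C] [MonoidalCategory C]
  (D : Type u₂) [Category.{v₂} D] [MonoidalCategory D]

/-- A colax monoidal functor: a functor `F` with a counit `η : F I ⟶ I` and comultiplication maps
`δ : F (X ⊗ Y) ⟶ F X ⊗ F Y` which are natural, coassociative and counital. -/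
structure ColaxFunctor extends C ⥤ D where
  [oplax : toFunctor.OplaxMonoidal]

attribute [instance] ColaxFunctor.oplax

namespace ColaxFunctor

variable {C D}

/-- A monoidal natural transformation between colax monoidal functors. -/
@[ext]
structure Hom (F G : ColaxFunctor C D) where
  /-- the underlying natural transformation -/
  hom : F.toFunctor ⟶ G.toFunctor
  counit : hom.app (𝟙_ C) ≫ η G.toFunctor = η F.toFunctor
  comul : ∀ X Y : C, hom.app (X ⊗ Y) ≫ δ G.toFunctor X Y =
    δ F.toFunctor X Y ≫ (hom.app X ⊗ₘ hom.app Y)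

instance : Category (ColaxFunctor C D) where
  Hom := Hom
  id F := ⟨𝟙 _, by simp, by simp⟩
  comp f g := ⟨f.hom ≫ g.hom, by simp [f.counit, g.counit], fun X Y => by
    rw [NatTrans.comp_app, Category.assoc, g.comul, reassoc_of% (f.comul X Y)]
    simp⟩

@[ext]
theorem hom_ext {F G : ColaxFunctor C D} {f g : F ⟶ G} (h : f.hom = g.hom) : f = g :=
  Hom.ext h

@[simp] theorem id_hom (F : ColaxFunctor C D) : (𝟙 F : F ⟶ F).hom = 𝟙 F.toFunctor := rfl

@[simp]
theorem comp_hom {F G H : ColaxFunctor C D} (f : F ⟶ G) (g : G ⟶ H) :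
    (f ≫ g).hom = f.hom ≫ g.hom := rfl

@[simp]
theorem comp_hom_assoc : type_of% (reassoc_of% @comp_hom.{v₁, v₂, u₁, u₂}) :=
  @(reassoc_of% @comp_hom.{v₁, v₂, u₁, u₂})

/-- The functor `X ↦ X_0` from colax monoidal functors to comonoids: the comonoid structure on
the value `X_0` at the unit object is given by the comultiplication and counit of `X`. -/
def vertices : ColaxFunctor C D ⥤ Comon D where
  obj X := X.toFunctor.mapComon.obj (Comon.trivial C)
  map {X Y} α :=
    { hom := α.hom.app (𝟙_ C)
      isComonHom_hom :=
        { hom_counit := by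
            change α.hom.app (𝟙_ C) ≫ Y.map (𝟙 _) ≫ η Y.toFunctor = X.map (𝟙 _) ≫ η X.toFunctor
            simp [α.counit]
          hom_comul := by
            change α.hom.app (𝟙_ C) ≫ Y.map (λ_ (𝟙_ C)).inv ≫ δ Y.toFunctor _ _ =
              (X.map (λ_ (𝟙_ C)).inv ≫ δ X.toFunctor _ _) ≫ (α.hom.app _ ⊗ₘ α.hom.app _)
            rw [Category.assoc, ← α.comul, α.hom.naturality_assoc] } }
  map_id _ := rfl
  map_comp _ _ := rfl

end ColaxFunctor

end Colax

section Free

variable (V : Type u) [Category.{v} V] [MonoidalCategory V] [HasColimits V]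

/-- The comonoid `F(S) = ∐_{a ∈ S} I`, whose comultiplication sends the summand of `a` to the
tensor product of the summand of `a` with itself, and whose counit is the codiagonal. -/
noncomputable def freeComonObj (S : Type v) : Comon V where
  X := ∐ fun _ : S => 𝟙_ V
  comon :=
    { counit := Limits.Sigma.desc fun _ => 𝟙 _
      comul := Limits.Sigma.desc fun a => (λ_ (𝟙_ V)).inv ≫
        (Sigma.ι (fun _ : S => 𝟙_ V) a ⊗ₘ Sigma.ι (fun _ : S => 𝟙_ V) a)
      counit_comul := by
        refine Sigma.hom_ext _ _ fun a => ?_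
        rw [← tensorHom_id, Sigma.ι_desc_assoc, Category.assoc, tensorHom_comp_tensorHom]
        simp
      comul_counit := by
        refine Sigma.hom_ext _ _ fun a => ?_
        rw [← id_tensorHom, Sigma.ι_desc_assoc, Category.assoc, tensorHom_comp_tensorHom]
        simp [unitors_inv_equal]
      comul_assoc := by
        refine Sigma.hom_ext _ _ fun a => ?_
        rw [← id_tensorHom, ← tensorHom_id, Sigma.ι_desc_assoc, Sigma.ι_desc_assoc,
          Category.assoc, Category.assoc, tensorHom_comp_tensorHom,
          tensorHom_comp_tensorHom_assoc, Sigma.ι_desc, Category.comp_id]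
        have e1 : ∀ i : 𝟙_ V ⟶ ∐ fun _ : S => 𝟙_ V, (i ⊗ₘ ((λ_ (𝟙_ V)).inv ≫ (i ⊗ₘ i))) =
            (𝟙_ V ◁ (λ_ (𝟙_ V)).inv) ≫ (i ⊗ₘ (i ⊗ₘ i)) := fun i => by
          rw [← id_tensorHom, tensorHom_comp_tensorHom, Category.id_comp]
        have e2 : ∀ i : 𝟙_ V ⟶ ∐ fun _ : S => 𝟙_ V, (((λ_ (𝟙_ V)).inv ≫ (i ⊗ₘ i)) ⊗ₘ i) =
            ((λ_ (𝟙_ V)).inv ▷ 𝟙_ V) ≫ ((i ⊗ₘ i) ⊗ₘ i) := fun i => by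
          rw [← tensorHom_id, tensorHom_comp_tensorHom, Category.id_comp]
        rw [e1, e2, Category.assoc, associator_naturality]
        simp only [← Category.assoc]
        congr 1
        monoidal_coherence }

variable {V} in
/-- The summand inclusion `I ⟶ F(S)` of an element of `S`. -/
noncomputable def freeInc {S : Type v} (a : S) : 𝟙_ V ⟶ (freeComonObj V S).X :=
  Sigma.ι (fun _ : S => 𝟙_ V) a

variable {V} in
/-- Morphisms out of `F(S)`. -/
noncomputable def freeDesc {S : Type v} {Z : V} (k : S → (𝟙_ V ⟶ Z)) : (freeComonObj V S).X ⟶ Z :=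
  Limits.Sigma.desc k

variable {V}

@[simp]
theorem freeInc_freeDesc {S : Type v} {Z : V} (k : S → (𝟙_ V ⟶ Z)) (a : S) :
    freeInc a ≫ freeDesc k = k a :=
  Sigma.ι_desc _ _

@[simp]
theorem freeInc_freeDesc_assoc : type_of% (reassoc_of% @freeInc_freeDesc.{v, u}) :=
  @(reassoc_of% @freeInc_freeDesc.{v, u})

theorem free_ext {S : Type v} {Z : V} {f g : (freeComonObj V S).X ⟶ Z}
    (h : ∀ a : S, freeInc a ≫ f = freeInc a ≫ g) : f = g :=
  Sigma.hom_ext _ _ h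

@[simp]
theorem freeInc_counit {S : Type v} (a : S) :
    freeInc a ≫ (freeComonObj V S).comon.counit = 𝟙 _ :=
  Sigma.ι_desc _ _

@[simp]
theorem freeInc_counit_assoc : type_of% (reassoc_of% @freeInc_counit.{v, u}) :=
  @(reassoc_of% @freeInc_counit.{v, u})

@[simp]
theorem freeInc_comul {S : Type v} (a : S) : freeInc a ≫ (freeComonObj V S).comon.comul =
    (λ_ (𝟙_ V)).inv ≫ (freeInc a ⊗ₘ freeInc a) :=
  Sigma.ι_desc _ _

@[simp]
theorem freeInc_comul_assoc : type_of% (reassoc_of% @freeInc_comul.{v, u}) :=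
  @(reassoc_of% @freeInc_comul.{v, u})

variable (V)

/-- The functor `F : S ↦ ∐_{a ∈ S} I` from sets to comonoids. -/
noncomputable def freeComon : Type v ⥤ Comon V where
  obj := freeComonObj V
  map {S T} f :=
    { hom := freeDesc fun a => freeInc (f a)
      isComonHom_hom :=
        { hom_counit := free_ext fun a => by simp
          hom_comul := free_ext fun a => by simp } }
  map_id S := by
    apply Comon.Hom.ext
    exact free_ext fun a => by simp
  map_comp f g := by
    apply Comon.Hom.ext
    exact free_ext fun a => by simp

end Free

section Based

variable (V : Type u) [Category.{v} V] [MonoidalCategory V] [HasColimits V]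

/-- The category `Colax_b(Fint^op, V)` of based colax monoidal functors: the 2-pullback of
`X ↦ X_0` and `F`. An object is a colax monoidal functor `X`, a set `S` and an isomorphism of
comonoids `X_0 ≅ F(S)`. -/
abbrev ColaxBased :=
  CategoricalPullback (ColaxFunctor.vertices (C := FinIntᵒᵖ) (D := V)) (freeComon V)

end Based

section QuivColax

variable (V : Type u) [Category.{v} V] [MonoidalCategory V] [HasColimits V]
  [MonoidalClosed V] [SymmetricCategory V]

/-- The objects of the Grothendieck construction of `S ↦ Colax(Fint^op, V-Quiv_S)`, `f ↦ f_!`: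
a set `S` together with a colax monoidal functor from `Fint^op` to quivers with vertex set `S`. -/
structure QuivColax where
  /-- the set of vertices -/
  base : Type v
  /-- the colax monoidal functor -/
  colax : ColaxFunctor FinIntᵒᵖ (Quiv.{v} V base)

namespace QuivColax

variable {V}

/-- The object `X_n(a, b)`. -/
abbrev obj (X : QuivColax.{v} V) (n : FinIntᵒᵖ) (a b : X.base) : V :=
  (X.colax.toFunctor.obj n).obj a b

/-- The counit of `X`. -/
noncomputable abbrev counit (X : QuivColax.{v} V) (a b : X.base) :
    X.obj (𝟙_ FinIntᵒᵖ) a b ⟶ (Quiv.unit V X.base).obj a b :=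
  (η X.colax.toFunctor).app a b

/-- The comultiplication of `X`. -/
noncomputable abbrev comul (X : QuivColax.{v} V) (m n : FinIntᵒᵖ) (a b : X.base) :
    X.obj (m ⊗ n) a b ⟶
      (Quiv.tensor (X.colax.toFunctor.obj m) (X.colax.toFunctor.obj n)).obj a b :=
  (δ X.colax.toFunctor m n).app a b

/-- A morphism `(X, S) ⟶ (Y, T)` in the Grothendieck construction: a map `f : S → T` together
with a monoidal natural transformation `f_! ∘ X ⟶ Y`, given by its transpose `X ⟶ f^* ∘ Y`.
The conditions `counit` and `comul` say that this transpose comes from a monoidal natural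
transformation, see `QuivColax.homEquiv`. -/
structure Hom (X Y : QuivColax.{v} V) where
  /-- the map on vertices -/
  base : X.base → Y.base
  /-- the transposed natural transformation -/
  nat : X.colax.toFunctor ⟶ Y.colax.toFunctor ⋙ Quiv.pullback base
  counit : nat.app (𝟙_ _) ≫ (Quiv.pullback base).map (η Y.colax.toFunctor) =
    η X.colax.toFunctor ≫ ε (Quiv.pullback (V := V) base)
  comul : ∀ m n, nat.app (m ⊗ n) ≫ (Quiv.pullback base).map (δ Y.colax.toFunctor m n) =
    δ X.colax.toFunctor m n ≫ (nat.app m ⊗ₘ nat.app n) ≫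
      μ (Quiv.pullback (V := V) base) (Y.colax.toFunctor.obj m) (Y.colax.toFunctor.obj n)

/-- The component `X_n(a, b) ⟶ Y_n(f a, f b)` of a morphism. -/
abbrev Hom.app {X Y : QuivColax.{v} V} (f : Hom X Y) (n : FinIntᵒᵖ) (a b : X.base) :
    X.obj n a b ⟶ Y.obj n (f.base a) (f.base b) :=
  (f.nat.app n).app a b

theorem Hom.naturality {X Y : QuivColax.{v} V} (f : Hom X Y) {m n : FinIntᵒᵖ} (g : m ⟶ n)
    (a b : X.base) : (X.colax.toFunctor.map g).app a b ≫ f.app n a b =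
      f.app m a b ≫ (Y.colax.toFunctor.map g).app (f.base a) (f.base b) :=
  congrArg (fun h => Quiv.Hom.app h a b) (f.nat.naturality g)

theorem Hom.counit_app {X Y : QuivColax.{v} V} (f : Hom X Y) (a b : X.base) :
    f.app (𝟙_ _) a b ≫ Y.counit (f.base a) (f.base b) =
      X.counit a b ≫ Quiv.unitDesc fun h => Quiv.unitInc V (congrArg f.base h) :=
  congrArg (fun h => Quiv.Hom.app h a b) f.counit

theorem inc_tensorHom_μ {S T : Type v} (f : S → T) {Q P : Quiv.{v} V S} {Q' P' : Quiv.{v} V T}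
    (α : Q ⟶ (Quiv.pullback f).obj Q') (β : P ⟶ (Quiv.pullback f).obj P') (a c b : S) :
    Quiv.inc Q P a c b ≫ ((α ⊗ₘ β) ≫ μ (Quiv.pullback (V := V) f) Q' P').app a b =
      (α.app a c ⊗ₘ β.app c b) ≫ Quiv.inc Q' P' (f a) (f c) (f b) := by
  erw [Quiv.inc_tensorMap_assoc, Quiv.inc_pullbackμ]
  rfl

theorem Hom.comul_app {X Y : QuivColax.{v} V} (f : Hom X Y) (m n : FinIntᵒᵖ) (a b : X.base) :
    f.app (m ⊗ n) a b ≫ Y.comul m n (f.base a) (f.base b) =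
      X.comul m n a b ≫ Quiv.tensorDesc fun c => (f.app m a c ⊗ₘ f.app n c b) ≫
        Quiv.inc _ _ (f.base a) (f.base c) (f.base b) := by
  refine (congrArg (fun h => Quiv.Hom.app h a b) (f.comul m n)).trans ?_
  refine congrArg (X.comul m n a b ≫ ·) (Quiv.tensor_ext fun c => ?_)
  exact (inc_tensorHom_μ f.base _ _ a c b).trans (Quiv.inc_tensorDesc
    (Q := X.colax.toFunctor.obj m) (P := X.colax.toFunctor.obj n)
    (Z := (Quiv.tensor (Y.colax.toFunctor.obj m) (Y.colax.toFunctor.obj n)).obj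
      (f.base a) (f.base b)) (fun c => (f.app m a c ⊗ₘ f.app n c b) ≫
        Quiv.inc _ _ (f.base a) (f.base c) (f.base b)) c).symm

/-- A morphism is given by its components. -/
def Hom.ofComponents {X Y : QuivColax.{v} V} (f : X.base → Y.base)
    (app : ∀ n a b, X.obj n a b ⟶ Y.obj n (f a) (f b))
    (naturality : ∀ {m n : FinIntᵒᵖ} (g : m ⟶ n) (a b : X.base),
      (X.colax.toFunctor.map g).app a b ≫ app n a b =
        app m a b ≫ (Y.colax.toFunctor.map g).app (f a) (f b))
    (counit : ∀ a b, app (𝟙_ _) a b ≫ Y.counit (f a) (f b) =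
      X.counit a b ≫ Quiv.unitDesc fun h => Quiv.unitInc V (congrArg f h))
    (comul : ∀ m n a b, app (m ⊗ n) a b ≫ Y.comul m n (f a) (f b) =
      X.comul m n a b ≫ Quiv.tensorDesc fun c => (app m a c ⊗ₘ app n c b) ≫
        Quiv.inc _ _ (f a) (f c) (f b)) : Hom X Y where
  base := f
  nat :=
    { app := fun n => ⟨app n⟩
      naturality := fun _ _ g => Quiv.hom_ext fun a b => naturality g a b }
  counit := by
    refine Quiv.hom_ext (V := V) (S := X.base) fun a b => ?_
    exact counit a b
  comul m n := Quiv.hom_ext fun a b => by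
    refine (comul m n a b).trans ?_
    refine congrArg (X.comul m n a b ≫ ·) (Quiv.tensor_ext fun c => ?_)
    exact (Quiv.inc_tensorDesc _ _).trans (inc_tensorHom_μ
      (Q' := Y.colax.toFunctor.obj m) (P' := Y.colax.toFunctor.obj n) f ⟨app m⟩ ⟨app n⟩ a c b).symm

theorem Hom.ext' {X Y : QuivColax.{v} V} {f g : Hom X Y} (h : f.base = g.base)
    (w : ∀ n a b, f.app n a b ≫ eqToHom (by rw [h]) = g.app n a b) : f = g := by
  obtain ⟨fb, fn, _, _⟩ := f
  obtain ⟨gb, gn, _, _⟩ := g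
  obtain rfl : fb = gb := h
  have : fn = gn := by
    refine NatTrans.ext (funext fun n => Quiv.hom_ext (V := V) (S := X.base) fun a b => ?_)
    exact (Category.comp_id _).symm.trans (w n a b)
  subst this
  rfl

noncomputable instance : Category (QuivColax.{v} V) where
  Hom := Hom
  id X := Hom.ofComponents (fun a => a) (fun _ _ _ => 𝟙 _) (by intros; simp)
    (fun a b => by
      rw [Category.id_comp]
      have : (Quiv.unitDesc fun h => Quiv.unitInc V (h)) =
        𝟙 ((Quiv.unit V X.base).obj a b) := Quiv.unit_ext fun h => by simp
      exact ((congrArg (X.counit a b ≫ ·) this).trans (Category.comp_id _)).symm)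
    (fun m n a b => by
      rw [Category.id_comp]
      have : (Quiv.tensorDesc fun c => (𝟙 (X.obj m a c) ⊗ₘ 𝟙 (X.obj n c b)) ≫
          Quiv.inc _ _ a c b) = 𝟙 _ := Quiv.tensor_ext fun h => by simp
      exact ((congrArg (X.comul m n a b ≫ ·) this).trans (Category.comp_id _)).symm)
  comp {X Y Z} f g := Hom.ofComponents (g.base ∘ f.base)
    (fun n a b => f.app n a b ≫ g.app n _ _)
    (fun h a b => by
      rw [reassoc_of% (f.naturality h a b), g.naturality, Category.assoc]
      rfl)
    (fun a b => by
      rw [Category.assoc]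
      erw [g.counit_app, reassoc_of% (f.counit_app a b)]
      refine congrArg (X.counit a b ≫ ·) (Quiv.unit_ext fun h => ?_)
      simp)
    (fun m n a b => by
      rw [Category.assoc]
      erw [g.comul_app, reassoc_of% (f.comul_app m n a b)]
      refine congrArg (X.comul m n a b ≫ ·) (Quiv.tensor_ext fun c => ?_)
      simp)
  id_comp f := Hom.ext' rfl fun n a b => by
    change (𝟙 _ ≫ f.app n a b) ≫ 𝟙 _ = f.app n a b
    simp
  comp_id f := Hom.ext' rfl fun n a b => by
    change (f.app n a b ≫ 𝟙 _) ≫ 𝟙 _ = f.app n a b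
    simp
  assoc f g h := Hom.ext' rfl fun n a b => by
    change ((f.app n a b ≫ g.app n _ _) ≫ h.app n _ _) ≫ 𝟙 _ =
      f.app n a b ≫ g.app n _ _ ≫ h.app n _ _
    simp

end QuivColax

end QuivColax

section HomEquiv

variable {V : Type u} [Category.{v} V] [MonoidalCategory V] [HasColimits V]
  [MonoidalClosed V] [SymmetricCategory V] {S T : Type v} (f : S → T)

theorem push_counit_iff {A : Quiv.{v} V S} {B : Quiv.{v} V T} (e : A ⟶ 𝟙_ _) (e' : B ⟶ 𝟙_ _)
    (α : A ⟶ (Quiv.pullback f).obj B) :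
    ((Quiv.pushforwardAdj f).homEquiv A B).symm α ≫ e' =
        (Quiv.pushforward f).map e ≫ η (Quiv.pushforward (V := V) f) ↔
      α ≫ (Quiv.pullback f).map e' = e ≫ ε (Quiv.pullback (V := V) f) := by
  rw [← ((Quiv.pushforwardAdj f).homEquiv _ _).injective.eq_iff,
    Adjunction.homEquiv_naturality_right, Equiv.apply_symm_apply,
    Adjunction.homEquiv_naturality_left]
  have : (Quiv.pushforwardAdj f).homEquiv _ _ (η (Quiv.pushforward (V := V) f)) =
      ε (Quiv.pullback (V := V) f) := Equiv.apply_symm_apply _ _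
  rw [this]

theorem push_comul_iff {A A₁ A₂ : Quiv.{v} V S} {B B₁ B₂ : Quiv.{v} V T} (d : A ⟶ A₁ ⊗ A₂)
    (d' : B ⟶ B₁ ⊗ B₂) (α : A ⟶ (Quiv.pullback f).obj B)
    (α₁ : A₁ ⟶ (Quiv.pullback f).obj B₁) (α₂ : A₂ ⟶ (Quiv.pullback f).obj B₂) :
    ((Quiv.pushforwardAdj f).homEquiv A B).symm α ≫ d' =
        ((Quiv.pushforward f).map d ≫ δ (Quiv.pushforward (V := V) f) A₁ A₂) ≫
          (((Quiv.pushforwardAdj f).homEquiv A₁ B₁).symm α₁ ⊗ₘ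
            ((Quiv.pushforwardAdj f).homEquiv A₂ B₂).symm α₂) ↔
      α ≫ (Quiv.pullback f).map d' =
        d ≫ (α₁ ⊗ₘ α₂) ≫ μ (Quiv.pullback (V := V) f) B₁ B₂ := by
  rw [← ((Quiv.pushforwardAdj f).homEquiv _ _).injective.eq_iff,
    Adjunction.homEquiv_naturality_right, Equiv.apply_symm_apply, Category.assoc,
    Adjunction.homEquiv_naturality_left, Adjunction.homEquiv_naturality_right]
  have : (Quiv.pushforwardAdj f).homEquiv _ _ (δ (Quiv.pushforward (V := V) f) A₁ A₂) =
      ((Quiv.pushforwardAdj f).unit.app A₁ ⊗ₘ (Quiv.pushforwardAdj f).unit.app A₂) ≫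
        μ (Quiv.pullback (V := V) f) _ _ := Equiv.apply_symm_apply _ _
  rw [this, Category.assoc, ← μ_natural, tensorHom_comp_tensorHom_assoc]
  have h : ∀ {A : Quiv.{v} V S} {B : Quiv.{v} V T} (α : A ⟶ (Quiv.pullback f).obj B),
      (Quiv.pushforwardAdj f).unit.app A ≫ (Quiv.pullback f).map
        (((Quiv.pushforwardAdj f).homEquiv A B).symm α) = α := fun α => by
    exact ((Quiv.pushforwardAdj f).homEquiv_unit _ _ _).symm.trans (Equiv.apply_symm_apply _ _)
  erw [h, h]

namespace QuivColax

/-- The colax monoidal functor `f_! ∘ X`. -/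
noncomputable def push (X : QuivColax.{v} V) {T : Type v} (f : X.base → T) :
    ColaxFunctor FinIntᵒᵖ (Quiv.{v} V T) where
  toFunctor := X.colax.toFunctor ⋙ Quiv.pushforward f

/-- Morphisms `(X, S) ⟶ (Y, T)` are the same as pairs of a map `f : S → T` and a monoidal
natural transformation `f_! ∘ X ⟶ Y`. -/
noncomputable def homEquiv (X Y : QuivColax.{v} V) :
    (X ⟶ Y) ≃ Σ f : X.base → Y.base, (X.push f ⟶ Y.colax) where
  toFun α := ⟨α.base,
    { hom :=
        { app := fun n => ((Quiv.pushforwardAdj α.base).homEquiv _ _).symm (α.nat.app n)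
          naturality := fun m n g => by
            refine ((Quiv.pushforwardAdj α.base).homEquiv_naturality_left_symm _ _).symm.trans ?_
            refine Eq.trans ?_ ((Quiv.pushforwardAdj α.base).homEquiv_naturality_right_symm _ _)
            exact congrArg _ (α.nat.naturality g) }
      counit := (push_counit_iff _ _ _ _).2 α.counit
      comul := fun m n => (push_comul_iff _ _ _ _ _ _).2 (α.comul m n) }⟩
  invFun β :=
    { base := β.1
      nat :=
        { app := fun n => (Quiv.pushforwardAdj β.1).homEquiv _ _ (β.2.hom.app n)
          naturality := fun m n g => by
            refine ((Quiv.pushforwardAdj β.1).homEquiv_naturality_left _ _).symm.trans ?_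
            refine Eq.trans ?_ ((Quiv.pushforwardAdj β.1).homEquiv_naturality_right _ _)
            exact congrArg _ (β.2.hom.naturality g) }
      counit := by
        refine (push_counit_iff _ _ _ _).1 ?_
        exact (congrArg (· ≫ η Y.colax.toFunctor) (Equiv.symm_apply_apply _ _)).trans β.2.counit
      comul := fun m n => by
        refine (push_comul_iff _ _ _ _ _ _).1 ?_
        refine (congrArg (· ≫ δ Y.colax.toFunctor m n) (Equiv.symm_apply_apply _ _)).trans
          ((β.2.comul m n).trans ?_)
        exact congrArg₂ (fun u w => δ (X.push β.1).toFunctor m n ≫ (u ⊗ₘ w))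
          (Equiv.symm_apply_apply _ _).symm (Equiv.symm_apply_apply _ _).symm }
  left_inv α := Hom.ext' rfl fun n a b => by
    refine (Category.comp_id _).trans ?_
    exact congrArg (fun h => Quiv.Hom.app h a b) (Equiv.apply_symm_apply _ (α.nat.app n))
  right_inv β := by
    obtain ⟨f, β⟩ := β
    refine congrArg (Sigma.mk f) (ColaxFunctor.hom_ext (NatTrans.ext (funext fun n => ?_)))
    exact Equiv.symm_apply_apply _ _

end QuivColax

end HomEquiv

section Comparison

variable (V : Type u) [Category.{v} V] [MonoidalCategory V] [HasColimits V]
  [MonoidalClosed V] [SymmetricCategory V]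

/-- The category `ts V` of templicial objects: the full subcategory of the Grothendieck
construction on the strongly unital functors, whose counit `X_0 ⟶ I_S` is an isomorphism. -/
abbrev TemplicialObject :=
  ObjectProperty.FullSubcategory fun X : QuivColax.{v} V => IsIso (η X.colax.toFunctor)

variable {V}

namespace QuivColax

/-- The colax monoidal functor with `n ↦ ∐_{a,b} X_n(a, b)`. -/
noncomputable def collapse (X : QuivColax.{v} V) : ColaxFunctor FinIntᵒᵖ V where
  toFunctor := X.colax.toFunctor ⋙ Quiv.total V X.base

/-- The components `∐_{a,b} X_n(a, b) ⟶ ∐_{x,y} Y_n(x, y)` induced by a morphism. -/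
noncomputable def collapseApp {X Y : QuivColax.{v} V} (f : X ⟶ Y) (n : FinIntᵒᵖ) :
    (Quiv.total V X.base).obj (X.colax.toFunctor.obj n) ⟶
      (Quiv.total V Y.base).obj (Y.colax.toFunctor.obj n) :=
  Quiv.totalDesc fun a b =>
    f.app n a b ≫ Quiv.totalInc (Y.colax.toFunctor.obj n) (f.base a) (f.base b)

@[simp]
theorem totalInc_collapseApp {X Y : QuivColax.{v} V} (f : X ⟶ Y) (n : FinIntᵒᵖ)
    (a b : X.base) : Quiv.totalInc (X.colax.toFunctor.obj n) a b ≫ collapseApp f n =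
      f.app n a b ≫ Quiv.totalInc (Y.colax.toFunctor.obj n) (f.base a) (f.base b) :=
  Quiv.totalInc_totalDesc _ _ _

@[simp]
theorem totalInc_collapseApp_assoc : type_of% (reassoc_of% @totalInc_collapseApp.{v, u}) :=
  @(reassoc_of% @totalInc_collapseApp.{v, u})

/-- The monoidal natural transformation induced by a morphism on coproducts. -/
noncomputable def collapseMap {X Y : QuivColax.{v} V} (f : X ⟶ Y) :
    X.collapse ⟶ Y.collapse where
  hom :=
    { app := collapseApp f
      naturality := fun m n g => Quiv.total_ext fun a b => by
        change Quiv.totalInc _ a b ≫ (Quiv.total V X.base).map _ ≫ _ =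
          Quiv.totalInc _ a b ≫ _ ≫ (Quiv.total V Y.base).map _
        rw [Quiv.totalInc_map_assoc, totalInc_collapseApp, totalInc_collapseApp_assoc,
          reassoc_of% (f.naturality g a b), Quiv.totalInc_map] }
  counit := Quiv.total_ext fun a b => by
    change Quiv.totalInc _ a b ≫ collapseApp f _ ≫ (Quiv.total V Y.base).map _ ≫
      Quiv.totalη V Y.base = Quiv.totalInc _ a b ≫ (Quiv.total V X.base).map _ ≫
        Quiv.totalη V X.base
    rw [totalInc_collapseApp_assoc, Quiv.totalInc_map_assoc, Quiv.totalInc_map_assoc]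
    erw [reassoc_of% (f.counit_app a b)]
    refine congrArg (X.counit a b ≫ ·) (Quiv.unit_ext fun h => ?_)
    rw [Quiv.unitInc_unitDesc_assoc]
    erw [Quiv.unitInc_totalInc_totalη, Quiv.unitInc_totalInc_totalη]
  comul m n := Quiv.total_ext fun a b => by
    change Quiv.totalInc _ a b ≫ collapseApp f _ ≫ (Quiv.total V Y.base).map _ ≫
      Quiv.totalδ _ _ = Quiv.totalInc _ a b ≫ ((Quiv.total V X.base).map _ ≫
        Quiv.totalδ _ _) ≫ (collapseApp f _ ⊗ₘ collapseApp f _)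
    rw [totalInc_collapseApp_assoc, Category.assoc, Quiv.totalInc_map_assoc,
      Quiv.totalInc_map_assoc]
    erw [reassoc_of% (f.comul_app m n a b)]
    refine congrArg (X.comul m n a b ≫ ·) (Quiv.tensor_ext fun c => ?_)
    rw [Quiv.inc_tensorDesc_assoc, Category.assoc]
    erw [Quiv.inc_totalInc_totalδ, Quiv.inc_totalInc_totalδ_assoc, tensorHom_comp_tensorHom,
      tensorHom_comp_tensorHom, totalInc_collapseApp, totalInc_collapseApp]

/-- The functor to `Colax(Fint^op, V)` which collapses quivers by taking coproducts. -/
noncomputable def collapseFunctor : QuivColax.{v} V ⥤ ColaxFunctor FinIntᵒᵖ V where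
  obj X := X.collapse
  map f := collapseMap f
  map_id X := ColaxFunctor.hom_ext (NatTrans.ext (funext fun n => by
    refine Quiv.total_ext (Q := X.colax.toFunctor.obj n) fun a b => ?_
    exact (totalInc_collapseApp _ _ _ _).trans
      ((Category.id_comp _).trans (Category.comp_id _).symm)))
  map_comp {X Y Z} f g := ColaxFunctor.hom_ext (NatTrans.ext (funext fun n => by
    refine Quiv.total_ext (Q := X.colax.toFunctor.obj n) fun a b => ?_
    change _ ≫ collapseApp (f ≫ g) n = _ ≫ collapseApp f n ≫ collapseApp g n
    rw [totalInc_collapseApp, totalInc_collapseApp_assoc, totalInc_collapseApp]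
    exact Category.assoc _ _ _))

/-- The isomorphism `(t_S)_!(I_S) ≅ F(S)`. -/
noncomputable def totalUnitIso (S : Type v) :
    (Quiv.total V S).obj (Quiv.unit V S) ≅ (freeComonObj V S).X where
  hom := Quiv.totalDesc fun a _ => Quiv.unitDesc fun _ => freeInc a
  inv := freeDesc fun a => Quiv.unitInc V rfl ≫ Quiv.totalInc _ a a
  hom_inv_id := Quiv.total_ext fun a b => Quiv.unit_ext fun h => by
    subst h
    rw [Quiv.totalInc_totalDesc_assoc, Quiv.unitInc_unitDesc_assoc, freeInc_freeDesc,
      Category.comp_id]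
  inv_hom_id := free_ext fun a => by
    rw [freeInc_freeDesc_assoc, Category.assoc, Quiv.totalInc_totalDesc,
      Quiv.unitInc_unitDesc, Category.comp_id]

@[simp]
theorem totalUnitIso_hom {S : Type v} {a b : S} (h : a = b) :
    Quiv.unitInc V h ≫ Quiv.totalInc _ a b ≫ (totalUnitIso S).hom = freeInc a := by
  simp [totalUnitIso]

@[simp]
theorem totalUnitIso_hom_assoc : type_of% (reassoc_of% @totalUnitIso_hom.{v, u}) :=
  @(reassoc_of% @totalUnitIso_hom.{v, u})

theorem totalUnitIso_counit (S : Type v) :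
    (totalUnitIso S).hom ≫ (freeComonObj V S).comon.counit = Quiv.totalη V S :=
  Quiv.total_ext fun a b => Quiv.unit_ext fun h => by
    rw [Quiv.unitInc_totalInc_totalη, totalUnitIso_hom_assoc, freeInc_counit]

theorem totalUnitIso_comul (S : Type v) :
    (totalUnitIso S).hom ≫ (freeComonObj V S).comon.comul =
      (Quiv.total V S).map (Quiv.leftIso (Quiv.unit V S)).inv ≫ Quiv.totalδ _ _ ≫
        ((totalUnitIso S).hom ⊗ₘ (totalUnitIso S).hom) :=
  Quiv.total_ext fun a b => Quiv.unit_ext fun h => by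
    subst h
    rw [totalUnitIso_hom_assoc, freeInc_comul, Quiv.totalInc_map_assoc, Quiv.leftIso_inv_app]
    simp only [Category.assoc, Quiv.inc_totalInc_totalδ_assoc, tensorHom_comp_tensorHom]
    rw [leftUnitor_inv_naturality_assoc, ← tensorHom_id, ← id_tensorHom,
      tensorHom_comp_tensorHom_assoc, tensorHom_comp_tensorHom, Category.id_comp,
      Category.comp_id, totalUnitIso_hom]

/-- The morphism `φ : ∐_{a,b} X_0(a, b) ⟶ F(S)` in `V` induced by the counit of `X`. -/
noncomputable def collapseφHom (X : QuivColax.{v} V) :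
    (Quiv.total V X.base).obj (X.colax.toFunctor.obj (𝟙_ _)) ⟶ (freeComonObj V X.base).X :=
  (Quiv.total V X.base).map (η X.colax.toFunctor) ≫ (totalUnitIso X.base).hom

theorem collapseφHom_counit (X : QuivColax.{v} V) :
    collapseφHom X ≫ (freeComonObj V X.base).comon.counit =
      (Quiv.total V X.base).map (η X.colax.toFunctor) ≫ Quiv.totalη V X.base := by
  rw [collapseφHom, Category.assoc, totalUnitIso_counit]

theorem collapseφHom_comul (X : QuivColax.{v} V) :
    collapseφHom X ≫ (freeComonObj V X.base).comon.comul =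
      (Quiv.total V X.base).map (X.colax.toFunctor.map (λ_ (𝟙_ _)).inv) ≫
        (Quiv.total V X.base).map (δ X.colax.toFunctor _ _) ≫ Quiv.totalδ _ _ ≫
          (collapseφHom X ⊗ₘ collapseφHom X) := by
  have h1 : X.colax.toFunctor.map (λ_ (𝟙_ _)).inv ≫ δ X.colax.toFunctor _ _ ≫
      (η X.colax.toFunctor ⊗ₘ η X.colax.toFunctor) = η X.colax.toFunctor ≫ (λ_ (𝟙_ _)).inv := by
    have h0 := Functor.OplaxMonoidal.oplax_left_unitality X.colax.toFunctor (𝟙_ _)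
    rw [leftUnitor_inv_naturality, h0, Category.assoc, Category.assoc,
      MonoidalCategory.tensorHom_def]
  have h2 : ∀ {Q Q' P P' : Quiv.{v} V X.base} (f : Q ⟶ Q') (g : P ⟶ P'),
      (Quiv.total V X.base).map (f ⊗ₘ g) ≫ Quiv.totalδ Q' P' =
        Quiv.totalδ Q P ≫ ((Quiv.total V X.base).map f ⊗ₘ (Quiv.total V X.base).map g) :=
    fun f g => (δ_natural (Quiv.total V X.base) f g).symm
  have h3 : ∀ {Q Q' P P' : Quiv.{v} V X.base} (f : Q ⟶ Q') (g : Q' ⟶ P) (k : P ⟶ P'),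
      (Quiv.total V X.base).map (f ≫ g ≫ k) = (Quiv.total V X.base).map f ≫
        (Quiv.total V X.base).map g ≫ (Quiv.total V X.base).map k := fun f g k => by
    rw [CategoryTheory.Functor.map_comp, CategoryTheory.Functor.map_comp]
  have h4 := (h3 _ _ _).symm.trans ((congrArg (Quiv.total V X.base).map h1).trans
    ((Quiv.total V X.base).map_comp _ _))
  rw [collapseφHom, ← tensorHom_comp_tensorHom, Category.assoc, totalUnitIso_comul]
  have h5 := congrArg (· ≫ ((totalUnitIso X.base).hom ⊗ₘ (totalUnitIso X.base).hom))
    (h2 (η X.colax.toFunctor) (η X.colax.toFunctor))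
  have h6 := congrArg (· ≫ Quiv.totalδ _ _ ≫ ((totalUnitIso X.base).hom ⊗ₘ
    (totalUnitIso X.base).hom)) h4
  simp only [Category.assoc] at h5 h6
  refine h6.symm.trans ?_
  exact congrArg (fun z => (Quiv.total V X.base).map (X.colax.toFunctor.map (λ_ (𝟙_ _)).inv) ≫
    (Quiv.total V X.base).map (δ X.colax.toFunctor _ _) ≫ z) h5

/-- The morphism of comonoids `φ : (∐_{a,b} X(a, b))_0 ⟶ F(S)` induced by the counit of `X`. -/
noncomputable def collapseφ (X : QuivColax.{v} V) :
    (ColaxFunctor.vertices (C := FinIntᵒᵖ) (D := V)).obj X.collapse ⟶ (freeComon V).obj X.base where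
  hom := collapseφHom X
  isComonHom_hom :=
    { hom_counit := by
        refine (collapseφHom_counit X).trans ?_
        change _ = (Quiv.total V X.base).map (X.colax.toFunctor.map (𝟙 _)) ≫
          (Quiv.total V X.base).map (η X.colax.toFunctor) ≫ Quiv.totalη V X.base
        rw [CategoryTheory.Functor.map_id, CategoryTheory.Functor.map_id, Category.id_comp]
      hom_comul := by
        refine (collapseφHom_comul X).trans ?_
        change _ = ((Quiv.total V X.base).map (X.colax.toFunctor.map (λ_ (𝟙_ _)).inv) ≫
          (Quiv.total V X.base).map (δ X.colax.toFunctor _ _) ≫ Quiv.totalδ _ _) ≫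
            (collapseφHom X ⊗ₘ collapseφHom X)
        rw [Category.assoc, Category.assoc] }

theorem collapseφ_natural {X Y : QuivColax.{v} V} (f : X ⟶ Y) :
    (ColaxFunctor.vertices (C := FinIntᵒᵖ) (D := V)).map (collapseMap f) ≫ collapseφ Y =
      collapseφ X ≫ (freeComon V).map (↾f.base) := by
  apply Comon.Hom.ext
  refine Quiv.total_ext (Q := X.colax.toFunctor.obj (𝟙_ _)) fun a b => ?_
  change _ ≫ collapseApp f (𝟙_ _) ≫ (Quiv.total V Y.base).map (η Y.colax.toFunctor) ≫
    (totalUnitIso Y.base).hom = _ ≫ ((Quiv.total V X.base).map (η X.colax.toFunctor) ≫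
    (totalUnitIso X.base).hom) ≫ freeDesc fun a => freeInc (f.base a)
  rw [totalInc_collapseApp_assoc, Quiv.totalInc_map_assoc, Category.assoc,
    Quiv.totalInc_map_assoc]
  erw [reassoc_of% (f.counit_app a b)]
  refine congrArg (X.counit a b ≫ ·) (Quiv.unit_ext fun h => ?_)
  rw [Quiv.unitInc_unitDesc_assoc]
  erw [totalUnitIso_hom, totalUnitIso_hom_assoc, freeInc_freeDesc]

/-- If `X` is strongly unital, then `φ` is an isomorphism of comonoids. -/
noncomputable def collapseφIso (X : QuivColax.{v} V) (hX : IsIso (η X.colax.toFunctor)) :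
    (ColaxFunctor.vertices (C := FinIntᵒᵖ) (D := V)).obj X.collapse ≅ (freeComon V).obj X.base :=
  have : IsIso ((Comon.forget V).map (collapseφ X)) := by
    change IsIso ((Quiv.total V X.base).map (η X.colax.toFunctor) ≫ (totalUnitIso X.base).hom)
    infer_instance
  have : IsIso (collapseφ X) := isIso_of_reflects_iso _ (Comon.forget V)
  asIso (collapseφ X)

end QuivColax

/-- The comparison functor `𝔠 : ts V ⥤ Colax_b(Fint^op, V)`: it sends `(X, S)` to the colax
monoidal functor `n ↦ ∐_{a,b ∈ S} X_n(a, b)` with base `S`. -/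
noncomputable def comparison (V : Type u) [Category.{v} V] [MonoidalCategory V] [HasColimits V]
    [MonoidalClosed V] [SymmetricCategory V] : TemplicialObject.{v} V ⥤ ColaxBased.{v} V where
  obj X := ⟨X.obj.collapse, X.obj.base, X.obj.collapseφIso X.property⟩
  map f :=
    { fst := QuivColax.collapseMap f.hom
      snd := ↾f.hom.base
      w := QuivColax.collapseφ_natural f.hom }
  map_id X := CategoricalPullback.hom_ext (QuivColax.collapseFunctor.map_id X.obj) rfl
  map_comp f g := CategoricalPullback.hom_ext (QuivColax.collapseFunctor.map_comp f.hom g.hom) rfl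



end Comparison

section Decomposing

/-- A morphism `f : A ⟶ ∐_{i ∈ S} A` is decomposing if `(∐_i f) ∘ f = (∐_i ι_i) ∘ f` and
`∇ ∘ f = 𝟙`. -/
structure IsDecomposingMor {V : Type u} [Category.{v} V] [HasColimits V] {S : Type v} {A : V}
    (f : A ⟶ ∐ fun _ : S => A) : Prop where
  comp_map : f ≫ Limits.Sigma.map (f := fun _ : S => A) (g := fun _ : S => ∐ fun _ : S => A)
      (fun _ => f) =
    f ≫ Limits.Sigma.map (f := fun _ : S => A) (g := fun _ : S => ∐ fun _ : S => A)
      (fun i => Sigma.ι (fun _ : S => A) i)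
  comp_desc : f ≫ Limits.Sigma.desc (fun _ : S => 𝟙 A) = 𝟙 A

/-- The fork obtained as the coproduct of the equalizers of `f t` and the coprojection `ι_j`. -/
noncomputable def decomposingFork {V : Type u} [Category.{v} V] [HasLimits V] [HasColimits V]
    {T S : Type v} {A : T → V} (f : ∀ t, A t ⟶ ∐ fun _ : S => A t) (j : S) :
    Fork (Limits.Sigma.map (f := A) (g := fun t => ∐ fun _ : S => A t) f)
      (Limits.Sigma.map (f := A) (g := fun t => ∐ fun _ : S => A t)
        fun t => Sigma.ι (fun _ : S => A t) j) :=
  Fork.ofι (Limits.Sigma.map (f := fun t => equalizer (f t) (Sigma.ι (fun _ : S => A t) j))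
    (g := A) fun t => equalizer.ι (f t) (Sigma.ι (fun _ : S => A t) j)) <| by
      refine Sigma.hom_ext _ _ fun t => ?_
      rw [Sigma.ι_map_assoc, Sigma.ι_map_assoc, Sigma.ι_map, Sigma.ι_map,
        equalizer.condition_assoc]

/-- A category `V` is decomposing if coproducts commute with decomposing equalizers (for every set
`T`, the functor `∐ : V^T ⥤ V` preserves decomposing equalizers), coproducts are disjoint, and the
tensor product preserves decomposing equalizers in each variable. -/
structure IsDecomposing (V : Type u) [Category.{v} V] [MonoidalCategory V] [HasLimits V]
    [HasColimits V] : Prop where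
  coproduct : ∀ {T S : Type v} {A : T → V} (f : ∀ t, A t ⟶ ∐ fun _ : S => A t)
    (_ : ∀ t, IsDecomposingMor (f t)) (j : S), Nonempty (IsLimit (decomposingFork f j))
  disjoint : ∀ {T : Type v} (A : T → V), CoproductDisjoint A
  tensorLeft : ∀ {S : Type v} {A : V} (f : A ⟶ ∐ fun _ : S => A) (_ : IsDecomposingMor f) (j : S)
    (W : V), PreservesLimit (parallelPair f (Sigma.ι (fun _ : S => A) j)) (tensorLeft W)
  tensorRight : ∀ {S : Type v} {A : V} (f : A ⟶ ∐ fun _ : S => A) (_ : IsDecomposingMor f) (j : S)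
    (W : V), PreservesLimit (parallelPair f (Sigma.ι (fun _ : S => A) j)) (tensorRight W)

end Decomposing

section Decomposition

variable {V : Type u} [Category.{v} V] [MonoidalCategory V] [HasLimits V] [HasColimits V]
  [MonoidalClosed V] [SymmetricCategory V]

/-- The canonical isomorphism `F(S) ⊗ (A ⊗ F(S)) ≅ ∐_{a,b ∈ S} A`, as a morphism. -/
noncomputable def freeTensor (S : Type v) (A : V) :
    (∐ fun _ : S => 𝟙_ V) ⊗ (A ⊗ (∐ fun _ : S => 𝟙_ V)) ⟶ ∐ fun _ : S × S => A :=
  rightDesc (A ⊗ (∐ fun _ : S => 𝟙_ V)) (fun _ : S => 𝟙_ V) fun a =>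
    (λ_ _).hom ≫ leftDesc A (fun _ : S => 𝟙_ V) fun b =>
      (ρ_ A).hom ≫ Sigma.ι (fun _ : S × S => A) (a, b)

theorem freeTensor_natural {S : Type v} {A A' : V} (g : A ⟶ A') :
    freeTensor S A ≫ Limits.Sigma.map (f := fun _ : S × S => A) (g := fun _ : S × S => A')
      (fun _ => g) =
        ((∐ fun _ : S => 𝟙_ V) ◁ (g ▷ (∐ fun _ : S => 𝟙_ V))) ≫ freeTensor S A' := by
  refine right_hom_ext fun a => ?_
  have h1 : Sigma.ι (fun _ : S => 𝟙_ V) a ▷ (A ⊗ (∐ fun _ : S => 𝟙_ V)) ≫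
      ((∐ fun _ : S => 𝟙_ V) ◁ (g ▷ (∐ fun _ : S => 𝟙_ V))) =
      𝟙_ V ◁ (g ▷ (∐ fun _ : S => 𝟙_ V)) ≫ Sigma.ι (fun _ : S => 𝟙_ V) a ▷ _ :=
    (whisker_exchange _ _).symm
  rw [reassoc_of% h1, freeTensor, ι_rightDesc_assoc, freeTensor, ι_rightDesc,
    leftUnitor_naturality_assoc, Category.assoc]
  refine congrArg ((λ_ _).hom ≫ ·) (left_hom_ext fun b => ?_)
  have h2 : A ◁ Sigma.ι (fun _ : S => 𝟙_ V) b ≫ g ▷ (∐ fun _ : S => 𝟙_ V) =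
      g ▷ 𝟙_ V ≫ A' ◁ Sigma.ι (fun _ : S => 𝟙_ V) b := whisker_exchange _ _
  rw [reassoc_of% h2, ι_leftDesc_assoc, ι_leftDesc, Category.assoc, Sigma.ι_map,
    rightUnitor_naturality_assoc]

namespace ColaxBased

/-- The given isomorphism `X_0 ≅ F(S) = ∐_{a ∈ S} I`, as a morphism in `V`. -/
noncomputable def baseHom (B : ColaxBased.{v} V) :
    B.fst.toFunctor.obj (𝟙_ _) ⟶ ∐ fun _ : B.snd => 𝟙_ V :=
  B.iso.hom.hom

/-- The morphism `μ_{0,n,0} : X_n ⟶ X_0 ⊗ X_n ⊗ X_0 ≅ ∐_{a,b ∈ S} X_n`. -/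
noncomputable def dec (B : ColaxBased.{v} V) (n : FinIntᵒᵖ) :
    B.fst.toFunctor.obj n ⟶ ∐ fun _ : B.snd × B.snd => B.fst.toFunctor.obj n :=
  B.fst.toFunctor.map (λ_ n).inv ≫ δ B.fst.toFunctor (𝟙_ _) n ≫
    B.fst.toFunctor.obj (𝟙_ _) ◁ (B.fst.toFunctor.map (ρ_ n).inv ≫ δ B.fst.toFunctor n (𝟙_ _)) ≫
    (B.baseHom ⊗ₘ (B.fst.toFunctor.obj n ◁ B.baseHom)) ≫ freeTensor B.snd _

theorem dec_natural (B : ColaxBased.{v} V) {m n : FinIntᵒᵖ} (g : m ⟶ n) :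
    B.fst.toFunctor.map g ≫ B.dec n = B.dec m ≫ Limits.Sigma.map
      (f := fun _ : B.snd × B.snd => B.fst.toFunctor.obj m)
      (g := fun _ : B.snd × B.snd => B.fst.toFunctor.obj n) (fun _ => B.fst.toFunctor.map g) := by
  have h1 : B.fst.toFunctor.map g ≫ B.fst.toFunctor.map (λ_ n).inv =
      B.fst.toFunctor.map (λ_ m).inv ≫ B.fst.toFunctor.map (𝟙_ _ ◁ g) := by
    rw [← CategoryTheory.Functor.map_comp, ← CategoryTheory.Functor.map_comp,
      leftUnitor_inv_naturality]
  have h2 : B.fst.toFunctor.map (𝟙_ _ ◁ g) ≫ δ B.fst.toFunctor (𝟙_ _) n =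
      δ B.fst.toFunctor (𝟙_ _) m ≫ _ ◁ B.fst.toFunctor.map g :=
    (δ_natural_right B.fst.toFunctor (𝟙_ _) g).symm
  have h3 : B.fst.toFunctor.map g ≫ B.fst.toFunctor.map (ρ_ n).inv ≫
      δ B.fst.toFunctor n (𝟙_ _) = (B.fst.toFunctor.map (ρ_ m).inv ≫
        δ B.fst.toFunctor m (𝟙_ _)) ≫ B.fst.toFunctor.map g ▷ _ := by
    rw [Category.assoc, δ_natural_left, ← CategoryTheory.Functor.map_comp_assoc,
      ← CategoryTheory.Functor.map_comp_assoc, rightUnitor_inv_naturality]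
  have h4 : (B.fst.toFunctor.obj (𝟙_ _) ◁ B.fst.toFunctor.map g ▷ B.fst.toFunctor.obj (𝟙_ _)) ≫
      (B.baseHom ⊗ₘ (B.fst.toFunctor.obj n ◁ B.baseHom)) =
      (B.baseHom ⊗ₘ (B.fst.toFunctor.obj m ◁ B.baseHom)) ≫
        ((∐ fun _ : B.snd => 𝟙_ V) ◁ (B.fst.toFunctor.map g ▷ (∐ fun _ : B.snd => 𝟙_ V))) := by
    simp only [← id_tensorHom, ← tensorHom_id, tensorHom_comp_tensorHom, Category.id_comp,
      Category.comp_id]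
  have h5 : B.fst.toFunctor.obj (𝟙_ _) ◁ B.fst.toFunctor.map g ≫ B.fst.toFunctor.obj (𝟙_ _) ◁
      (B.fst.toFunctor.map (ρ_ n).inv ≫ δ B.fst.toFunctor n (𝟙_ _)) =
      B.fst.toFunctor.obj (𝟙_ _) ◁ (B.fst.toFunctor.map (ρ_ m).inv ≫
        δ B.fst.toFunctor m (𝟙_ _)) ≫ B.fst.toFunctor.obj (𝟙_ _) ◁
          B.fst.toFunctor.map g ▷ B.fst.toFunctor.obj (𝟙_ _) := by
    rw [← MonoidalCategory.whiskerLeft_comp, ← MonoidalCategory.whiskerLeft_comp, h3]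
  rw [dec, dec]
  simp only [Category.assoc]
  rw [reassoc_of% h1, reassoc_of% h2, freeTensor_natural, reassoc_of% h5, reassoc_of% h4]

/-- The morphism `e_{a,b} : X_n(a, b) ⟶ X_n`. It is the equalizer of `μ_{0,n,0}` and the
`(a, b)`-th coprojection. -/
noncomputable abbrev e (B : ColaxBased.{v} V) (n : FinIntᵒᵖ) (a b : B.snd) :
    equalizer (B.dec n) (Sigma.ι (fun _ : B.snd × B.snd => B.fst.toFunctor.obj n) (a, b)) ⟶
      B.fst.toFunctor.obj n :=
  equalizer.ι _ _

/-- The functor `Fint^op ⥤ V-Quiv_S` with `n ↦ X_n(a, b)`. -/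
noncomputable def quiver (B : ColaxBased.{v} V) : FinIntᵒᵖ ⥤ Quiv.{v} V B.snd where
  obj n := ⟨fun a b => equalizer (B.dec n)
    (Sigma.ι (fun _ : B.snd × B.snd => B.fst.toFunctor.obj n) (a, b))⟩
  map {m n} g := ⟨fun a b => equalizer.lift (B.e m a b ≫ B.fst.toFunctor.map g) (by
    rw [Category.assoc, dec_natural, equalizer.condition_assoc, Sigma.ι_map, Category.assoc])⟩
  map_id n := Quiv.hom_ext fun a b => equalizer.hom_ext (by simp)
  map_comp f g := Quiv.hom_ext fun a b => equalizer.hom_ext (by simp)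

end ColaxBased

open ColaxBased in
/-- The decomposition of a based colax monoidal functor `X` with base `S`: the functor
`n ↦ (X_n(a, b))_{a,b}` together with a strongly unital colax monoidal structure on it, which is
compatible with the structure of `X` along the morphisms `e_{a,b}`: the counit is
`ε ∘ e_{a,b}` and the comultiplication is the factorization of `μ_{m,n} ∘ e_{a,b}` through
`(e_{a,c} ⊗ e_{c,b})_c`. -/
structure Decomposition (B : ColaxBased.{v} V) where
  [oplax : (quiver B).OplaxMonoidal]
  [isIso_counit : IsIso (η (quiver B))]
  counit : ∀ a b : B.snd, (η (quiver B)).app a b ≫ Quiv.unitDesc (fun _ => 𝟙 (𝟙_ V)) =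
    e B (𝟙_ _) a b ≫ η B.fst.toFunctor
  comul : ∀ (m n : FinIntᵒᵖ) (a b : B.snd), (δ (quiver B) m n).app a b ≫
    Quiv.tensorDesc (fun c => e B m a c ⊗ₘ e B n c b) = e B (m ⊗ n) a b ≫ δ B.fst.toFunctor m n

/-- The templicial object given by a decomposition. -/
noncomputable def Decomposition.toTemplicial {B : ColaxBased.{v} V} (D : Decomposition B) :
    TemplicialObject.{v} V where
  obj :=
    { base := B.snd
      colax := { toFunctor := B.quiver, oplax := D.oplax } }
  property := D.isIso_counit

theorem Decomposition.hom_ext {B C : ColaxBased.{v} V} {D : Decomposition B}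
    {E : Decomposition C} {f g : D.toTemplicial ⟶ E.toTemplicial} (h : f.hom.base = g.hom.base)
    (w : ∀ (n : FinIntᵒᵖ) (a b : B.snd), f.hom.app n a b ≫ C.e n (f.hom.base a) (f.hom.base b) =
      g.hom.app n a b ≫ C.e n (g.hom.base a) (g.hom.base b)) : f = g := by
  refine ObjectProperty.hom_ext _ (QuivColax.Hom.ext' h fun n a b => ?_)
  have key : ∀ {x x' y y' : C.snd} (hx : x = x') (hy : y = y')
      (k : E.toTemplicial.obj.obj n x y = E.toTemplicial.obj.obj n x' y'),
      eqToHom k ≫ C.e n x' y' = C.e n x y := by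
    rintro x _ y _ rfl rfl k
    exact Category.id_comp _
  refine equalizer.hom_ext ?_
  refine (Category.assoc _ _ _).trans (Eq.trans ?_ (w n a b))
  exact congrArg (f.hom.app n a b ≫ ·) (key (congrFun h a) (congrFun h b) _)

/-- The data of the functor `𝔡`, which sends a based colax monoidal functor `X` with base `S` to
its decomposition, and a morphism `(α, f) : (X, S) ⟶ (Y, T)` to the morphism which is given by
`f` on vertices and by the factorization of `α ∘ e_{a,b}` through `e_{f a,f b}`. -/
structure DecompositionFunctor (V : Type u) [Category.{v} V] [MonoidalCategory V] [HasLimits V]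
    [HasColimits V] [MonoidalClosed V] [SymmetricCategory V] where
  onObj : ∀ B : ColaxBased.{v} V, Decomposition B
  map : ∀ {B C : ColaxBased.{v} V}, (B ⟶ C) → ((onObj B).toTemplicial ⟶ (onObj C).toTemplicial)
  map_base : ∀ {B C : ColaxBased.{v} V} (g : B ⟶ C) (a : B.snd), (map g).hom.base a = g.snd a
  map_e : ∀ {B C : ColaxBased.{v} V} (g : B ⟶ C) (n : FinIntᵒᵖ) (a b : B.snd),
    (map g).hom.app n a b ≫ C.e n ((map g).hom.base a) ((map g).hom.base b) =
      B.e n a b ≫ g.fst.hom.app n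

/-- The functor `𝔡 : Colax_b(Fint^op, V) ⥤ ts V`. -/
noncomputable def DecompositionFunctor.functor (d : DecompositionFunctor.{v} V) :
    ColaxBased.{v} V ⥤ TemplicialObject.{v} V where
  obj B := (d.onObj B).toTemplicial
  map g := d.map g
  map_id B := Decomposition.hom_ext (funext fun a => d.map_base (𝟙 B) a) fun n a b =>
    (d.map_e (𝟙 B) n a b).trans ((Category.comp_id _).trans (Category.id_comp _).symm)
  map_comp {A B C} f g := Decomposition.hom_ext
    (funext fun a => (d.map_base (f ≫ g) a).trans
      ((congrArg g.snd (d.map_base f a)).symm.trans (d.map_base g _).symm)) fun n a b => by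
    refine (d.map_e (f ≫ g) n a b).trans ?_
    have h1 := d.map_e f n a b
    have h2 := d.map_e g n ((d.map f).hom.base a) ((d.map f).hom.base b)
    refine (Category.assoc _ _ _).symm.trans ?_
    refine (congrArg (· ≫ g.fst.hom.app n) h1).symm.trans ?_
    refine (Category.assoc _ _ _).trans ?_
    exact (congrArg ((d.map f).hom.app n a b ≫ ·) h2).symm.trans (Category.assoc _ _ _).symm

end Decomposition

end

end Templicial

/-! The comonoid `F(S)` coacts on each `X_n` from the left and from the right, by comultiplying off
a factor `X_0` and applying `φ`. Since `F(S) ⊗ A` and `A ⊗ F(S)` are coproducts of copies of `A`,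
the two coactions together form the morphism `μ_{0,n,0} : X_n ⟶ ∐_{S × S} X_n`, which should be read
as labelling each piece of `X_n` by its source and target. Counitality, coassociativity and the
commutation of the two coactions say that this morphism is decomposing
(`IsBaseMor.isDecomposingMor_actBoth`).

Two consequences of the axioms on `V` carry the argument. First, a decomposing morphism really
decomposes its domain: `A` is the coproduct of the equalizers of `f` with the coprojections
(`IsDecomposing.isSum_equalizer`). Hence `X_n` is the coproduct of its parts `X_n(a, b)`. Second, if
two labellings of the summands of `A` agree after precomposition with `h`, then `h` factors through
anything that receives the summands whose labels agree (`IsDecomposing.factors`). Together with the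
fact that a subfamily of summands includes monomorphically (`IsDecomposing.mono_of_injective`), this
produces all required lifts and makes them unique.

Restricted to `X_n(a, b)`, the comultiplication `μ_{m,n}` keeps the source `a` and the target `b`.
By coassociativity it cannot distinguish the right coaction on `X_m` from the left coaction on
`X_n`, so the two middle vertices agree. It therefore lifts to `∐_c X_m(a, c) ⊗ X_n(c, b)`. In the
same way the counit lifts to `I_S(a, b)`. All coherence conditions are inherited from `X` along
monomorphisms, and the lifted counit is invertible because `φ` is.

For a templicial object, counitality shows that the summand `X_n(a, b)` of the total coproduct is
exactly the part with labels `(a, b)`. As morphisms of based functors respect labels, `𝔠` is fully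
faithful. The morphisms `(e_{a,b})` form an isomorphism `𝔠 𝔡 ⟶ 𝟙`, and the prescription for `𝔡` on
morphisms is equivalent to naturality of this isomorphism. A fully faithful functor with such a
natural isomorphism is left adjoint to `𝔡`, with invertible unit and counit. -/

namespace Templicial

set_option linter.unusedSectionVars false

section

/-! ### Coproducts, labellings of summands, and decomposing morphisms. -/

section Sums

variable {V : Type u} [Category.{v} V]

/-- The morphisms `i k : B k ⟶ A` exhibit `A` as a coproduct of the objects `B k`. -/
structure IsSum {K : Type v} {B : K → V} {A : V} (i : ∀ k, B k ⟶ A) : Prop where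
  exists_desc : ∀ {Z : V} (u : ∀ k, B k ⟶ Z), ∃ h : A ⟶ Z, ∀ k, i k ≫ h = u k
  hom_ext : ∀ {Z : V} {g h : A ⟶ Z}, (∀ k, i k ≫ g = i k ≫ h) → g = h

namespace IsSum

variable {K : Type v} {B : K → V} {A : V} {i : ∀ k, B k ⟶ A}

/-- The morphism out of a coproduct given by its restrictions to the summands. -/
noncomputable def desc (hi : IsSum i) {Z : V} (u : ∀ k, B k ⟶ Z) : A ⟶ Z :=
  (hi.exists_desc u).choose

@[simp]
theorem fac (hi : IsSum i) {Z : V} (u : ∀ k, B k ⟶ Z) (k : K) : i k ≫ hi.desc u = u k :=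
  (hi.exists_desc u).choose_spec k

@[simp]
theorem fac_assoc (hi : IsSum i) {Z Z' : V} (u : ∀ k, B k ⟶ Z) (k : K) (h : Z ⟶ Z') :
    i k ≫ hi.desc u ≫ h = u k ≫ h := by
  rw [← Category.assoc, fac]

/-- A coproduct in the sense of `IsSum` is a colimit cofan. -/
noncomputable def isColimit (hi : IsSum i) : IsColimit (Cofan.mk A i) :=
  Cofan.IsColimit.mk _ (fun t => hi.desc t.inj) (fun t k => hi.fac t.inj k)
    fun t _ hm => hi.hom_ext fun k => (hm k).trans (hi.fac t.inj k).symm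

theorem sigma [HasColimits V] (B : K → V) : IsSum (Sigma.ι B) where
  exists_desc u := ⟨Sigma.desc u, fun k => Sigma.ι_desc u k⟩
  hom_ext h := Sigma.hom_ext _ _ h

theorem of_isIso (hi : IsSum i) {A' : V} (f : A ⟶ A') [IsIso f] : IsSum fun k => i k ≫ f where
  exists_desc u := ⟨inv f ≫ hi.desc u, fun k => by simp⟩
  hom_ext h := by
    rw [← cancel_epi f]
    exact hi.hom_ext fun k => by simpa using h k

theorem comp_prod (hi : IsSum i) {L : Type v} {C : K → L → V} {j : ∀ k l, C k l ⟶ B k}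
    (hj : ∀ k, IsSum (j k)) :
    IsSum (B := fun p : K × L => C p.1 p.2) fun p => j p.1 p.2 ≫ i p.1 where
  exists_desc u := ⟨hi.desc fun k => (hj k).desc fun l => u ⟨k, l⟩, fun p => by simp⟩
  hom_ext h := hi.hom_ext fun k => (hj k).hom_ext fun l => by simpa using h ⟨k, l⟩

section Monoidal

variable [MonoidalCategory V] [MonoidalClosed V] (W : V)

/-- Closedness makes tensoring a left adjoint; the universal property is transported by currying. -/
theorem whiskerLeft (hi : IsSum i) : IsSum fun k => W ◁ i k where
  exists_desc u := ⟨MonoidalClosed.uncurry (hi.desc fun k => MonoidalClosed.curry (u k)),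
    fun k => by
      rw [← MonoidalClosed.uncurry_natural_left]
      simp⟩
  hom_ext h := by
    apply MonoidalClosed.curry_injective
    refine hi.hom_ext fun k => ?_
    rw [← MonoidalClosed.curry_natural_left, ← MonoidalClosed.curry_natural_left, h]

variable [SymmetricCategory V]

theorem whiskerRight (hi : IsSum i) : IsSum fun k => i k ▷ W where
  exists_desc u := ⟨(β_ _ _).hom ≫ (hi.whiskerLeft W).desc fun k => (β_ _ _).hom ≫ u k,
    fun k => by
      rw [BraidedCategory.braiding_naturality_left_assoc]
      refine (congrArg ((β_ _ _).hom ≫ ·) ((hi.whiskerLeft W).fac _ k)).trans ?_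
      simp⟩
  hom_ext {Z g h} w := by
    rw [← cancel_epi (β_ W A).hom]
    exact (hi.whiskerLeft W).hom_ext fun k => by simp [w]

theorem tensor (hi : IsSum i) {L : Type v} {B' : L → V} {A' : V} {j : ∀ l, B' l ⟶ A'}
    (hj : IsSum j) : IsSum (B := fun p : K × L => B p.1 ⊗ B' p.2) fun p => i p.1 ⊗ₘ j p.2 := by
  have := (hi.whiskerRight A').comp_prod fun k => hj.whiskerLeft (B k)
  simpa only [MonoidalCategory.tensorHom_def'] using this

end Monoidal

end IsSum

variable [HasColimits V]

/-- The morphism `f : A ⟶ ∐_L A` sends the summand `B k` of `A` to the copy with index `p k`. -/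
def IsLabelling {K : Type v} {B : K → V} {A : V} (i : ∀ k, B k ⟶ A) {L : Type v}
    (f : A ⟶ ∐ fun _ : L => A) (p : K → L) : Prop :=
  ∀ k, i k ≫ f = i k ≫ Sigma.ι (fun _ : L => A) (p k)

/-- The morphism `h` equalizes two labellings of the summands of `A`, which coincide at most on
the summands which satisfy `P`. -/
def IsSupported {K : Type v} {B : K → V} {A : V} (i : ∀ k, B k ⟶ A) {Z : V} (h : Z ⟶ A)
    (P : K → Prop) : Prop :=
  ∃ (L : Type v) (f g : A ⟶ ∐ fun _ : L => A) (p q : K → L), IsLabelling i f p ∧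
    IsLabelling i g q ∧ h ≫ f = h ≫ g ∧ ∀ k, p k = q k → P k

section

variable {K : Type v} {B : K → V} {A : V} {i : ∀ k, B k ⟶ A}

theorem IsLabelling.const {L : Type v} (l : L) :
    IsLabelling i (Sigma.ι (fun _ : L => A) l) fun _ => l := fun _ => rfl

theorem IsLabelling.comp_desc {L : Type v} {f : A ⟶ ∐ fun _ : L => A} {p : K → L}
    (hf : IsLabelling i f p) {Z : V} (u : L → (A ⟶ Z)) (k : K) :
    i k ≫ f ≫ Sigma.desc u = i k ≫ u (p k) := by
  rw [← Category.assoc, hf, Category.assoc, Sigma.ι_desc]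

/-- On each summand both labels are constants, so the order in which they are read does not matter.
-/
theorem IsLabelling.comm (hi : IsSum i) {L M : Type v} {f : A ⟶ ∐ fun _ : L => A}
    {g : A ⟶ ∐ fun _ : M => A} {p : K → L} {q : K → M} (hf : IsLabelling i f p)
    (hg : IsLabelling i g q) {Z : V} (u : L → M → (A ⟶ Z)) :
    f ≫ Sigma.desc (fun l => g ≫ Sigma.desc fun m => u l m) =
      g ≫ Sigma.desc (fun m => f ≫ Sigma.desc fun l => u l m) :=
  hi.hom_ext fun k => by
    rw [hf.comp_desc, hg.comp_desc, hg.comp_desc, hf.comp_desc]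

/-- The witness labels by pairs. An equation after `h` can only be applied to the label that is read
first, so `f` is replaced by `g`, the two labels are swapped by `IsLabelling.comm`, `f'` is replaced
by `g'`, and the labels are swapped back. -/
theorem IsSupported.and (hi : IsSum i) {Z : V} {h : Z ⟶ A} {P Q : K → Prop}
    (hP : IsSupported i h P) (hQ : IsSupported i h Q) : IsSupported i h fun k => P k ∧ Q k := by
  obtain ⟨L, f, g, p, q, hf, hg, e, w⟩ := hP
  obtain ⟨M, f', g', p', q', hf', hg', e', w'⟩ := hQ
  refine ⟨L × M,
    f ≫ Sigma.desc fun l => f' ≫ Sigma.desc fun m => Sigma.ι (fun _ : L × M => A) (l, m),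
    g ≫ Sigma.desc fun l => g' ≫ Sigma.desc fun m => Sigma.ι (fun _ : L × M => A) (l, m),
    fun k => (p k, p' k), fun k => (q k, q' k), fun k => ?_, fun k => ?_, ?_, fun k hk => ?_⟩
  · rw [hf.comp_desc, hf'.comp_desc]
  · rw [hg.comp_desc, hg'.comp_desc]
  · rw [reassoc_of% e, hg.comm hi hf', reassoc_of% e', hg'.comm hi hg]
  · exact ⟨w k (congrArg Prod.fst hk), w' k (congrArg Prod.snd hk)⟩

end

section Decomposing

theorem isDecomposingMor_ι {S : Type v} (A : V) (s : S) :
    IsDecomposingMor (Sigma.ι (fun _ : S => A) s) where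
  comp_map := by simp
  comp_desc := by simp

/-- The axioms are read off from the operator `u ↦ f ≫ Sigma.desc u` on families of morphisms: it
recovers the identity from the constant family `𝟙 A`, and applying it twice amounts to restricting
to the diagonal. In this form they can be verified for morphisms composed from several labellings.
-/
theorem IsDecomposingMor.of_desc {S : Type v} {A : V} {f : A ⟶ ∐ fun _ : S => A}
    (h₁ : f ≫ Sigma.desc (fun _ : S => 𝟙 A) = 𝟙 A)
    (h₂ : ∀ {Z : V} (u : S → S → (A ⟶ Z)),
      f ≫ Sigma.desc (fun s => f ≫ Sigma.desc fun t => u s t) = f ≫ Sigma.desc fun s => u s s) :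
    IsDecomposingMor f where
  comp_map := by
    -- The universal choice of `u`: the copy of `A` in the iterated coproduct with outer index `s`
    -- and inner index `t`.
    have := h₂ fun s t => Sigma.ι (fun _ : S => A) t ≫ Sigma.ι (fun _ : S => ∐ fun _ : S => A) s
    convert this using 2
    · refine Sigma.hom_ext _ _ fun s => ?_
      rw [Sigma.ι_map, Sigma.ι_desc]
      refine congrArg (f ≫ ·) (Sigma.hom_ext _ _ fun t => ?_)
      rw [Sigma.ι_desc]
    · refine Sigma.hom_ext _ _ fun s => ?_
      rw [Sigma.ι_map, Sigma.ι_desc]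
  comp_desc := h₁

theorem IsDecomposingMor.comp_desc_desc {S : Type v} {A : V} {f : A ⟶ ∐ fun _ : S => A}
    (hf : IsDecomposingMor f) {Z : V} (u : S → S → (A ⟶ Z)) :
    f ≫ Sigma.desc (fun s => f ≫ Sigma.desc fun t => u s t) = f ≫ Sigma.desc fun s => u s s := by
  have := congrArg (· ≫ Sigma.desc fun s => Sigma.desc fun t => u s t) hf.comp_map
  simp only [Category.assoc] at this
  convert this using 2
  · exact Sigma.hom_ext _ _ fun s => by simp
  · exact Sigma.hom_ext _ _ fun s => by simp

/-- Labels may be changed along any map, injective or not: the operator of the new morphism at `u`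
is that of `f` at `u ∘ σ`. -/
theorem IsDecomposingMor.comp_reindex {S T : Type v} {A : V} {f : A ⟶ ∐ fun _ : S => A}
    (hf : IsDecomposingMor f) (σ : S → T) :
    IsDecomposingMor (f ≫ Sigma.desc fun s => Sigma.ι (fun _ : T => A) (σ s)) := by
  have key : ∀ {Z : V} (u : T → (A ⟶ Z)),
      (f ≫ Sigma.desc fun s => Sigma.ι (fun _ : T => A) (σ s)) ≫ Sigma.desc u =
        f ≫ Sigma.desc fun s => u (σ s) := fun u => by
    rw [Category.assoc]
    exact congrArg (f ≫ ·) (Sigma.hom_ext _ _ fun s => by simp)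
  refine .of_desc ?_ fun u => ?_
  · rw [key, hf.comp_desc]
  · simp only [key, hf.comp_desc_desc]

theorem decomposingFork_ι [HasLimits V] {T S : Type v} {A : T → V}
    (f : ∀ t, A t ⟶ ∐ fun _ : S => A t) (j : S) :
    (decomposingFork f j).ι = Sigma.desc fun t =>
      equalizer.ι (f t) (Sigma.ι (fun _ : S => A t) j) ≫ Sigma.ι A t := by
  refine Sigma.hom_ext _ _ fun t => ?_
  rw [Sigma.ι_desc]
  exact Sigma.ι_map (fun t => equalizer.ι (f t) (Sigma.ι (fun _ : S => A t) j)) t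

end Decomposing

end Sums

/-! ### Consequences of the axioms for a decomposing category. -/

namespace IsDecomposing

variable {V : Type u} [Category.{v} V] [MonoidalCategory V] [HasLimits V] [HasColimits V]

theorem mono (hV : IsDecomposing.{v} V) {K : Type v} {B : K → V} {A : V} {i : ∀ k, B k ⟶ A}
    (hi : IsSum i) (k : K) : Mono (i k) :=
  (hV.disjoint B).mono_inj hi.isColimit k

/-- The inclusion of the coproduct of some of the summands is a monomorphism. -/
theorem mono_of_injective (hV : IsDecomposing.{v} V) {K L : Type v} {B : K → V} {A : V}
    {i : ∀ k, B k ⟶ A} (hi : IsSum i) {B' : L → V} {A' : V} {j : ∀ l, B' l ⟶ A'} (hj : IsSum j)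
    (p : K → L) (hp : Function.Injective p) (e : ∀ k, B k ≅ B' (p k)) (m : A ⟶ A')
    (hm : ∀ k, i k ≫ m = (e k).hom ≫ j (p k)) : Mono m := by
  classical
  -- `A'` is mapped to the binary coproduct of `A` and the summands outside the range of `p`. There
  -- `m` becomes a coprojection, which is monic by disjointness, and so `m` is monic.
  let C : ULift.{v} Bool → V := fun x => if x.down then A else
    ∐ fun l : { l : L // l ∉ Set.range p } => B' l
  let ι₁ : A ⟶ ∐ C := Sigma.ι C ⟨true⟩
  have : Mono ι₁ := hV.mono (IsSum.sigma C) ⟨true⟩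
  let ι₀ : (∐ fun l : { l : L // l ∉ Set.range p } => B' l) ⟶ ∐ C := Sigma.ι C ⟨false⟩
  let r : A' ⟶ ∐ C := hj.desc fun l => if h : l ∈ Set.range p then
      eqToHom (by rw [h.choose_spec]) ≫ (e h.choose).inv ≫ i h.choose ≫ ι₁
    else Sigma.ι (fun l : { l : L // l ∉ Set.range p } => B' l) ⟨l, h⟩ ≫ ι₀
  have hr : m ≫ r = ι₁ := hi.hom_ext fun k => by
    rw [reassoc_of% (hm k), hj.fac, dif_pos ⟨k, rfl⟩]
    -- The index chosen from membership in the range equals `k` only by injectivity of `p`, so it is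
    -- first generalized.
    have key : ∀ (k' : K) (h : k' = k) (h' : B' (p k) = B' (p k')),
        (e k).hom ≫ eqToHom h' ≫ (e k').inv ≫ i k' ≫ ι₁ = i k ≫ ι₁ := by
      rintro k' rfl h'
      simp
    exact key _ (hp (⟨k, rfl⟩ : p k ∈ Set.range p).choose_spec) _
  exact mono_of_mono_fac hr

section

variable {T S : Type v} {A : T → V} {f : ∀ t, A t ⟶ ∐ fun _ : S => A t}

/-- This is the existence half of axiom (a), and `mono_desc` is the uniqueness half. The index `j`
has to be the same for all `t`, which is why labels are normalized before either one is applied. -/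
theorem exists_lift (hV : IsDecomposing.{v} V) (hf : ∀ t, IsDecomposingMor (f t)) (j : S) {Z : V}
    (h : Z ⟶ ∐ A) (w : h ≫ Limits.Sigma.map (f := A) (g := fun t => ∐ fun _ : S => A t) f =
      h ≫ Limits.Sigma.map (f := A) (g := fun t => ∐ fun _ : S => A t)
        fun t => Sigma.ι (fun _ : S => A t) j) :
    ∃ y : Z ⟶ ∐ fun t => equalizer (f t) (Sigma.ι (fun _ : S => A t) j),
      y ≫ Sigma.desc (fun t => equalizer.ι (f t) (Sigma.ι (fun _ : S => A t) j) ≫ Sigma.ι A t) =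
        h := by
  obtain ⟨hlim⟩ := hV.coproduct f hf j
  obtain ⟨y, hy⟩ := Fork.IsLimit.lift' hlim h w
  exact ⟨y, (congrArg (y ≫ ·) (decomposingFork_ι f j).symm).trans hy⟩

theorem mono_desc (hV : IsDecomposing.{v} V) (hf : ∀ t, IsDecomposingMor (f t)) (j : S) :
    Mono (Sigma.desc fun t => equalizer.ι (f t) (Sigma.ι (fun _ : S => A t) j) ≫ Sigma.ι A t) := by
  obtain ⟨hlim⟩ := hV.coproduct f hf j
  have := Fork.IsLimit.mono hlim
  rw [← decomposingFork_ι]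
  exact this

end

/-- A morphism which is supported on certain summands factors through their coproduct. -/
theorem factors (hV : IsDecomposing.{v} V) {K : Type v} {B : K → V} {A : V}
    {i : ∀ k, B k ⟶ A} (hi : IsSum i) {Z : V} {h : Z ⟶ A} {P : K → Prop}
    (hh : IsSupported i h P) {M : V} (m : M ⟶ A)
    (hm : ∀ k, P k → ∃ w : B k ⟶ M, w ≫ m = i k) : ∃ w : Z ⟶ M, w ≫ m = h := by
  obtain ⟨L, f, g, p, q, hf, hg, e, hpq⟩ := hh
  -- The two labellings are reduced to one: the summand `B k` gets as label the truth value of `p k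
  -- = q k`, to be compared with the constant label `True`.
  let Ω := ULift.{v} Prop
  let t : Ω := ⟨True⟩
  let x : K → Ω := fun k => ⟨p k = q k⟩
  let φ : ∀ k, B k ⟶ ∐ fun _ : Ω => B k := fun k => Sigma.ι (fun _ : Ω => B k) (x k)
  let c : A ⟶ ∐ B := hi.desc (Sigma.ι B)
  -- In the copy of `A` with index `l`, the summand `k` is relabelled by `l = q k`. After `f` this
  -- is the truth value of `p k = q k`, after `g` it is always true, so `h` equalizes the two
  -- resulting morphisms.
  let r : (∐ fun _ : L => A) ⟶ ∐ fun k => ∐ fun _ : Ω => B k :=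
    Sigma.desc fun l => hi.desc fun k => Sigma.ι (fun _ : Ω => B k) ⟨l = q k⟩ ≫
      Sigma.ι (fun k => ∐ fun _ : Ω => B k) k
  have h1 : f ≫ r = c ≫ Limits.Sigma.map (f := B) (g := fun k => ∐ fun _ : Ω => B k) φ :=
    hi.hom_ext fun k => by
      rw [hf.comp_desc, hi.fac, hi.fac_assoc, Sigma.ι_map]
  have h2 : g ≫ r = c ≫ Limits.Sigma.map (f := B) (g := fun k => ∐ fun _ : Ω => B k)
      fun k => Sigma.ι (fun _ : Ω => B k) t :=
    hi.hom_ext fun k => by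
      rw [hg.comp_desc, hi.fac, hi.fac_assoc, Sigma.ι_map]
      simp [t]
  have h3 : (h ≫ c) ≫ Limits.Sigma.map (f := B) (g := fun k => ∐ fun _ : Ω => B k) φ =
      (h ≫ c) ≫ Limits.Sigma.map (f := B) (g := fun k => ∐ fun _ : Ω => B k)
        fun k => Sigma.ι (fun _ : Ω => B k) t := by
    rw [Category.assoc, Category.assoc, ← h1, ← h2, reassoc_of% e]
  obtain ⟨y, hy⟩ := hV.exists_lift (fun k => isDecomposingMor_ι _ _) t _ h3
  -- If the labels agree, the given factorization of `i k` is used. Otherwise the equalizer maps to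
  -- the pullback of two distinct coprojections, which is initial by disjointness and so maps to `M`
  -- compatibly with every morphism to `A`.
  have hw : ∀ k, ∃ w : equalizer (φ k) (Sigma.ι (fun _ : Ω => B k) t) ⟶ M,
      w ≫ m = equalizer.ι (φ k) (Sigma.ι (fun _ : Ω => B k) t) ≫ i k := fun k => by
    by_cases hk : p k = q k
    · obtain ⟨w, hw⟩ := hm k (hpq k hk)
      exact ⟨equalizer.ι _ _ ≫ w, by rw [Category.assoc, hw]⟩
    · have hx : x k ≠ t := fun h => hk (by
        have := congrArg ULift.down h
        simpa [x, t] using this)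
      have hd := hV.disjoint fun _ : Ω => B k
      let I := IsInitial.ofCoproductDisjoint (X := fun _ : Ω => B k) hx
      refine ⟨pullback.lift _ _ (equalizer.condition _ _) ≫ I.to M, ?_⟩
      rw [Category.assoc, I.hom_ext (I.to M ≫ m) (pullback.fst _ _ ≫ i k),
        pullback.lift_fst_assoc]
  choose w hw using hw
  refine ⟨y ≫ Sigma.desc w, ?_⟩
  have h4 : (y ≫ Sigma.desc fun k => equalizer.ι (φ k) (Sigma.ι (fun _ : Ω => B k) t) ≫
      Sigma.ι B k) ≫ Sigma.desc i = h := by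
    rw [hy, Category.assoc, show c ≫ Sigma.desc i = 𝟙 A from hi.hom_ext fun k => by simp [c],
      Category.comp_id]
  rw [← h4, Category.assoc, Category.assoc]
  refine congrArg (y ≫ ·) (Sigma.hom_ext _ _ fun k => ?_)
  simp [hw]

/-- The equalizers of a decomposing morphism on `A` and the coprojections decompose `A`. -/
theorem isSum_equalizer (hV : IsDecomposing.{v} V) {S : Type v} {A : V}
    {f : A ⟶ ∐ fun _ : S => A} (hf : IsDecomposingMor f) :
    IsSum fun s => equalizer.ι f (Sigma.ι (fun _ : S => A) s) := by
  classical
  -- The equalizers with `ι_t` involve a coprojection that varies with `t`, whereas axiom (a) needs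
  -- a fixed one. Renaming the label `t` to `none` in the `t`-th copy of `A` makes `ι_none` serve
  -- for all `t`.
  let σ : S → S → Option S := fun t s => if s = t then none else some s
  let φ : S → (A ⟶ ∐ fun _ : Option S => A) := fun t =>
    f ≫ Sigma.desc fun s => Sigma.ι (fun _ : Option S => A) (σ t s)
  have hφ : ∀ t, IsDecomposingMor (φ t) := fun t => hf.comp_reindex _
  -- Reading the label twice gives the same value `t` both times, and `σ t t = none`.
  have h1 : f ≫ Limits.Sigma.map (f := fun _ : S => A) (g := fun _ => ∐ fun _ : Option S => A) φ =
      f ≫ Limits.Sigma.map (f := fun _ : S => A) (g := fun _ => ∐ fun _ : Option S => A)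
        fun _ => Sigma.ι (fun _ : Option S => A) none := by
    have := hf.comp_desc_desc fun t s => Sigma.ι (fun _ : Option S => A) (σ t s) ≫
      Sigma.ι (fun _ : S => ∐ fun _ : Option S => A) t
    convert this using 2
    · refine Sigma.hom_ext _ _ fun s => ?_
      rw [Sigma.ι_map, Sigma.ι_desc, Category.assoc]
      refine congrArg (f ≫ ·) (Sigma.hom_ext _ _ fun t => ?_)
      simp
    · exact Sigma.hom_ext _ _ fun s => by simp [σ]
  obtain ⟨y, hy⟩ := hV.exists_lift hφ none _ h1
  have := hV.mono_desc hφ none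
  -- The renaming is undone by `Option.getD · t`, so the equalizer of `φ t` and `ι_none` is that of
  -- `f` and `ι_t`.
  have h2 : ∀ t, equalizer.ι (φ t) (Sigma.ι (fun _ : Option S => A) none) ≫ f =
      equalizer.ι (φ t) (Sigma.ι (fun _ : Option S => A) none) ≫ Sigma.ι (fun _ : S => A) t := by
    intro t
    have := equalizer.condition (φ t) (Sigma.ι (fun _ : Option S => A) none)
    have := congrArg (· ≫ Sigma.desc fun s => Sigma.ι (fun _ : S => A) (s.getD t)) this
    simp only [Category.assoc, Sigma.ι_desc] at this
    refine Eq.trans ?_ this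
    refine congrArg (equalizer.ι (φ t) _ ≫ ·) ?_
    refine (Category.comp_id f).symm.trans ?_
    simp only [φ, Category.assoc]
    refine congrArg (f ≫ ·) (Sigma.hom_ext _ _ fun s => ?_)
    by_cases hs : s = t <;> simp [σ, hs]
  have h3 : ∀ t, equalizer.ι f (Sigma.ι (fun _ : S => A) t) ≫ φ t =
      equalizer.ι f (Sigma.ι (fun _ : S => A) t) ≫ Sigma.ι (fun _ : Option S => A) none := by
    intro t
    simp only [φ]
    rw [equalizer.condition_assoc, Sigma.ι_desc]
    simp [σ]
  let a : ∀ t, equalizer (φ t) (Sigma.ι (fun _ : Option S => A) none) ⟶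
      equalizer f (Sigma.ι (fun _ : S => A) t) := fun t => equalizer.lift _ (h2 t)
  let b : ∀ t, equalizer f (Sigma.ι (fun _ : S => A) t) ⟶
      equalizer (φ t) (Sigma.ι (fun _ : Option S => A) none) := fun t => equalizer.lift _ (h3 t)
  have hba : ∀ t, b t ≫ a t = 𝟙 _ := fun t => equalizer.hom_ext (by simp [a, b])
  have hb : ∀ t, b t ≫ equalizer.ι (φ t) (Sigma.ι (fun _ : Option S => A) none) =
      equalizer.ι f (Sigma.ι (fun _ : S => A) t) := fun t => equalizer.lift_ι _ _
  have ha : ∀ t, a t ≫ equalizer.ι f (Sigma.ι (fun _ : S => A) t) =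
      equalizer.ι (φ t) (Sigma.ι (fun _ : Option S => A) none) := fun t => equalizer.lift_ι _ _
  -- The morphism `y` is the inverse of the comparison from the coproduct of the equalizers to `A`.
  -- This direction uses the uniqueness half of (a); the direction `hyd` uses that the codiagonal
  -- composed with `f` is the identity.
  have hey : ∀ t, equalizer.ι f (Sigma.ι (fun _ : S => A) t) ≫ y = b t ≫ Sigma.ι
      (fun t => equalizer (φ t) (Sigma.ι (fun _ : Option S => A) none)) t := fun t => by
    rw [← cancel_mono (Sigma.desc fun t => equalizer.ι (φ t)
      (Sigma.ι (fun _ : Option S => A) none) ≫ Sigma.ι (fun _ : S => A) t), Category.assoc, hy,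
      Category.assoc, Sigma.ι_desc, reassoc_of% (hb t), equalizer.condition]
  have hyd : y ≫ Sigma.desc (fun t => a t ≫ equalizer.ι f (Sigma.ι (fun _ : S => A) t)) = 𝟙 A := by
    rw [← hf.comp_desc]
    conv_rhs => rw [← hy, Category.assoc]
    refine congrArg (y ≫ ·) (Sigma.hom_ext _ _ fun t => ?_)
    simp [ha]
  refine ⟨fun u => ⟨y ≫ Sigma.desc fun t => a t ≫ u t, fun t => ?_⟩, fun {Z g h} w => ?_⟩
  · rw [reassoc_of% (hey t), Sigma.ι_desc, reassoc_of% (hba t)]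
  · have key : ∀ g : A ⟶ Z, g = y ≫ Sigma.desc
        (fun t => a t ≫ equalizer.ι f (Sigma.ι (fun _ : S => A) t) ≫ g) := fun g => by
      conv_lhs => rw [← Category.id_comp g, ← hyd, Category.assoc]
      refine congrArg (y ≫ ·) (Sigma.hom_ext _ _ fun t => ?_)
      simp
    rw [key g, key h]
    simp only [w]

end IsDecomposing

end

/-! ### Tensoring with `F(S)`: families of morphisms as morphisms out of `A ⊗ F(S)` and `F(S) ⊗ A`.
-/

section

open Functor.OplaxMonoidal Functor.LaxMonoidal

/-- The comultiplication of `F(S)`. -/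
noncomputable def diag (V : Type u) [Category.{v} V] [MonoidalCategory V] [HasColimits V]
    (S : Type v) : (∐ fun _ : S => 𝟙_ V) ⟶ (∐ fun _ : S => 𝟙_ V) ⊗ ∐ fun _ : S => 𝟙_ V :=
  Sigma.desc fun s => (λ_ (𝟙_ V)).inv ≫
    (Sigma.ι (fun _ : S => 𝟙_ V) s ⊗ₘ Sigma.ι (fun _ : S => 𝟙_ V) s)

@[simp]
theorem ι_diag {V : Type u} [Category.{v} V] [MonoidalCategory V] [HasColimits V] {S : Type v}
    (s : S) : Sigma.ι (fun _ : S => 𝟙_ V) s ≫ diag V S = (λ_ (𝟙_ V)).inv ≫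
    (Sigma.ι (fun _ : S => 𝟙_ V) s ⊗ₘ Sigma.ι (fun _ : S => 𝟙_ V) s) :=
  Sigma.ι_desc _ _

section Integral

variable {V : Type u} [Category.{v} V] [MonoidalCategory V] [HasColimits V] [MonoidalClosed V]
  {S : Type v} {A W Z : V}

/-- The morphism out of `A ⊗ F(S)` which is `k s` on the summand with index `s`. -/
noncomputable def integralRight (k : S → (A ⟶ Z)) : A ⊗ (∐ fun _ : S => 𝟙_ V) ⟶ Z :=
  leftDesc A (fun _ : S => 𝟙_ V) fun s => (ρ_ A).hom ≫ k s

@[simp]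
theorem ι_integralRight (k : S → (A ⟶ Z)) (s : S) :
    A ◁ Sigma.ι (fun _ : S => 𝟙_ V) s ≫ integralRight k = (ρ_ A).hom ≫ k s :=
  ι_leftDesc _ _ _ _

@[simp]
theorem ι_integralRight_assoc : type_of% (reassoc_of% @ι_integralRight.{v, u}) :=
  @(reassoc_of% @ι_integralRight.{v, u})

theorem whiskerRight_integralRight {A' : V} (g : A' ⟶ A) (k : S → (A ⟶ Z)) :
    g ▷ (∐ fun _ : S => 𝟙_ V) ≫ integralRight k = integralRight fun s => g ≫ k s :=
  left_hom_ext fun s => by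
    rw [whisker_exchange_assoc]
    simp

theorem integralRight_comp {Z' : V} (k : S → (A ⟶ Z)) (g : Z ⟶ Z') :
    integralRight k ≫ g = integralRight fun s => k s ≫ g :=
  left_hom_ext fun s => by simp

-- Half of the isomorphism `A ⊗ F(S) ≅ ∐_S A`, enough to turn an equation about labels back into one
-- about coactions.
@[simp]
theorem integralRight_inv :
    integralRight (Sigma.ι fun _ : S => A) ≫
      Sigma.desc (fun s => (ρ_ A).inv ≫ A ◁ Sigma.ι (fun _ : S => 𝟙_ V) s) = 𝟙 _ :=
  left_hom_ext fun s => by simp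

/-- The diagonal of `F(S)` reaches only the summands with equal indices. This turns coassociativity
of a coaction into the idempotence condition of a decomposing morphism. -/
theorem diag_integralRight (k : S → S → (A ⟶ Z)) :
    A ◁ diag V S ≫ (α_ _ _ _).inv ≫ integralRight (fun s => integralRight fun t => k s t) =
      integralRight fun s => k s s := by
  refine left_hom_ext fun s => ?_
  rw [← MonoidalCategory.whiskerLeft_comp_assoc, ι_diag, MonoidalCategory.tensorHom_def,
    MonoidalCategory.whiskerLeft_comp, MonoidalCategory.whiskerLeft_comp, Category.assoc,
    Category.assoc, associator_inv_naturality_right_assoc, ι_integralRight,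
    rightUnitor_tensor_hom, Category.assoc, Iso.inv_hom_id_assoc,
    ← MonoidalCategory.whiskerLeft_comp_assoc, ← MonoidalCategory.whiskerLeft_comp_assoc]
  simp [unitors_inv_equal]

variable [SymmetricCategory V]

/-- The morphism out of `F(S) ⊗ A` which is `k s` on the summand with index `s`. -/
noncomputable def integralLeft (k : S → (A ⟶ Z)) : (∐ fun _ : S => 𝟙_ V) ⊗ A ⟶ Z :=
  rightDesc A (fun _ : S => 𝟙_ V) fun s => (λ_ A).hom ≫ k s

@[simp]
theorem ι_integralLeft (k : S → (A ⟶ Z)) (s : S) :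
    Sigma.ι (fun _ : S => 𝟙_ V) s ▷ A ≫ integralLeft k = (λ_ A).hom ≫ k s :=
  ι_rightDesc _ _ _ _

@[simp]
theorem ι_integralLeft_assoc : type_of% (reassoc_of% @ι_integralLeft.{v, u}) :=
  @(reassoc_of% @ι_integralLeft.{v, u})

theorem whiskerLeft_integralLeft {A' : V} (g : A' ⟶ A) (k : S → (A ⟶ Z)) :
    (∐ fun _ : S => 𝟙_ V) ◁ g ≫ integralLeft k = integralLeft fun s => g ≫ k s :=
  right_hom_ext fun s => by
    rw [← whisker_exchange_assoc]
    simp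

theorem integralLeft_comp {Z' : V} (k : S → (A ⟶ Z)) (g : Z ⟶ Z') :
    integralLeft k ≫ g = integralLeft fun s => k s ≫ g :=
  right_hom_ext fun s => by simp

/-- A Fubini rule: labels on the two sides of `A` may be read in either order. -/
theorem integralLeft_integralRight (k : S → S → (A ⟶ Z)) :
    (α_ (∐ fun _ : S => 𝟙_ V) A (∐ fun _ : S => 𝟙_ V)).hom ≫
        integralLeft (fun s => integralRight fun t => k s t) =
      integralRight fun t => integralLeft fun s => k s t := by
  refine left_hom_ext fun t =>
    (((IsSum.sigma fun _ : S => 𝟙_ V).whiskerRight A).whiskerRight (𝟙_ V)).hom_ext fun s => ?_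
  rw [ι_integralRight, rightUnitor_naturality_assoc, ι_integralLeft]
  rw [tensor_whiskerLeft, Category.assoc, Category.assoc, Iso.inv_hom_id_assoc,
    associator_naturality_left_assoc, ← whisker_exchange_assoc, ι_integralLeft,
    leftUnitor_naturality_assoc, ι_integralRight]
  have h : (α_ (𝟙_ V) A (𝟙_ V)).hom ≫ (λ_ (A ⊗ 𝟙_ V)).hom ≫ (ρ_ A).hom =
    (ρ_ (𝟙_ V ⊗ A)).hom ≫ (λ_ A).hom := by monoidal_coherence
  rw [reassoc_of% h]

theorem diag_integralLeft (k : S → S → (A ⟶ Z)) :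
    diag V S ▷ A ≫ (α_ _ _ _).hom ≫ integralLeft (fun s => integralLeft fun t => k s t) =
      integralLeft fun s => k s s := by
  refine right_hom_ext fun s => ?_
  rw [← comp_whiskerRight_assoc, ι_diag, MonoidalCategory.tensorHom_def', comp_whiskerRight,
    comp_whiskerRight, Category.assoc, Category.assoc, associator_naturality_left_assoc,
    ι_integralLeft, leftUnitor_tensor_hom, Category.assoc, Iso.hom_inv_id_assoc,
    ← comp_whiskerRight_assoc, ← comp_whiskerRight_assoc]
  simp

@[simp]
theorem integralLeft_inv :
    integralLeft (Sigma.ι fun _ : S => A) ≫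
      Sigma.desc (fun s => (λ_ A).inv ≫ Sigma.ι (fun _ : S => 𝟙_ V) s ▷ A) = 𝟙 _ :=
  right_hom_ext fun s => by simp

end Integral

end

/-! ### The left and right coactions of `F(S)` on a colax monoidal functor. -/

section

open Functor.OplaxMonoidal Functor.LaxMonoidal

section Coaction

variable {V : Type u} [Category.{v} V] [MonoidalCategory V] [HasColimits V]
  {C : Type u₁} [Category.{v₁} C] [MonoidalCategory C] (X : C ⥤ V) [X.OplaxMonoidal]
  {S : Type v} (φ : X.obj (𝟙_ C) ⟶ ∐ fun _ : S => 𝟙_ V)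

/-- The morphism `φ : X_0 ⟶ F(S)` is a morphism of comonoids. -/
structure IsBaseMor : Prop where
  counit : φ ≫ Sigma.desc (fun _ : S => 𝟙 (𝟙_ V)) = η X
  comul : φ ≫ diag V S = X.map (λ_ (𝟙_ C)).inv ≫ δ X (𝟙_ C) (𝟙_ C) ≫ (φ ⊗ₘ φ)

/-- The left coaction `X_n ⟶ F(S) ⊗ X_n`. -/
noncomputable def coactLeft (n : C) : X.obj n ⟶ (∐ fun _ : S => 𝟙_ V) ⊗ X.obj n :=
  X.map (λ_ n).inv ≫ δ X (𝟙_ C) n ≫ φ ▷ X.obj n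

/-- The right coaction `X_n ⟶ X_n ⊗ F(S)`. -/
noncomputable def coactRight (n : C) : X.obj n ⟶ X.obj n ⊗ ∐ fun _ : S => 𝟙_ V :=
  X.map (ρ_ n).inv ≫ δ X n (𝟙_ C) ≫ X.obj n ◁ φ

theorem coactRight_natural {m n : C} (g : m ⟶ n) :
    X.map g ≫ coactRight X φ n = coactRight X φ m ≫ X.map g ▷ _ := by
  simp only [coactRight, Category.assoc, whisker_exchange, δ_natural_left_assoc]
  simp only [← CategoryTheory.Functor.map_comp_assoc, rightUnitor_inv_naturality]

/-- Coassociativity at `(0, m, n)`: the comultiplication respects the left coaction. Its mirror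
image `δ_coactRight` is coassociativity at `(m, n, 0)`. -/
theorem δ_coactLeft (m n : C) : δ X m n ≫ coactLeft X φ m ▷ X.obj n ≫ (α_ _ _ _).hom =
    coactLeft X φ (m ⊗ n) ≫ _ ◁ δ X m n := by
  simp only [coactLeft, comp_whiskerRight, Category.assoc, δ_natural_left_assoc,
    associator_naturality_left, Functor.OplaxMonoidal.associativity_assoc, ← whisker_exchange]
  simp only [← CategoryTheory.Functor.map_comp_assoc]
  congr 2
  monoidal_coherence

theorem δ_coactRight (m n : C) : δ X m n ≫ X.obj m ◁ coactRight X φ n ≫ (α_ _ _ _).inv =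
    coactRight X φ (m ⊗ n) ≫ δ X m n ▷ _ := by
  simp only [coactRight, MonoidalCategory.whiskerLeft_comp, Category.assoc,
    δ_natural_right_assoc, associator_inv_naturality_right, whisker_exchange]
  have h := oplax_associativity X m n (𝟙_ C)
  have h' : δ X m (n ⊗ 𝟙_ C) ≫ X.obj m ◁ δ X n (𝟙_ C) ≫ (α_ _ _ _).inv =
      X.map (α_ _ _ _).inv ≫ δ X (m ⊗ n) (𝟙_ C) ≫ δ X m n ▷ _ := by
    rw [← cancel_mono (α_ _ _ _).hom]
    simp [h]
  rw [reassoc_of% h']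
  simp only [← CategoryTheory.Functor.map_comp_assoc]
  congr 2
  monoidal_coherence

/-- Coassociativity at `(m, 0, n)`: both sides split off `X_0` between the two factors. This is what
forces the two middle vertices in a comultiplication to agree. -/
theorem δ_coact_middle (m n : C) : δ X m n ≫ coactRight X φ m ▷ X.obj n ≫ (α_ _ _ _).hom =
    δ X m n ≫ X.obj m ◁ coactLeft X φ n := by
  simp only [coactRight, coactLeft, comp_whiskerRight, MonoidalCategory.whiskerLeft_comp,
    Category.assoc, δ_natural_left_assoc, δ_natural_right_assoc, associator_naturality_middle,
    Functor.OplaxMonoidal.associativity_assoc]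
  simp only [← CategoryTheory.Functor.map_comp_assoc]
  congr 2
  monoidal_coherence

/-- The left coaction is built from `μ_{0,n}`, which respects the right coaction by `δ_coactRight`;
naturality does the rest. -/
theorem coactLeft_coactRight (n : C) : coactLeft X φ n ≫ _ ◁ coactRight X φ n =
    coactRight X φ n ≫ coactLeft X φ n ▷ _ ≫ (α_ _ _ _).hom := by
  have h := δ_coactRight X φ (𝟙_ C) n
  rw [← cancel_mono (α_ _ _ _).inv]
  simp only [Category.assoc, Iso.hom_inv_id, Category.comp_id]
  conv_lhs => rw [coactLeft]
  simp only [Category.assoc, ← whisker_exchange_assoc]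
  rw [associator_inv_naturality_left, reassoc_of% h, reassoc_of% (coactRight_natural X φ)]
  simp [coactLeft]

variable {X φ}

/-- On `X_0` the coaction is the comultiplication of the comonoid with `φ` applied to one factor,
and `φ` carries this comultiplication to the diagonal. -/
theorem IsBaseMor.coactRight_unit (hφ : IsBaseMor X φ) :
    coactRight X φ (𝟙_ C) ≫ φ ▷ _ = φ ≫ diag V S := by
  rw [hφ.comul, coactRight, unitors_inv_equal]
  simp [MonoidalCategory.tensorHom_def']

theorem IsBaseMor.coactLeft_unit (hφ : IsBaseMor X φ) :
    coactLeft X φ (𝟙_ C) ≫ _ ◁ φ = φ ≫ diag V S := by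
  rw [hφ.comul, coactLeft]
  simp [MonoidalCategory.tensorHom_def]

/-- By `δ_coact_middle` the second coaction moves onto the factor `X_0` split off by the first one,
where `IsBaseMor.coactRight_unit` turns it into the diagonal. -/
theorem IsBaseMor.coactLeft_coassoc (hφ : IsBaseMor X φ) (n : C) :
    coactLeft X φ n ≫ _ ◁ coactLeft X φ n =
      coactLeft X φ n ≫ diag V S ▷ _ ≫ (α_ _ _ _).hom := by
  nth_rewrite 1 [coactLeft]
  nth_rewrite 2 [coactLeft]
  simp only [Category.assoc, ← whisker_exchange]
  rw [← reassoc_of% (δ_coact_middle X φ), ← associator_naturality_left,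
    ← comp_whiskerRight_assoc, ← comp_whiskerRight_assoc, hφ.coactRight_unit]

theorem IsBaseMor.coactRight_coassoc (hφ : IsBaseMor X φ) (n : C) :
    coactRight X φ n ≫ coactRight X φ n ▷ _ =
      coactRight X φ n ≫ _ ◁ diag V S ≫ (α_ _ _ _).inv := by
  nth_rewrite 1 [coactRight]
  nth_rewrite 2 [coactRight]
  have h := δ_coact_middle X φ n (𝟙_ C)
  rw [← Category.assoc, ← Iso.eq_comp_inv] at h
  simp only [Category.assoc] at h
  simp only [Category.assoc, whisker_exchange]
  rw [reassoc_of% h, ← associator_inv_naturality_right, ← MonoidalCategory.whiskerLeft_comp_assoc,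
    ← MonoidalCategory.whiskerLeft_comp_assoc, hφ.coactLeft_unit]

variable [MonoidalClosed V] (X φ)

/-- The right coaction as a morphism `X_n ⟶ ∐_S X_n`. -/
noncomputable def actRight (n : C) : X.obj n ⟶ ∐ fun _ : S => X.obj n :=
  coactRight X φ n ≫ integralRight (Sigma.ι fun _ : S => X.obj n)

theorem actRight_desc (n : C) {Z : V} (k : S → (X.obj n ⟶ Z)) :
    actRight X φ n ≫ Sigma.desc k = coactRight X φ n ≫ integralRight k := by
  rw [actRight, Category.assoc, integralRight_comp]
  simp

theorem coactRight_of_actRight {n : C} {A : V} {e : A ⟶ X.obj n} {s : S}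
    (h : e ≫ actRight X φ n = e ≫ Sigma.ι (fun _ : S => X.obj n) s) :
    e ≫ coactRight X φ n = e ≫ (ρ_ _).inv ≫ _ ◁ Sigma.ι (fun _ : S => 𝟙_ V) s := by
  have := congrArg (· ≫ Sigma.desc
    (fun s => (ρ_ (X.obj n)).inv ≫ X.obj n ◁ Sigma.ι (fun _ : S => 𝟙_ V) s)) h
  simpa only [actRight, Category.assoc, integralRight_inv, Sigma.ι_desc, Category.comp_id] using this

variable {X φ}

/-- Ignoring the label is the counit of `F(S)`; along `φ` it becomes the counit of `X`, which
cancels the factor `X_0`. -/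
theorem IsBaseMor.actRight_const (hφ : IsBaseMor X φ) (n : C) {Z : V} (k : X.obj n ⟶ Z) :
    actRight X φ n ≫ Sigma.desc (fun _ : S => k) = k := by
  have h : integralRight (fun _ : S => k) =
      X.obj n ◁ Sigma.desc (fun _ : S => 𝟙 (𝟙_ V)) ≫ (ρ_ _).hom ≫ k :=
    left_hom_ext fun s => by
      rw [ι_integralRight, ← MonoidalCategory.whiskerLeft_comp_assoc, Sigma.ι_desc]
      simp
  rw [actRight_desc, h, coactRight, Category.assoc, Category.assoc,
    ← MonoidalCategory.whiskerLeft_comp_assoc, hφ.counit]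
  rw [right_unitality_hom_assoc, ← CategoryTheory.Functor.map_comp_assoc]
  simp

theorem IsBaseMor.actRight_actRight (hφ : IsBaseMor X φ) (n : C) {Z : V}
    (k : S → S → (X.obj n ⟶ Z)) :
    actRight X φ n ≫ Sigma.desc (fun s => actRight X φ n ≫ Sigma.desc fun t => k s t) =
      actRight X φ n ≫ Sigma.desc fun s => k s s := by
  simp only [actRight_desc, ← whiskerRight_integralRight]
  rw [← Category.assoc, hφ.coactRight_coassoc, Category.assoc, Category.assoc]
  rw [diag_integralRight fun t s => k t s]

variable [SymmetricCategory V] (X φ)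

/-- The left coaction as a morphism `X_n ⟶ ∐_S X_n`. -/
noncomputable def actLeft (n : C) : X.obj n ⟶ ∐ fun _ : S => X.obj n :=
  coactLeft X φ n ≫ integralLeft (Sigma.ι fun _ : S => X.obj n)

theorem actLeft_desc (n : C) {Z : V} (k : S → (X.obj n ⟶ Z)) :
    actLeft X φ n ≫ Sigma.desc k = coactLeft X φ n ≫ integralLeft k := by
  rw [actLeft, Category.assoc, integralLeft_comp]
  simp

theorem coactLeft_of_actLeft {n : C} {A : V} {e : A ⟶ X.obj n} {s : S}
    (h : e ≫ actLeft X φ n = e ≫ Sigma.ι (fun _ : S => X.obj n) s) :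
    e ≫ coactLeft X φ n = e ≫ (λ_ _).inv ≫ Sigma.ι (fun _ : S => 𝟙_ V) s ▷ _ := by
  have := congrArg (· ≫ Sigma.desc
    (fun s => (λ_ (X.obj n)).inv ≫ Sigma.ι (fun _ : S => 𝟙_ V) s ▷ X.obj n)) h
  simpa only [actLeft, Category.assoc, integralLeft_inv, Sigma.ι_desc, Category.comp_id] using this

theorem actLeft_actRight (n : C) {Z : V} (k : S → S → (X.obj n ⟶ Z)) :
    actLeft X φ n ≫ Sigma.desc (fun s => actRight X φ n ≫ Sigma.desc fun t => k s t) =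
      actRight X φ n ≫ Sigma.desc (fun t => actLeft X φ n ≫ Sigma.desc fun s => k s t) := by
  simp only [actRight_desc, actLeft_desc, ← whiskerRight_integralRight, ← whiskerLeft_integralLeft]
  rw [reassoc_of% (coactLeft_coactRight X φ n), integralLeft_integralRight]

variable {X φ}

theorem IsBaseMor.actLeft_const (hφ : IsBaseMor X φ) (n : C) {Z : V} (k : X.obj n ⟶ Z) :
    actLeft X φ n ≫ Sigma.desc (fun _ : S => k) = k := by
  have h : integralLeft (fun _ : S => k) =
      Sigma.desc (fun _ : S => 𝟙 (𝟙_ V)) ▷ X.obj n ≫ (λ_ _).hom ≫ k :=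
    right_hom_ext fun s => by
      rw [ι_integralLeft, ← comp_whiskerRight_assoc, Sigma.ι_desc]
      simp
  rw [actLeft_desc, h, coactLeft, Category.assoc, Category.assoc,
    ← comp_whiskerRight_assoc, hφ.counit]
  rw [left_unitality_hom_assoc, ← CategoryTheory.Functor.map_comp_assoc]
  simp

theorem IsBaseMor.actLeft_actLeft (hφ : IsBaseMor X φ) (n : C) {Z : V}
    (k : S → S → (X.obj n ⟶ Z)) :
    actLeft X φ n ≫ Sigma.desc (fun s => actLeft X φ n ≫ Sigma.desc fun t => k s t) =
      actLeft X φ n ≫ Sigma.desc fun s => k s s := by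
  simp only [actLeft_desc, ← whiskerLeft_integralLeft]
  rw [reassoc_of% (hφ.coactLeft_coassoc n), diag_integralLeft]

variable (X φ)

/-- Both coactions as a morphism `X_n ⟶ ∐_{S × S} X_n`. -/
noncomputable def actBoth (n : C) : X.obj n ⟶ ∐ fun _ : S × S => X.obj n :=
  actLeft X φ n ≫ Sigma.desc fun s => actRight X φ n ≫ Sigma.desc fun t =>
    Sigma.ι (fun _ : S × S => X.obj n) (s, t)

theorem actBoth_desc (n : C) {Z : V} (k : S × S → (X.obj n ⟶ Z)) :
    actBoth X φ n ≫ Sigma.desc k =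
      actLeft X φ n ≫ Sigma.desc fun s => actRight X φ n ≫ Sigma.desc fun t => k (s, t) := by
  rw [actBoth, Category.assoc]
  refine congrArg (_ ≫ ·) (Sigma.hom_ext _ _ fun s => ?_)
  rw [Sigma.ι_desc_assoc, Sigma.ι_desc, Category.assoc]
  exact congrArg (_ ≫ ·) (Sigma.hom_ext _ _ fun t => by simp)

variable {X φ}

/-- The two conditions come from the counit and idempotence laws of the single actions, once these
are allowed to pass each other. -/
theorem IsBaseMor.isDecomposingMor_actBoth (hφ : IsBaseMor X φ) (n : C) :
    IsDecomposingMor (actBoth X φ n) := by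
  refine .of_desc ?_ fun u => ?_
  · rw [actBoth_desc]
    simp only [hφ.actRight_const, hφ.actLeft_const]
  · simp only [actBoth_desc]
    -- Source and target are read twice in alternation. Exchanging the two inner readings puts equal
    -- kinds next to each other, where they collapse.
    have h : ∀ s, actRight X φ n ≫ Sigma.desc (fun t => actLeft X φ n ≫ Sigma.desc fun s' =>
        actRight X φ n ≫ Sigma.desc fun t' => u (s, t) (s', t')) =
        actLeft X φ n ≫ Sigma.desc fun s' => actRight X φ n ≫ Sigma.desc fun t =>
          u (s, t) (s', t) := fun s => by
      rw [← actLeft_actRight X φ n fun s' t => actRight X φ n ≫ Sigma.desc fun t' =>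
        u (s, t) (s', t')]
      simp only [hφ.actRight_actRight]
    simp only [h, hφ.actLeft_actLeft]

end Coaction

end

/-! ### The parts `X_n(a, b)` of a based colax monoidal functor. -/

section

open Functor.OplaxMonoidal Functor.LaxMonoidal

namespace ColaxBased

variable {V : Type u} [Category.{v} V] [MonoidalCategory V] [HasLimits V] [HasColimits V]
  [MonoidalClosed V] [SymmetricCategory V]

/-- The morphism `h : A ⟶ X_n` lands in the part `X_n(a, b)`. -/
def IsPart (B : ColaxBased.{v} V) {n : FinIntᵒᵖ} {A : V} (h : A ⟶ B.fst.toFunctor.obj n)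
    (a b : B.snd) : Prop :=
  h ≫ B.dec n = h ≫ Sigma.ι (fun _ : B.snd × B.snd => B.fst.toFunctor.obj n) (a, b)

/-- The morphism `e_{a,b} : X_n(a, b) ⟶ X_n`, with the component of a quiver as its domain. -/
noncomputable def partInc (B : ColaxBased.{v} V) (n : FinIntᵒᵖ) (a b : B.snd) :
    (B.quiver.obj n).obj a b ⟶ B.fst.toFunctor.obj n :=
  B.e n a b

instance (B : ColaxBased.{v} V) (n : FinIntᵒᵖ) (a b : B.snd) : Mono (B.partInc n a b) :=
  inferInstanceAs (Mono (equalizer.ι _ _))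

theorem isPart_partInc (B : ColaxBased.{v} V) (n : FinIntᵒᵖ) (a b : B.snd) :
    B.IsPart (B.partInc n a b) a b :=
  equalizer.condition _ _

@[simp]
theorem quiver_map_partInc (B : ColaxBased.{v} V) {m n : FinIntᵒᵖ} (g : m ⟶ n) (a b : B.snd) :
    (B.quiver.map g).app a b ≫ B.partInc n a b = B.partInc m a b ≫ B.fst.toFunctor.map g :=
  equalizer.lift_ι _ _

@[simp]
theorem quiver_map_partInc_assoc : type_of% (reassoc_of% @quiver_map_partInc.{v, u}) :=
  @(reassoc_of% @quiver_map_partInc.{v, u})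

theorem isBaseMor (B : ColaxBased.{v} V) : IsBaseMor B.fst.toFunctor B.baseHom where
  counit := by
    refine (B.iso.hom.isComonHom_hom.hom_counit).trans ?_
    change B.fst.toFunctor.map (𝟙 _) ≫ η B.fst.toFunctor = _
    rw [CategoryTheory.Functor.map_id, Category.id_comp]
  comul := by
    refine (B.iso.hom.isComonHom_hom.hom_comul).trans ?_
    exact Category.assoc _ _ _

/-- Sliding the first `φ` past the second comultiplication separates `μ_{0,n,0}` into the left
coaction followed by the right one. -/
theorem dec_eq (B : ColaxBased.{v} V) (n : FinIntᵒᵖ) :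
    B.dec n = actBoth B.fst.toFunctor B.baseHom n := by
  have h : freeTensor B.snd (B.fst.toFunctor.obj n) = integralLeft fun s => integralRight fun t =>
      Sigma.ι (fun _ : B.snd × B.snd => B.fst.toFunctor.obj n) (s, t) := rfl
  have h' : B.fst.toFunctor.obj (𝟙_ _) ◁ (B.fst.toFunctor.map (ρ_ n).inv ≫
      δ B.fst.toFunctor n (𝟙_ _)) ≫ (B.baseHom ⊗ₘ (B.fst.toFunctor.obj n ◁ B.baseHom)) =
        B.baseHom ▷ _ ≫ _ ◁ coactRight B.fst.toFunctor B.baseHom n := by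
    rw [MonoidalCategory.tensorHom_def', ← MonoidalCategory.whiskerLeft_comp_assoc,
      whisker_exchange]
    simp only [coactRight, Category.assoc]
  rw [dec, h, reassoc_of% h', whiskerLeft_integralLeft]
  simp only [actBoth, actLeft_desc, actRight_desc, coactLeft, Category.assoc]

theorem isDecomposingMor_dec (B : ColaxBased.{v} V) (n : FinIntᵒᵖ) :
    IsDecomposingMor (B.dec n) :=
  B.dec_eq n ▸ B.isBaseMor.isDecomposingMor_actBoth n

/-- A marginal: ignoring the target leaves only the left action. With `dec_snd`, it splits the
condition `IsPart` into one on sources and one on targets. -/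
theorem dec_fst (B : ColaxBased.{v} V) (n : FinIntᵒᵖ) {Z : V}
    (k : B.snd → (B.fst.toFunctor.obj n ⟶ Z)) :
    B.dec n ≫ Sigma.desc (fun p => k p.1) =
      actLeft B.fst.toFunctor B.baseHom n ≫ Sigma.desc k := by
  rw [dec_eq, actBoth_desc]
  simp only [B.isBaseMor.actRight_const]

theorem dec_snd (B : ColaxBased.{v} V) (n : FinIntᵒᵖ) {Z : V}
    (k : B.snd → (B.fst.toFunctor.obj n ⟶ Z)) :
    B.dec n ≫ Sigma.desc (fun p => k p.2) =
      actRight B.fst.toFunctor B.baseHom n ≫ Sigma.desc k := by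
  rw [dec_eq, actBoth_desc]
  simp only [B.isBaseMor.actLeft_const]

namespace IsPart

variable {B : ColaxBased.{v} V} {n : FinIntᵒᵖ} {A : V} {h : A ⟶ B.fst.toFunctor.obj n}
  {a b : B.snd}

theorem comp_actLeft (hh : B.IsPart h a b) :
    h ≫ actLeft B.fst.toFunctor B.baseHom n =
      h ≫ Sigma.ι (fun _ : B.snd => B.fst.toFunctor.obj n) a := by
  have := B.dec_fst n (Sigma.ι fun _ : B.snd => B.fst.toFunctor.obj n)
  rw [← Category.comp_id (actLeft _ _ _), ← show Sigma.desc
    (Sigma.ι fun _ : B.snd => B.fst.toFunctor.obj n) = 𝟙 _ from Sigma.hom_ext _ _ (by simp),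
    ← this, ← Category.assoc, hh, Category.assoc, Sigma.ι_desc]

theorem comp_actRight (hh : B.IsPart h a b) :
    h ≫ actRight B.fst.toFunctor B.baseHom n =
      h ≫ Sigma.ι (fun _ : B.snd => B.fst.toFunctor.obj n) b := by
  have := B.dec_snd n (Sigma.ι fun _ : B.snd => B.fst.toFunctor.obj n)
  rw [← Category.comp_id (actRight _ _ _), ← show Sigma.desc
    (Sigma.ι fun _ : B.snd => B.fst.toFunctor.obj n) = 𝟙 _ from Sigma.hom_ext _ _ (by simp),
    ← this, ← Category.assoc, hh, Category.assoc, Sigma.ι_desc]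

theorem comp_coactLeft (hh : B.IsPart h a b) : h ≫ coactLeft B.fst.toFunctor B.baseHom n =
    h ≫ (λ_ _).inv ≫ Sigma.ι (fun _ : B.snd => 𝟙_ V) a ▷ _ :=
  coactLeft_of_actLeft _ _ hh.comp_actLeft

theorem comp_coactRight (hh : B.IsPart h a b) : h ≫ coactRight B.fst.toFunctor B.baseHom n =
    h ≫ (ρ_ _).inv ≫ _ ◁ Sigma.ι (fun _ : B.snd => 𝟙_ V) b :=
  coactRight_of_actRight _ _ hh.comp_actRight

theorem of_comp_coact (hl : h ≫ coactLeft B.fst.toFunctor B.baseHom n =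
      h ≫ (λ_ _).inv ≫ Sigma.ι (fun _ : B.snd => 𝟙_ V) a ▷ _)
    (hr : h ≫ coactRight B.fst.toFunctor B.baseHom n =
      h ≫ (ρ_ _).inv ≫ _ ◁ Sigma.ι (fun _ : B.snd => 𝟙_ V) b) : B.IsPart h a b := by
  rw [IsPart, dec_eq, actBoth, actLeft_desc, reassoc_of% hl, ι_integralLeft, Iso.inv_hom_id_assoc,
    actRight_desc, reassoc_of% hr, ι_integralRight, Iso.inv_hom_id_assoc]

/-- The factorization through `X_n(a, b)`. -/
noncomputable def lift (hh : B.IsPart h a b) : A ⟶ (B.quiver.obj n).obj a b :=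
  equalizer.lift h hh

@[simp]
theorem lift_partInc (hh : B.IsPart h a b) : hh.lift ≫ B.partInc n a b = h :=
  equalizer.lift_ι _ _

end IsPart

/-- This is where `X_n` is recovered from its parts, and hence why the counit of the adjunction will
be invertible. -/
theorem isSum_partInc (hV : IsDecomposing.{v} V) (B : ColaxBased.{v} V) (n : FinIntᵒᵖ) :
    IsSum fun p : B.snd × B.snd => B.partInc n p.1 p.2 :=
  hV.isSum_equalizer (B.isDecomposingMor_dec n)

section Map

variable {B C : ColaxBased.{v} V} (g : B ⟶ C)

theorem baseHom_natural : g.fst.hom.app (𝟙_ _) ≫ C.baseHom =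
    B.baseHom ≫ Sigma.desc fun s => Sigma.ι (fun _ : C.snd => 𝟙_ V) (g.snd s) :=
  congrArg Comon.Hom.hom g.w

/-- A morphism of based functors is a comodule map along `F(g)`, as it respects the comultiplication
and the isomorphisms `φ`. It therefore sends the part `(a, b)` to the part `(g a, g b)`, see
`IsPart.comp_hom`. -/
theorem coactLeft_map (n : FinIntᵒᵖ) : g.fst.hom.app n ≫ coactLeft C.fst.toFunctor C.baseHom n =
    coactLeft B.fst.toFunctor B.baseHom n ≫
      (Sigma.desc (fun s => Sigma.ι (fun _ : C.snd => 𝟙_ V) (g.snd s)) ▷ _) ≫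
        _ ◁ g.fst.hom.app n := by
  rw [coactLeft, coactLeft, ← g.fst.hom.naturality_assoc, reassoc_of% (g.fst.comul)]
  simp only [Category.assoc]
  rw [← comp_whiskerRight_assoc, ← baseHom_natural, MonoidalCategory.tensorHom_def',
    Category.assoc, ← comp_whiskerRight, whisker_exchange]

theorem coactRight_map (n : FinIntᵒᵖ) : g.fst.hom.app n ≫ coactRight C.fst.toFunctor C.baseHom n =
    coactRight B.fst.toFunctor B.baseHom n ≫
      (_ ◁ Sigma.desc (fun s => Sigma.ι (fun _ : C.snd => 𝟙_ V) (g.snd s))) ≫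
        g.fst.hom.app n ▷ _ := by
  rw [coactRight, coactRight, ← g.fst.hom.naturality_assoc, reassoc_of% (g.fst.comul)]
  simp only [Category.assoc]
  rw [← MonoidalCategory.whiskerLeft_comp_assoc, ← baseHom_natural, MonoidalCategory.tensorHom_def,
    Category.assoc, ← MonoidalCategory.whiskerLeft_comp, ← whisker_exchange]

theorem actLeft_map (n : FinIntᵒᵖ) {Z : V} (k : C.snd → (C.fst.toFunctor.obj n ⟶ Z)) :
    g.fst.hom.app n ≫ actLeft C.fst.toFunctor C.baseHom n ≫ Sigma.desc k =
      actLeft B.fst.toFunctor B.baseHom n ≫ Sigma.desc fun s => g.fst.hom.app n ≫ k (g.snd s) := by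
  rw [actLeft_desc, actLeft_desc, reassoc_of% (coactLeft_map g), whiskerLeft_integralLeft]
  refine congrArg (_ ≫ ·) (right_hom_ext fun s => ?_)
  rw [← comp_whiskerRight_assoc, Sigma.ι_desc, ι_integralLeft, ι_integralLeft]

theorem actRight_map (n : FinIntᵒᵖ) {Z : V} (k : C.snd → (C.fst.toFunctor.obj n ⟶ Z)) :
    g.fst.hom.app n ≫ actRight C.fst.toFunctor C.baseHom n ≫ Sigma.desc k =
      actRight B.fst.toFunctor B.baseHom n ≫
        Sigma.desc fun s => g.fst.hom.app n ≫ k (g.snd s) := by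
  rw [actRight_desc, actRight_desc, reassoc_of% (coactRight_map g), whiskerRight_integralRight]
  refine congrArg (_ ≫ ·) (left_hom_ext fun s => ?_)
  rw [← MonoidalCategory.whiskerLeft_comp_assoc, Sigma.ι_desc, ι_integralRight, ι_integralRight]

theorem dec_map (n : FinIntᵒᵖ) : g.fst.hom.app n ≫ C.dec n =
    B.dec n ≫ Sigma.desc fun p => g.fst.hom.app n ≫
      Sigma.ι (fun _ : C.snd × C.snd => C.fst.toFunctor.obj n) (g.snd p.1, g.snd p.2) := by
  rw [dec_eq, dec_eq, actBoth_desc, actBoth, actLeft_map]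
  simp only [actRight_map]

theorem IsPart.comp_hom {n : FinIntᵒᵖ} {A : V} {h : A ⟶ B.fst.toFunctor.obj n} {a b : B.snd}
    (hh : B.IsPart h a b) : C.IsPart (h ≫ g.fst.hom.app n) (g.snd a) (g.snd b) := by
  rw [IsPart, Category.assoc, dec_map, ← Category.assoc, hh, Category.assoc, Sigma.ι_desc,
    Category.assoc]

end Map

end ColaxBased

end

/-! ### Embedding quiver tensor products, and lifting the comultiplication. -/

section

open Functor.OplaxMonoidal Functor.LaxMonoidal

variable {V : Type u} [Category.{v} V] [MonoidalCategory V] [HasLimits V] [HasColimits V]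
  [MonoidalClosed V] [SymmetricCategory V]

namespace Quiv

variable {S : Type v}

theorem isSum_inc (Q P : Quiv.{v} V S) (a b : S) : IsSum fun c => inc Q P a c b :=
  IsSum.sigma _

theorem isSum_totalInc (Q : Quiv.{v} V S) : IsSum fun p : S × S => totalInc Q p.1 p.2 :=
  IsSum.sigma _

/-- The morphism `I_S(a, b) ⟶ F(S)`. -/
noncomputable def unitEmb (V : Type u) [Category.{v} V] [MonoidalCategory V] [HasColimits V]
    {S : Type v} (a b : S) : (unit V S).obj a b ⟶ ∐ fun _ : S => 𝟙_ V :=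
  unitDesc fun _ => Sigma.ι (fun _ : S => 𝟙_ V) a

theorem isSum_unitEmb : IsSum fun p : S × S => unitEmb V p.1 p.2 := by
  have h := (isSum_totalInc (unit V S)).of_isIso (QuivColax.totalUnitIso S).hom
  have h' : (fun p : S × S => totalInc (unit V S) p.1 p.2 ≫ (QuivColax.totalUnitIso S).hom) =
      fun p : S × S => unitEmb V p.1 p.2 := funext fun p => unit_ext fun h => by
    exact (QuivColax.totalUnitIso_hom h).trans
      (unitInc_unitDesc (fun _ => Sigma.ι (fun _ : S => 𝟙_ V) p.1) h).symm
  exact h' ▸ h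

section

variable {Q P : Quiv.{v} V S} {A A' : V} (i : ∀ a b, Q.obj a b ⟶ A) (j : ∀ a b, P.obj a b ⟶ A')

/-- The morphism `(Q ⊗ P)(a, b) ⟶ A ⊗ A'` induced by morphisms from the components of `Q` and `P`
to `A` and `A'`. -/
noncomputable def tensorEmb (a b : S) : (tensor Q P).obj a b ⟶ A ⊗ A' :=
  tensorDesc fun c => i a c ⊗ₘ j c b

@[simp]
theorem inc_tensorEmb (a c b : S) : inc Q P a c b ≫ tensorEmb i j a b = i a c ⊗ₘ j c b :=
  inc_tensorDesc _ _

@[simp]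
theorem inc_tensorEmb_assoc (a c b : S) {Z : V} (h : A ⊗ A' ⟶ Z) :
    inc Q P a c b ≫ tensorEmb i j a b ≫ h = (i a c ⊗ₘ j c b) ≫ h :=
  inc_tensorDesc_assoc _ _ _

theorem tensorMap_tensorEmb {Q' P' : Quiv.{v} V S} (f : Q' ⟶ Q) (g : P' ⟶ P) (a b : S) :
    (tensorMap f g).app a b ≫ tensorEmb i j a b =
      tensorEmb (fun a b => f.app a b ≫ i a b) (fun a b => g.app a b ≫ j a b) a b :=
  tensor_ext fun c => by simp

theorem tensorEmb_comp {B B' : V} (f : A ⟶ B) (g : A' ⟶ B') (a b : S) :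
    tensorEmb i j a b ≫ (f ⊗ₘ g) =
      tensorEmb (fun a b => i a b ≫ f) (fun a b => j a b ≫ g) a b :=
  tensor_ext fun c => by simp

variable {i j}

/-- `A ⊗ A'` is the coproduct of all `Q(x, y) ⊗ P(z, w)`, and the summands of `(Q ⊗ P)(a, b)` are
those at `((a, c), (c, b))`, which determines `c`. The threefold version below serves
coassociativity. -/
theorem mono_tensorEmb (hV : IsDecomposing.{v} V) (hi : IsSum fun p : S × S => i p.1 p.2)
    (hj : IsSum fun p : S × S => j p.1 p.2) (a b : S) : Mono (tensorEmb i j a b) :=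
  hV.mono_of_injective (isSum_inc Q P a b) (hi.tensor hj) (fun c => ((a, c), (c, b)))
    (fun c c' h => congrArg (fun q : (S × S) × (S × S) => q.1.2) h) (fun c => Iso.refl _) _
    fun c => by simp

theorem mono_tensorEmb_tensorEmb (hV : IsDecomposing.{v} V) {R : Quiv.{v} V S} {A'' : V}
    {k : ∀ a b, R.obj a b ⟶ A''} (hi : IsSum fun p : S × S => i p.1 p.2)
    (hj : IsSum fun p : S × S => j p.1 p.2) (hk : IsSum fun p : S × S => k p.1 p.2) (a b : S) :
    Mono (tensorEmb i (tensorEmb j k) a b) :=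
  hV.mono_of_injective
    ((isSum_inc Q (tensor P R) a b).comp_prod fun d => (isSum_inc P R d b).whiskerLeft (Q.obj a d))
    (hi.tensor (hj.tensor hk)) (fun p => ((a, p.1), ((p.1, p.2), (p.2, b))))
    (fun p p' h => Prod.ext (congrArg (fun q : (S × S) × ((S × S) × (S × S)) => q.1.2) h)
      (congrArg (fun q : (S × S) × ((S × S) × (S × S)) => q.2.1.2) h)) (fun p => Iso.refl _) _
    fun p => by
      simp only [Iso.refl_hom, Category.id_comp, Category.assoc, inc_tensorEmb]
      rw [← id_tensorHom, tensorHom_comp_tensorHom, Category.id_comp, inc_tensorEmb]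

end

theorem mono_unitEmb (hV : IsDecomposing.{v} V) (a b : S) : Mono (unitEmb V a b) :=
  hV.mono (isSum_unitEmb (V := V)) (a, b)

end Quiv

namespace ColaxBased

variable {B : ColaxBased.{v} V}

namespace IsPart

/-- Comultiplication respects the left coaction, so the first factor inherits the source `a`. The
next lemma is the same for the target and the second factor. -/
theorem comp_δ_coactLeft {m n : FinIntᵒᵖ} {A Z : V} {a b : B.snd}
    {h : A ⟶ B.fst.toFunctor.obj (m ⊗ n)}
    (hh : B.IsPart h a b) (c : B.snd → (B.fst.toFunctor.obj m ⊗ B.fst.toFunctor.obj n ⟶ Z)) :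
    (h ≫ δ B.fst.toFunctor m n) ≫ coactLeft B.fst.toFunctor B.baseHom m ▷ _ ≫
      (α_ _ _ _).hom ≫ integralLeft c = (h ≫ δ B.fst.toFunctor m n) ≫ c a := by
  rw [Category.assoc, reassoc_of% (δ_coactLeft B.fst.toFunctor B.baseHom m n),
    reassoc_of% hh.comp_coactLeft, whiskerLeft_integralLeft, ι_integralLeft,
    Iso.inv_hom_id_assoc, Category.assoc]

theorem comp_δ_coactRight {m n : FinIntᵒᵖ} {A Z : V} {a b : B.snd}
    {h : A ⟶ B.fst.toFunctor.obj (m ⊗ n)}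
    (hh : B.IsPart h a b) (c : B.snd → (B.fst.toFunctor.obj m ⊗ B.fst.toFunctor.obj n ⟶ Z)) :
    (h ≫ δ B.fst.toFunctor m n) ≫ _ ◁ coactRight B.fst.toFunctor B.baseHom n ≫
      (α_ _ _ _).inv ≫ integralRight c = (h ≫ δ B.fst.toFunctor m n) ≫ c b := by
  rw [Category.assoc, reassoc_of% (δ_coactRight B.fst.toFunctor B.baseHom m n),
    reassoc_of% hh.comp_coactRight, whiskerRight_integralRight, ι_integralRight,
    Iso.inv_hom_id_assoc, Category.assoc]

variable {n : FinIntᵒᵖ} {A A' W Z : V} {h : A ⟶ B.fst.toFunctor.obj n} {a b : B.snd}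
  (hh : B.IsPart h a b) (k : A' ⟶ W)
include hh

/-- This lemma and the next three evaluate the possible labels of a tensor product (source and
target of either factor) on a summand. In the two middle ones the factor `F(S)` stands between the
two objects and is absorbed into the second. -/
theorem tensorHom_coactLeft (c : B.snd → (B.fst.toFunctor.obj n ⊗ W ⟶ Z)) :
    (h ⊗ₘ k) ≫ coactLeft B.fst.toFunctor B.baseHom n ▷ W ≫ (α_ _ _ _).hom ≫ integralLeft c =
      (h ⊗ₘ k) ≫ c a := by
  rw [MonoidalCategory.tensorHom_def', Category.assoc, ← comp_whiskerRight_assoc,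
    hh.comp_coactLeft]
  simp only [comp_whiskerRight, Category.assoc, associator_naturality_left_assoc, ι_integralLeft]
  simp [-Functor.OplaxMonoidal.left_unitality, -Functor.OplaxMonoidal.right_unitality]

theorem tensorHom_coactRight (c : B.snd → (W ⊗ B.fst.toFunctor.obj n ⟶ Z)) :
    (k ⊗ₘ h) ≫ W ◁ coactRight B.fst.toFunctor B.baseHom n ≫ (α_ _ _ _).inv ≫ integralRight c =
      (k ⊗ₘ h) ≫ c b := by
  rw [MonoidalCategory.tensorHom_def, Category.assoc, ← MonoidalCategory.whiskerLeft_comp_assoc,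
    hh.comp_coactRight]
  simp only [MonoidalCategory.whiskerLeft_comp, Category.assoc,
    associator_inv_naturality_right_assoc, ι_integralRight]
  simp [-Functor.OplaxMonoidal.left_unitality, -Functor.OplaxMonoidal.right_unitality]

theorem tensorHom_middle_coactRight (c : B.snd → (B.fst.toFunctor.obj n ⊗ W ⟶ Z)) :
    (h ⊗ₘ k) ≫ coactRight B.fst.toFunctor B.baseHom n ▷ W ≫ (α_ _ _ _).hom ≫
      _ ◁ integralLeft (Sigma.ι fun _ : B.snd => W) ≫ leftDesc _ _ c = (h ⊗ₘ k) ≫ c b := by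
  rw [MonoidalCategory.tensorHom_def', Category.assoc, ← comp_whiskerRight_assoc,
    hh.comp_coactRight]
  simp only [comp_whiskerRight, whisker_assoc, Category.assoc, Iso.inv_hom_id_assoc]
  rw [← MonoidalCategory.whiskerLeft_comp_assoc, ι_integralLeft]
  simp [-Functor.OplaxMonoidal.left_unitality, -Functor.OplaxMonoidal.right_unitality]

theorem tensorHom_middle_coactLeft (c : B.snd → (W ⊗ B.fst.toFunctor.obj n ⟶ Z)) :
    (k ⊗ₘ h) ≫ W ◁ coactLeft B.fst.toFunctor B.baseHom n ≫
      W ◁ integralLeft (Sigma.ι fun _ : B.snd => B.fst.toFunctor.obj n) ≫ leftDesc _ _ c =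
        (k ⊗ₘ h) ≫ c a := by
  rw [MonoidalCategory.tensorHom_def, Category.assoc, ← MonoidalCategory.whiskerLeft_comp_assoc,
    ← MonoidalCategory.whiskerLeft_comp_assoc, Category.assoc, reassoc_of% hh.comp_coactLeft]
  simp [-Functor.OplaxMonoidal.left_unitality, -Functor.OplaxMonoidal.right_unitality]

end IsPart

/-- Three pairs of labellings are combined: the source of the first factor against the constant `a`,
the target of the first against the source of the second, and the target of the second against the
constant `b`. The middle pair agrees by `δ_coact_middle`. -/
theorem isSupported_comul {m n : FinIntᵒᵖ} {Q P : Quiv.{v} V B.snd}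
    {i : ∀ a b, Q.obj a b ⟶ B.fst.toFunctor.obj m} {j : ∀ a b, P.obj a b ⟶ B.fst.toFunctor.obj n}
    (hi : IsSum fun p : B.snd × B.snd => i p.1 p.2) (hj : IsSum fun p : B.snd × B.snd => j p.1 p.2)
    (hi' : ∀ a b, B.IsPart (i a b) a b) (hj' : ∀ a b, B.IsPart (j a b) a b) {Z : V} {a b : B.snd}
    {e : Z ⟶ B.fst.toFunctor.obj (m ⊗ n)} (he : B.IsPart e a b) :
    IsSupported (fun q : (B.snd × B.snd) × (B.snd × B.snd) => i q.1.1 q.1.2 ⊗ₘ j q.2.1 q.2.2)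
      (e ≫ δ B.fst.toFunctor m n) fun q => (q.1.1 = a ∧ q.1.2 = q.2.1) ∧ q.2.2 = b := by
  have h₁ : IsSupported
      (fun q : (B.snd × B.snd) × (B.snd × B.snd) => i q.1.1 q.1.2 ⊗ₘ j q.2.1 q.2.2)
      (e ≫ δ B.fst.toFunctor m n) fun q => q.1.1 = a :=
    ⟨B.snd, _, _, fun q => q.1.1, fun _ => a, fun q => (hi' _ _).tensorHom_coactLeft _ _,
      .const a, he.comp_δ_coactLeft _, fun _ h => h⟩
  have h₂ : IsSupported
      (fun q : (B.snd × B.snd) × (B.snd × B.snd) => i q.1.1 q.1.2 ⊗ₘ j q.2.1 q.2.2)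
      (e ≫ δ B.fst.toFunctor m n) fun q => q.1.2 = q.2.1 :=
    ⟨B.snd, _, _, fun q => q.1.2, fun q => q.2.1,
      fun q => (hi' _ _).tensorHom_middle_coactRight _ _,
      fun q => (hj' _ _).tensorHom_middle_coactLeft _ _, by
        rw [Category.assoc, Category.assoc,
          reassoc_of% (δ_coact_middle B.fst.toFunctor B.baseHom m n)], fun _ h => h⟩
  have h₃ : IsSupported
      (fun q : (B.snd × B.snd) × (B.snd × B.snd) => i q.1.1 q.1.2 ⊗ₘ j q.2.1 q.2.2)
      (e ≫ δ B.fst.toFunctor m n) fun q => q.2.2 = b :=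
    ⟨B.snd, _, _, fun q => q.2.2, fun _ => b, fun q => (hj' _ _).tensorHom_coactRight _ _,
      .const b, he.comp_δ_coactRight _, fun _ h => h⟩
  exact .and (hi.tensor hj) (.and (hi.tensor hj) h₁ h₂) h₃

theorem exists_comul_lift (hV : IsDecomposing.{v} V) {m n : FinIntᵒᵖ} {Q P : Quiv.{v} V B.snd}
    {i : ∀ a b, Q.obj a b ⟶ B.fst.toFunctor.obj m} {j : ∀ a b, P.obj a b ⟶ B.fst.toFunctor.obj n}
    (hi : IsSum fun p : B.snd × B.snd => i p.1 p.2) (hj : IsSum fun p : B.snd × B.snd => j p.1 p.2)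
    (hi' : ∀ a b, B.IsPart (i a b) a b) (hj' : ∀ a b, B.IsPart (j a b) a b) {Z : V} {a b : B.snd}
    {e : Z ⟶ B.fst.toFunctor.obj (m ⊗ n)} (he : B.IsPart e a b) :
    ∃ w : Z ⟶ (Quiv.tensor Q P).obj a b,
      w ≫ Quiv.tensorEmb i j a b = e ≫ δ B.fst.toFunctor m n := by
  refine hV.factors (hi.tensor hj) (isSupported_comul hi hj hi' hj' he) _ ?_
  rintro ⟨⟨a, c⟩, ⟨c', b⟩⟩ ⟨⟨h₁, h₂⟩, h₃⟩
  obtain rfl : a = _ := h₁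
  obtain rfl : c = c' := h₂
  obtain rfl : b = _ := h₃
  exact ⟨Quiv.inc Q P a c b, Quiv.inc_tensorEmb i j a c b⟩

end ColaxBased

end

/-! ### Lifting the counit, and existence of the decomposition. -/

section

open Functor.OplaxMonoidal Functor.LaxMonoidal

variable {V : Type u} [Category.{v} V] [MonoidalCategory V] [HasLimits V] [HasColimits V]
  [MonoidalClosed V] [SymmetricCategory V]

namespace Quiv

variable {S : Type v} {A : V} {P : Quiv.{v} V S} (j : ∀ a b, P.obj a b ⟶ A)

theorem leftIso_inv_tensorEmb (a b : S) : (leftIso P).inv.app a b ≫ tensorEmb (unitEmb V) j a b =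
    j a b ≫ (λ_ _).inv ≫ Sigma.ι (fun _ : S => 𝟙_ V) a ▷ _ := by
  rw [leftIso_inv_app, Category.assoc, Category.assoc, inc_tensorEmb, ← tensorHom_id,
    tensorHom_comp_tensorHom, unitEmb, unitInc_unitDesc, Category.id_comp,
    MonoidalCategory.tensorHom_def', leftUnitor_inv_naturality_assoc]

theorem rightIso_inv_tensorEmb (a b : S) :
    (rightIso P).inv.app a b ≫ tensorEmb j (unitEmb V) a b =
      j a b ≫ (ρ_ _).inv ≫ _ ◁ Sigma.ι (fun _ : S => 𝟙_ V) b := by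
  rw [rightIso_inv_app, Category.assoc, Category.assoc, inc_tensorEmb, ← id_tensorHom,
    tensorHom_comp_tensorHom, unitEmb, unitInc_unitDesc, Category.id_comp,
    MonoidalCategory.tensorHom_def, rightUnitor_inv_naturality_assoc]

end Quiv

namespace ColaxBased

variable {B : ColaxBased.{v} V}

theorem baseHom_counit (B : ColaxBased.{v} V) :
    B.baseHom ≫ Sigma.desc (fun _ : B.snd => 𝟙 (𝟙_ V)) = η B.fst.toFunctor :=
  B.isBaseMor.counit

section

variable {A : V} {h : A ⟶ B.fst.toFunctor.obj (𝟙_ _)} {a b : B.snd}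

/-- On `X_0` the left coaction followed by `φ` is `φ` followed by the diagonal. On a part with
source `a` the first coordinate is the constant `a`; eliminating the second coordinate by the counit
gives the formula. -/
theorem IsPart.comp_baseHom_left (hh : B.IsPart h a b) :
    h ≫ B.baseHom = h ≫ η B.fst.toFunctor ≫ Sigma.ι (fun _ : B.snd => 𝟙_ V) a := by
  have h₁ : h ≫ B.baseHom ≫ diag V B.snd =
      h ≫ B.baseHom ≫ (λ_ _).inv ≫ Sigma.ι (fun _ : B.snd => 𝟙_ V) a ▷ _ := by
    rw [← B.isBaseMor.coactLeft_unit, reassoc_of% hh.comp_coactLeft, ← whisker_exchange]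
    simp only [leftUnitor_inv_naturality_assoc]
  have h₂ : diag V B.snd ≫ _ ◁ Sigma.desc (fun _ : B.snd => 𝟙 (𝟙_ V)) ≫ (ρ_ _).hom = 𝟙 _ :=
    Sigma.hom_ext _ _ fun s => by
      rw [← Category.assoc, ι_diag, MonoidalCategory.tensorHom_def]
      simp only [Category.assoc]
      rw [← MonoidalCategory.whiskerLeft_comp_assoc, Sigma.ι_desc]
      simp [unitors_inv_equal]
  have h₃ := congrArg (· ≫ _ ◁ Sigma.desc (fun _ : B.snd => 𝟙 (𝟙_ V)) ≫ (ρ_ _).hom) h₁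
  simp only [Category.assoc, h₂, Category.comp_id] at h₃
  rw [h₃, ← whisker_exchange_assoc, ← leftUnitor_inv_naturality_assoc,
    reassoc_of% B.baseHom_counit, rightUnitor_naturality, unitors_inv_equal,
    Iso.inv_hom_id_assoc]

theorem IsPart.comp_baseHom_right (hh : B.IsPart h a b) :
    h ≫ B.baseHom = h ≫ η B.fst.toFunctor ≫ Sigma.ι (fun _ : B.snd => 𝟙_ V) b := by
  have h₁ : h ≫ B.baseHom ≫ diag V B.snd =
      h ≫ B.baseHom ≫ (ρ_ _).inv ≫ _ ◁ Sigma.ι (fun _ : B.snd => 𝟙_ V) b := by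
    rw [← B.isBaseMor.coactRight_unit, reassoc_of% hh.comp_coactRight, whisker_exchange]
    simp only [rightUnitor_inv_naturality_assoc]
  have h₂ : diag V B.snd ≫ Sigma.desc (fun _ : B.snd => 𝟙 (𝟙_ V)) ▷ _ ≫ (λ_ _).hom = 𝟙 _ :=
    Sigma.hom_ext _ _ fun s => by
      rw [← Category.assoc, ι_diag, MonoidalCategory.tensorHom_def']
      simp only [Category.assoc]
      rw [← comp_whiskerRight_assoc, Sigma.ι_desc]
      simp
  have h₃ := congrArg (· ≫ Sigma.desc (fun _ : B.snd => 𝟙 (𝟙_ V)) ▷ _ ≫ (λ_ _).hom) h₁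
  simp only [Category.assoc, h₂, Category.comp_id] at h₃
  rw [h₃, whisker_exchange_assoc, ← rightUnitor_inv_naturality_assoc,
    reassoc_of% B.baseHom_counit, leftUnitor_naturality, ← unitors_inv_equal,
    Iso.inv_hom_id_assoc]

/-- By the two preceding formulas the composite with `φ` is supported at the single index `a` and
also at `b`, hence only where `a = b`. -/
theorem IsPart.exists_counit_lift (hV : IsDecomposing.{v} V) (hh : B.IsPart h a b) :
    ∃ w : A ⟶ (Quiv.unit V B.snd).obj a b, w ≫ Quiv.unitEmb V a b = h ≫ B.baseHom := by
  -- The tautological labelling: every summand of `F(S)` is labelled by its own index.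
  let f : (∐ fun _ : B.snd => 𝟙_ V) ⟶ ∐ fun _ : B.snd => ∐ fun _ : B.snd => 𝟙_ V :=
    Sigma.desc fun s => Sigma.ι (fun _ : B.snd => 𝟙_ V) s ≫
      Sigma.ι (fun _ : B.snd => ∐ fun _ : B.snd => 𝟙_ V) s
  have hf : IsLabelling (Sigma.ι fun _ : B.snd => 𝟙_ V) f fun s => s := fun s => by simp [f]
  refine hV.factors (IsSum.sigma fun _ : B.snd => 𝟙_ V) (P := fun s => s = a ∧ s = b)
    (.and (IsSum.sigma _) ?_ ?_) _ ?_
  · refine ⟨B.snd, f, Sigma.ι (fun _ : B.snd => ∐ fun _ : B.snd => 𝟙_ V) a, fun s => s, fun _ => a, hf, .const a, ?_, fun _ h => h⟩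
    rw [hh.comp_baseHom_left, Category.assoc, Category.assoc, Category.assoc, Category.assoc, hf]
  · refine ⟨B.snd, f, Sigma.ι (fun _ : B.snd => ∐ fun _ : B.snd => 𝟙_ V) b, fun s => s, fun _ => b, hf, .const b, ?_, fun _ h => h⟩
    rw [hh.comp_baseHom_right, Category.assoc, Category.assoc, Category.assoc, Category.assoc, hf]
  · rintro s ⟨rfl, rfl⟩
    exact ⟨Quiv.unitInc V rfl, Quiv.unitInc_unitDesc _ _⟩

end

instance (B : ColaxBased.{v} V) : IsIso B.baseHom :=
  inferInstanceAs (IsIso ((Comon.forget V).map B.iso.hom))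

/-- The summand of `a` in `F(S)` is duplicated by the diagonal, so in `X_0` both its labels are `a`.
These lifts form the inverse of the counit. -/
theorem isPart_inv_baseHom (B : ColaxBased.{v} V) (a : B.snd) :
    B.IsPart (Sigma.ι (fun _ : B.snd => 𝟙_ V) a ≫ inv B.baseHom) a a := by
  refine .of_comp_coact ?_ ?_
  · rw [← cancel_mono (_ ◁ B.baseHom)]
    simp only [Category.assoc, B.isBaseMor.coactLeft_unit, ← whisker_exchange,
      ← leftUnitor_inv_naturality_assoc, IsIso.inv_hom_id_assoc, ι_diag]
    rw [leftUnitor_inv_naturality_assoc, MonoidalCategory.tensorHom_def']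
  · rw [← cancel_mono (B.baseHom ▷ _)]
    simp only [Category.assoc, B.isBaseMor.coactRight_unit, whisker_exchange,
      ← rightUnitor_inv_naturality_assoc, IsIso.inv_hom_id_assoc, ι_diag]
    rw [rightUnitor_inv_naturality_assoc, MonoidalCategory.tensorHom_def, unitors_inv_equal]

theorem exists_quiverδ (B : ColaxBased.{v} V) (hV : IsDecomposing.{v} V) (m n : FinIntᵒᵖ) (a b : B.snd) :
    ∃ w : (B.quiver.obj (m ⊗ n)).obj a b ⟶
      (Quiv.tensor (B.quiver.obj m) (B.quiver.obj n)).obj a b,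
      w ≫ Quiv.tensorEmb (B.partInc m) (B.partInc n) a b =
        B.partInc (m ⊗ n) a b ≫ δ B.fst.toFunctor m n :=
  exists_comul_lift hV (isSum_partInc hV B m) (isSum_partInc hV B n) (B.isPart_partInc m)
    (B.isPart_partInc n) (B.isPart_partInc (m ⊗ n) a b)

section Existence

variable (B) (hV : IsDecomposing.{v} V)

/-- The counit of the decomposition of `B`. -/
noncomputable def quiverη : B.quiver.obj (𝟙_ _) ⟶ Quiv.unit V B.snd :=
  ⟨fun a b => ((B.isPart_partInc (𝟙_ _) a b).exists_counit_lift hV).choose⟩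

theorem quiverη_unitEmb (a b : B.snd) : (B.quiverη hV).app a b ≫ Quiv.unitEmb V a b =
    B.partInc (𝟙_ _) a b ≫ B.baseHom :=
  ((B.isPart_partInc (𝟙_ _) a b).exists_counit_lift hV).choose_spec

/-- The comultiplication of the decomposition of `B`. -/
noncomputable def quiverδ (m n : FinIntᵒᵖ) :
    B.quiver.obj (m ⊗ n) ⟶ Quiv.tensor (B.quiver.obj m) (B.quiver.obj n) :=
  ⟨fun a b => (B.exists_quiverδ hV m n a b).choose⟩

theorem quiverδ_tensorEmb (m n : FinIntᵒᵖ) (a b : B.snd) :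
    (B.quiverδ hV m n).app a b ≫ Quiv.tensorEmb (B.partInc m) (B.partInc n) a b =
      B.partInc (m ⊗ n) a b ≫ δ B.fst.toFunctor m n :=
  (B.exists_quiverδ hV m n a b).choose_spec

/-- As for the coherence laws below, it suffices to compare composites with a monomorphism into
tensor products of values of `X` (or `F(S)`), where the identity is known. -/
theorem quiverδ_natural {m m' n n' : FinIntᵒᵖ} (f : m ⟶ m') (g : n ⟶ n') :
    B.quiverδ hV m n ≫ Quiv.tensorMap (B.quiver.map f) (B.quiver.map g) =
      B.quiver.map (f ⊗ₘ g) ≫ B.quiverδ hV m' n' := by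
  ext a b
  have := Quiv.mono_tensorEmb hV (isSum_partInc hV B m') (isSum_partInc hV B n') a b
  rw [← cancel_mono (Quiv.tensorEmb (B.partInc m') (B.partInc n') a b), Quiv.comp_app,
    Quiv.comp_app, Category.assoc, Category.assoc, quiverδ_tensorEmb, quiver_map_partInc_assoc,
    ← δ_natural, ← reassoc_of% (B.quiverδ_tensorEmb hV m n a b), Quiv.tensorMap_tensorEmb,
    Quiv.tensorEmb_comp]
  simp only [quiver_map_partInc]

theorem quiverδ_assoc (m n p : FinIntᵒᵖ) :
    B.quiverδ hV (m ⊗ n) p ≫ Quiv.tensorMap (B.quiverδ hV m n) (𝟙 _) ≫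
        (Quiv.assocIso (B.quiver.obj m) (B.quiver.obj n) (B.quiver.obj p)).hom =
      B.quiver.map (α_ m n p).hom ≫ B.quiverδ hV m (n ⊗ p) ≫
        Quiv.tensorMap (𝟙 _) (B.quiverδ hV n p) := by
  ext a b
  have := Quiv.mono_tensorEmb_tensorEmb hV (isSum_partInc hV B m) (isSum_partInc hV B n)
    (isSum_partInc hV B p) a b
  rw [← cancel_mono (Quiv.tensorEmb (B.partInc m)
    (Quiv.tensorEmb (B.partInc n) (B.partInc p)) a b)]
  have h₁ : (Quiv.assocIso (B.quiver.obj m) (B.quiver.obj n) (B.quiver.obj p)).hom.app a b ≫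
      Quiv.tensorEmb (B.partInc m) (Quiv.tensorEmb (B.partInc n) (B.partInc p)) a b =
      Quiv.tensorEmb (Quiv.tensorEmb (B.partInc m) (B.partInc n)) (B.partInc p) a b ≫
        (α_ _ _ _).hom := by
    refine Quiv.tensor_ext fun c => Quiv.right_tensor_ext fun d => ?_
    rw [Quiv.inc_assocIso_assoc, Quiv.inc_tensorEmb, Quiv.inc_tensorEmb_assoc, ← id_tensorHom,
      ← tensorHom_id, tensorHom_comp_tensorHom, tensorHom_comp_tensorHom_assoc,
      Quiv.inc_tensorEmb, Quiv.inc_tensorEmb]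
    simp
  have h₂ : (Quiv.tensorMap (B.quiverδ hV m n) (𝟙 (B.quiver.obj p))).app a b ≫
      Quiv.tensorEmb (Quiv.tensorEmb (B.partInc m) (B.partInc n)) (B.partInc p) a b =
      Quiv.tensorEmb (B.partInc (m ⊗ n)) (B.partInc p) a b ≫ δ B.fst.toFunctor m n ▷ _ := by
    rw [← tensorHom_id, Quiv.tensorEmb_comp, Quiv.tensorMap_tensorEmb]
    simp only [quiverδ_tensorEmb, Quiv.id_app, Category.id_comp, Category.comp_id]
  have h₃ : (Quiv.tensorMap (𝟙 (B.quiver.obj m)) (B.quiverδ hV n p)).app a b ≫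
      Quiv.tensorEmb (B.partInc m) (Quiv.tensorEmb (B.partInc n) (B.partInc p)) a b =
      Quiv.tensorEmb (B.partInc m) (B.partInc (n ⊗ p)) a b ≫ _ ◁ δ B.fst.toFunctor n p := by
    rw [← id_tensorHom, Quiv.tensorEmb_comp, Quiv.tensorMap_tensorEmb]
    simp only [quiverδ_tensorEmb, Quiv.id_app, Category.id_comp, Category.comp_id]
  simp only [Quiv.comp_app, Category.assoc]
  rw [h₁, reassoc_of% h₂, h₃, reassoc_of% (B.quiverδ_tensorEmb hV (m ⊗ n) p a b),
    reassoc_of% (B.quiverδ_tensorEmb hV m (n ⊗ p) a b), quiver_map_partInc_assoc,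
    oplax_associativity]

/-- After embedding, the right hand side is the left coaction restricted to a part, and the quiver
unitor is exactly the insertion of the constant source `a`. -/
theorem quiverδ_left_unit (n : FinIntᵒᵖ) : (Quiv.leftIso (B.quiver.obj n)).inv =
    B.quiver.map (λ_ n).inv ≫ B.quiverδ hV (𝟙_ _) n ≫ Quiv.tensorMap (B.quiverη hV) (𝟙 _) := by
  ext a b
  have := Quiv.mono_tensorEmb hV (Quiv.isSum_unitEmb (V := V) (S := B.snd))
    (isSum_partInc hV B n) a b
  rw [← cancel_mono (Quiv.tensorEmb (Quiv.unitEmb V) (B.partInc n) a b)]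
  simp only [Quiv.comp_app, Category.assoc, Quiv.tensorMap_tensorEmb, quiverη_unitEmb,
    Quiv.id_app, Category.id_comp]
  have h₁ := Quiv.tensorEmb_comp (B.partInc (𝟙_ _)) (B.partInc n) B.baseHom
    (𝟙 (B.fst.toFunctor.obj n)) a b
  simp only [Category.comp_id] at h₁
  rw [← h₁, reassoc_of% (B.quiverδ_tensorEmb hV (𝟙_ _) n a b), quiver_map_partInc_assoc,
    tensorHom_id]
  exact (Quiv.leftIso_inv_tensorEmb _ a b).trans (B.isPart_partInc n a b).comp_coactLeft.symm

theorem quiverδ_right_unit (n : FinIntᵒᵖ) : (Quiv.rightIso (B.quiver.obj n)).inv =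
    B.quiver.map (ρ_ n).inv ≫ B.quiverδ hV n (𝟙_ _) ≫ Quiv.tensorMap (𝟙 _) (B.quiverη hV) := by
  ext a b
  have := Quiv.mono_tensorEmb hV (isSum_partInc hV B n)
    (Quiv.isSum_unitEmb (V := V) (S := B.snd)) a b
  rw [← cancel_mono (Quiv.tensorEmb (B.partInc n) (Quiv.unitEmb V) a b)]
  simp only [Quiv.comp_app, Category.assoc, Quiv.tensorMap_tensorEmb, quiverη_unitEmb,
    Quiv.id_app, Category.id_comp]
  have h₁ := Quiv.tensorEmb_comp (B.partInc n) (B.partInc (𝟙_ _)) (𝟙 (B.fst.toFunctor.obj n))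
    B.baseHom a b
  simp only [Category.comp_id] at h₁
  rw [← h₁, reassoc_of% (B.quiverδ_tensorEmb hV n (𝟙_ _) a b), quiver_map_partInc_assoc,
    id_tensorHom]
  exact (Quiv.rightIso_inv_tensorEmb _ a b).trans (B.isPart_partInc n a b).comp_coactRight.symm

theorem isIso_quiverη : IsIso (B.quiverη hV) := by
  -- The inverse is the restriction of `φ⁻¹` to the summands of `F(S)`; for `a = b` it lands in the
  -- right part by `isPart_inv_baseHom`.
  let k : ∀ a b : B.snd, (Quiv.unit V B.snd).obj a b ⟶ (B.quiver.obj (𝟙_ _)).obj a b :=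
    fun a b => Quiv.unitDesc fun h => (h ▸ B.isPart_inv_baseHom a : B.IsPart
      (Sigma.ι (fun _ : B.snd => 𝟙_ V) a ≫ inv B.baseHom) a b).lift
  have hk : ∀ a b, k a b ≫ B.partInc (𝟙_ _) a b = Quiv.unitEmb V a b ≫ inv B.baseHom :=
    fun a b => Quiv.unit_ext fun h => by
      simp [k, Quiv.unitEmb]
  refine ⟨⟨⟨k⟩, Quiv.hom_ext fun a b => ?_, Quiv.hom_ext fun a b => ?_⟩⟩
  · rw [← cancel_mono (B.partInc (𝟙_ _) a b)]
    simp only [Quiv.comp_app, Category.assoc, Quiv.id_app, hk,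
      reassoc_of% (B.quiverη_unitEmb hV a b)]
    simp
  · have := Quiv.mono_unitEmb hV a b
    rw [← cancel_mono (Quiv.unitEmb V a b)]
    simp only [Quiv.comp_app, Category.assoc, Quiv.id_app, quiverη_unitEmb, reassoc_of% hk]
    simp

/-- The decomposition of `B`. -/
noncomputable def decomposition : Decomposition B where
  oplax :=
    { η := B.quiverη hV
      δ := B.quiverδ hV
      δ_natural_left := fun f n => by
        have := B.quiverδ_natural hV f (𝟙 n)
        rwa [CategoryTheory.Functor.map_id, tensorHom_id] at this
      δ_natural_right := fun n f => by
        have := B.quiverδ_natural hV (𝟙 n) f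
        rwa [CategoryTheory.Functor.map_id, id_tensorHom] at this
      oplax_associativity := B.quiverδ_assoc hV
      oplax_left_unitality := B.quiverδ_left_unit hV
      oplax_right_unitality := B.quiverδ_right_unit hV }
  isIso_counit := B.isIso_quiverη hV
  counit a b := by
    have h := congrArg (· ≫ Sigma.desc fun _ : B.snd => 𝟙 (𝟙_ V)) (B.quiverη_unitEmb hV a b)
    simp only [Category.assoc, baseHom_counit] at h
    refine Eq.trans (congrArg ((B.quiverη hV).app a b ≫ ·) ?_) h
    exact Quiv.unit_ext fun h => by simp [Quiv.unitEmb]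
  comul := B.quiverδ_tensorEmb hV

end Existence

end ColaxBased

end

/-! ### Full faithfulness of the comparison functor. -/

section

open Functor.OplaxMonoidal Functor.LaxMonoidal

variable {V : Type u} [Category.{v} V] [MonoidalCategory V] [HasLimits V] [HasColimits V]
  [MonoidalClosed V] [SymmetricCategory V]

namespace Quiv

variable {S : Type v}

theorem totalInc_totalδ (Q P : Quiv.{v} V S) (a b : S) :
    totalInc (tensor Q P) a b ≫ totalδ Q P = tensorEmb (totalInc Q) (totalInc P) a b :=
  totalInc_totalDesc _ _ _

theorem totalInc_totalδ_assoc (Q P : Quiv.{v} V S) (a b : S) {Z : V}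
    (k : (total V S).obj Q ⊗ (total V S).obj P ⟶ Z) :
    totalInc (tensor Q P) a b ≫ totalδ Q P ≫ k =
      tensorEmb (totalInc Q) (totalInc P) a b ≫ k := by
  rw [← totalInc_totalδ, Category.assoc]

end Quiv

namespace QuivColax

theorem totalInc_collapseφHom (X : QuivColax.{v} V) (a b : X.base) :
    Quiv.totalInc (X.colax.toFunctor.obj (𝟙_ _)) a b ≫ collapseφHom X =
      X.counit a b ≫ Quiv.unitEmb V a b := by
  rw [collapseφHom, Quiv.totalInc_map_assoc]
  refine congrArg (X.counit a b ≫ ·) (Quiv.unit_ext fun h => ?_)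
  exact (totalUnitIso_hom h).trans
    (Quiv.unitInc_unitDesc (fun _ => Sigma.ι (fun _ : X.base => 𝟙_ V) a) h).symm

theorem totalInc_map_δ_assoc (X : QuivColax.{v} V) (m n : FinIntᵒᵖ) (a b : X.base) {Z : V}
    (k : (Quiv.total V X.base).obj (X.colax.toFunctor.obj m) ⊗
      (Quiv.total V X.base).obj (X.colax.toFunctor.obj n) ⟶ Z) :
    Quiv.totalInc (X.colax.toFunctor.obj (m ⊗ n)) a b ≫
        (Quiv.total V X.base).map (δ X.colax.toFunctor m n) ≫ Quiv.totalδ _ _ ≫ k =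
      X.comul m n a b ≫ Quiv.tensorEmb (Quiv.totalInc (X.colax.toFunctor.obj m))
        (Quiv.totalInc (X.colax.toFunctor.obj n)) a b ≫ k := by
  rw [← Quiv.totalInc_totalδ_assoc, Quiv.totalInc_map_assoc]
  rfl

theorem totalInc_map_δ (X : QuivColax.{v} V) (m n : FinIntᵒᵖ) (a b : X.base) :
    Quiv.totalInc (X.colax.toFunctor.obj (m ⊗ n)) a b ≫
        (Quiv.total V X.base).map (δ X.colax.toFunctor m n) ≫ Quiv.totalδ _ _ =
      X.comul m n a b ≫ Quiv.tensorEmb (Quiv.totalInc (X.colax.toFunctor.obj m))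
        (Quiv.totalInc (X.colax.toFunctor.obj n)) a b := by
  simpa using X.totalInc_map_δ_assoc m n a b (𝟙 _)

/-- Left counitality of `X` over quivers: comultiplying off `X_0` and applying the counit inserts
the unit at the vertex `a`, and in the total coproduct this is the label `a`. -/
theorem totalInc_coactLeft (X : QuivColax.{v} V) (n : FinIntᵒᵖ) (a b : X.base) :
    Quiv.totalInc (X.colax.toFunctor.obj n) a b ≫
        coactLeft X.collapse.toFunctor (collapseφHom X) n =
      Quiv.totalInc (X.colax.toFunctor.obj n) a b ≫ (λ_ _).inv ≫
        Sigma.ι (fun _ : X.base => 𝟙_ V) a ▷ _ := by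
  change _ ≫ (Quiv.total V X.base).map (X.colax.toFunctor.map (λ_ n).inv) ≫
    ((Quiv.total V X.base).map (δ X.colax.toFunctor (𝟙_ _) n) ≫ Quiv.totalδ _ _) ≫
      collapseφHom X ▷ (Quiv.total V X.base).obj (X.colax.toFunctor.obj n) = _
  have h := Quiv.tensorEmb_comp (Quiv.totalInc (X.colax.toFunctor.obj (𝟙_ _)))
    (Quiv.totalInc (X.colax.toFunctor.obj n)) (collapseφHom X) (𝟙 _) a b
  have h' := Quiv.tensorMap_tensorEmb (Quiv.unitEmb V (S := X.base)) (Quiv.totalInc (X.colax.toFunctor.obj n))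
    (η X.colax.toFunctor) (𝟙 _) a b
  simp only [Category.comp_id, totalInc_collapseφHom] at h
  simp only [Quiv.id_app, Category.id_comp] at h'
  rw [Category.assoc, Quiv.totalInc_map_assoc, totalInc_map_δ_assoc, ← tensorHom_id, h.trans h'.symm,
    ← Quiv.leftIso_inv_tensorEmb]
  have h₀ := congrArg (fun h => Quiv.Hom.app h a b)
    (oplax_left_unitality X.colax.toFunctor n)
  refine Eq.trans ?_ (congrArg (· ≫ Quiv.tensorEmb (Quiv.unitEmb V (S := X.base)) (Quiv.totalInc (X.colax.toFunctor.obj n)) a b) h₀).symm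
  simp only [Quiv.comp_app, Category.assoc]
  rfl

theorem totalInc_coactRight (X : QuivColax.{v} V) (n : FinIntᵒᵖ) (a b : X.base) :
    Quiv.totalInc (X.colax.toFunctor.obj n) a b ≫
        coactRight X.collapse.toFunctor (collapseφHom X) n =
      Quiv.totalInc (X.colax.toFunctor.obj n) a b ≫ (ρ_ _).inv ≫
        _ ◁ Sigma.ι (fun _ : X.base => 𝟙_ V) b := by
  change _ ≫ (Quiv.total V X.base).map (X.colax.toFunctor.map (ρ_ n).inv) ≫
    ((Quiv.total V X.base).map (δ X.colax.toFunctor n (𝟙_ _)) ≫ Quiv.totalδ _ _) ≫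
      (Quiv.total V X.base).obj (X.colax.toFunctor.obj n) ◁ collapseφHom X = _
  have h := Quiv.tensorEmb_comp (Quiv.totalInc (X.colax.toFunctor.obj n))
    (Quiv.totalInc (X.colax.toFunctor.obj (𝟙_ _))) (𝟙 _) (collapseφHom X) a b
  have h' := Quiv.tensorMap_tensorEmb (Quiv.totalInc (X.colax.toFunctor.obj n)) (Quiv.unitEmb V (S := X.base))
    (𝟙 _) (η X.colax.toFunctor) a b
  simp only [Category.comp_id, totalInc_collapseφHom] at h
  simp only [Quiv.id_app, Category.id_comp] at h'
  rw [Category.assoc, Quiv.totalInc_map_assoc, totalInc_map_δ_assoc, ← id_tensorHom, h.trans h'.symm,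
    ← Quiv.rightIso_inv_tensorEmb]
  have h₀ := congrArg (fun h => Quiv.Hom.app h a b)
    (oplax_right_unitality X.colax.toFunctor n)
  refine Eq.trans ?_ (congrArg (· ≫ Quiv.tensorEmb (Quiv.totalInc (X.colax.toFunctor.obj n)) (Quiv.unitEmb V (S := X.base)) a b) h₀).symm
  simp only [Quiv.comp_app, Category.assoc]
  rfl

section OfTotal

variable {X Y : QuivColax.{v} V} (hV : IsDecomposing.{v} V) (f : X.base → Y.base)
  (γ : ∀ n, (Quiv.total V X.base).obj (X.colax.toFunctor.obj n) ⟶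
    (Quiv.total V Y.base).obj (Y.colax.toFunctor.obj n))
  (naturality : ∀ {m n : FinIntᵒᵖ} (g : m ⟶ n),
    (Quiv.total V X.base).map (X.colax.toFunctor.map g) ≫ γ n =
      γ m ≫ (Quiv.total V Y.base).map (Y.colax.toFunctor.map g))
  (counit : γ (𝟙_ _) ≫ collapseφHom Y =
    collapseφHom X ≫ Sigma.desc fun s => Sigma.ι (fun _ : Y.base => 𝟙_ V) (f s))
  (comul : ∀ m n, γ (m ⊗ n) ≫ (Quiv.total V Y.base).map (δ Y.colax.toFunctor m n) ≫
      Quiv.totalδ _ _ = (Quiv.total V X.base).map (δ X.colax.toFunctor m n) ≫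
        Quiv.totalδ _ _ ≫ (γ m ⊗ₘ γ n))
  (app : ∀ n a b, X.obj n a b ⟶ Y.obj n (f a) (f b))
  (happ : ∀ n a b, app n a b ≫ Quiv.totalInc (Y.colax.toFunctor.obj n) (f a) (f b) =
    Quiv.totalInc (X.colax.toFunctor.obj n) a b ≫ γ n)

/-- A morphism is given by a monoidal natural transformation of the coproducts and components
which are compatible with it. -/
def Hom.ofTotal : Hom X Y :=
  -- Each condition is tested after a monomorphism: into the total coproduct, into `F(T)`, or into a
  -- tensor product of total coproducts.
  Hom.ofComponents f app
    (fun {m n} g a b => by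
      have := hV.mono (Quiv.isSum_totalInc (Y.colax.toFunctor.obj n)) (f a, f b)
      rw [← cancel_mono (Quiv.totalInc (Y.colax.toFunctor.obj n) (f a) (f b)),
        Category.assoc, happ, Category.assoc, ← Quiv.totalInc_map, reassoc_of% (happ m a b),
        ← Quiv.totalInc_map_assoc, naturality])
    (fun a b => by
      have := Quiv.mono_unitEmb hV (f a) (f b)
      rw [← cancel_mono (Quiv.unitEmb V (f a) (f b)), Category.assoc]
      refine (congrArg (app (𝟙_ _) a b ≫ ·) (Y.totalInc_collapseφHom (f a) (f b)).symm).trans ?_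
      refine (Category.assoc _ _ _).symm.trans ?_
      refine (congrArg (· ≫ collapseφHom Y) (happ (𝟙_ _) a b)).trans ?_
      refine (Category.assoc _ _ _).trans ((congrArg (_ ≫ ·) counit).trans ?_)
      refine (Category.assoc _ _ _).symm.trans ((congrArg
        (· ≫ Sigma.desc fun s => Sigma.ι (fun _ : Y.base => 𝟙_ V) (f s))
        (X.totalInc_collapseφHom a b)).trans ?_)
      rw [Category.assoc, Category.assoc]
      refine congrArg (_ ≫ ·) (Quiv.unit_ext fun h => ?_)
      simp [Quiv.unitEmb])
    (fun m n a b => by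
      have := Quiv.mono_tensorEmb hV (Quiv.isSum_totalInc (Y.colax.toFunctor.obj m))
        (Quiv.isSum_totalInc (Y.colax.toFunctor.obj n)) (f a) (f b)
      rw [← cancel_mono (Quiv.tensorEmb (Quiv.totalInc (Y.colax.toFunctor.obj m))
        (Quiv.totalInc (Y.colax.toFunctor.obj n)) (f a) (f b)), Category.assoc,
        ← totalInc_map_δ, reassoc_of% (happ (m ⊗ n) a b), comul, totalInc_map_δ_assoc,
        Category.assoc]
      refine congrArg (_ ≫ ·) (Quiv.tensor_ext fun c => ?_)
      rw [Quiv.inc_tensorEmb_assoc, Quiv.inc_tensorDesc_assoc, Category.assoc,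
        Quiv.inc_tensorEmb, tensorHom_comp_tensorHom, tensorHom_comp_tensorHom, happ, happ])

end OfTotal

end QuivColax

namespace TemplicialObject

theorem isPart_totalInc (X : TemplicialObject.{v} V) (n : FinIntᵒᵖ) (a b : X.obj.base) :
    ((comparison V).obj X).IsPart (Quiv.totalInc (X.obj.colax.toFunctor.obj n) a b) a b :=
  .of_comp_coact (X.obj.totalInc_coactLeft n a b) (X.obj.totalInc_coactRight n a b)

variable (hV : IsDecomposing.{v} V)

/-- A converse to `isPart_totalInc`. The morphism `dec` labels each summand by its own pair of
vertices, so whatever it labels by `(a, b)` comes from that summand alone. -/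
theorem exists_totalInc_lift (hV : IsDecomposing.{v} V) {X : TemplicialObject.{v} V}
    {n : FinIntᵒᵖ} {A : V} {h : A ⟶ (Quiv.total V X.obj.base).obj (X.obj.colax.toFunctor.obj n)}
    {a b : X.obj.base} (hh : ((comparison V).obj X).IsPart h a b) :
    ∃ w : A ⟶ X.obj.obj n a b, w ≫ Quiv.totalInc (X.obj.colax.toFunctor.obj n) a b = h := by
  refine hV.factors (Quiv.isSum_totalInc (X.obj.colax.toFunctor.obj n)) (P := fun p => p = (a, b))
    ⟨X.obj.base × X.obj.base, ((comparison V).obj X).dec n,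
      Sigma.ι (fun _ : X.obj.base × X.obj.base => ((comparison V).obj X).fst.toFunctor.obj n) (a, b),
      fun p => p, fun _ => (a, b), fun p => X.isPart_totalInc n p.1 p.2, .const (a, b), hh,
      fun _ h => h⟩ _ ?_
  rintro _ rfl
  exact ⟨𝟙 _, Category.id_comp _⟩

/-- The component of the preimage of a morphism under the comparison functor. -/
noncomputable def preimageApp {X Y : TemplicialObject.{v} V}
    (g : (comparison V).obj X ⟶ (comparison V).obj Y) (n : FinIntᵒᵖ) (a b : X.obj.base) :
    X.obj.obj n a b ⟶ Y.obj.obj n (g.snd a) (g.snd b) :=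
  (exists_totalInc_lift hV ((X.isPart_totalInc n a b).comp_hom g)).choose

theorem preimageApp_totalInc {X Y : TemplicialObject.{v} V}
    (g : (comparison V).obj X ⟶ (comparison V).obj Y) (n : FinIntᵒᵖ) (a b : X.obj.base) :
    preimageApp hV g n a b ≫
        Quiv.totalInc (Y.obj.colax.toFunctor.obj n) (g.snd a) (g.snd b) =
      Quiv.totalInc (X.obj.colax.toFunctor.obj n) a b ≫ g.fst.hom.app n :=
  (exists_totalInc_lift hV ((X.isPart_totalInc n a b).comp_hom g)).choose_spec

/-- The preimage of a morphism under the comparison functor. -/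
noncomputable def preimage {X Y : TemplicialObject.{v} V}
    (g : (comparison V).obj X ⟶ (comparison V).obj Y) : X ⟶ Y where
  hom := QuivColax.Hom.ofTotal hV g.snd (fun n => g.fst.hom.app n)
    (fun f => g.fst.hom.naturality f) (ColaxBased.baseHom_natural g)
    (fun m n => (g.fst.comul m n).trans (Category.assoc _ _ _)) (preimageApp hV g)
    (preimageApp_totalInc hV g)

/-- The comparison functor is fully faithful. -/
noncomputable def fullyFaithfulComparison : (comparison V).FullyFaithful where
  preimage := preimage hV
  map_preimage {X Y} g := CategoricalPullback.hom_ext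
    (ColaxFunctor.hom_ext (NatTrans.ext (funext fun n => Quiv.total_ext fun a b =>
      (QuivColax.totalInc_collapseApp (preimage hV g).hom n a b).trans
        (preimageApp_totalInc hV g n a b)))) rfl
  -- The components are determined by the total morphism because the summand inclusions are monic.
  preimage_map {X Y} f := ObjectProperty.hom_ext _ (QuivColax.Hom.ext' rfl fun n a b => by
    have := hV.mono (Quiv.isSum_totalInc (Y.obj.colax.toFunctor.obj n))
      (f.hom.base a, f.hom.base b)
    refine (Category.comp_id _).trans ((cancel_mono
      (Quiv.totalInc (Y.obj.colax.toFunctor.obj n) (f.hom.base a) (f.hom.base b))).1 ?_)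
    exact (preimageApp_totalInc hV ((comparison V).map f) n a b).trans
      (QuivColax.totalInc_collapseApp f.hom n a b))

end TemplicialObject

end

/-! ### The isomorphism `𝔠 𝔡 ≅ 𝟙` and the adjunction. -/

section

open Functor.OplaxMonoidal Functor.LaxMonoidal

variable {V : Type u} [Category.{v} V] [MonoidalCategory V] [HasLimits V] [HasColimits V]
  [MonoidalClosed V] [SymmetricCategory V]

theorem ColaxFunctor.isIso_of_isIso_app {C : Type u₁} [Category.{v₁} C] [MonoidalCategory C]
    {D : Type u₂} [Category.{v₂} D] [MonoidalCategory D] {F G : ColaxFunctor C D} (f : F ⟶ G)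
    (h : ∀ X, IsIso (f.hom.app X)) : IsIso f := by
  have := NatIso.isIso_of_isIso_app f.hom
  refine ⟨⟨inv f.hom, ?_, fun X Y => ?_⟩, ColaxFunctor.hom_ext ?_, ColaxFunctor.hom_ext ?_⟩
  · rw [NatIso.isIso_inv_app, IsIso.inv_comp_eq, f.counit]
  · rw [NatIso.isIso_inv_app, NatIso.isIso_inv_app, NatIso.isIso_inv_app, IsIso.inv_comp_eq,
      reassoc_of% (f.comul X Y), tensorHom_comp_tensorHom, IsIso.hom_inv_id, IsIso.hom_inv_id]
    simp
  · exact IsIso.hom_inv_id f.hom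
  · exact IsIso.inv_hom_id f.hom

namespace Decomposition

variable {B : ColaxBased.{v} V} (D : Decomposition B)

/-- A decomposition prescribes its counit only after the map to `I`, which forgets the vertex. The
vertex is recovered because on a part with source `a` the morphism `φ` is `ε` followed by the
coprojection of `a`. -/
theorem counit_unitEmb (a b : B.snd) : D.toTemplicial.obj.counit a b ≫ Quiv.unitEmb V a b =
    B.partInc (𝟙_ _) a b ≫ B.baseHom := by
  have h : Quiv.unitEmb V a b =
      Quiv.unitDesc (fun _ => 𝟙 (𝟙_ V)) ≫ Sigma.ι (fun _ : B.snd => 𝟙_ V) a :=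
    Quiv.unit_ext fun h => by simp [Quiv.unitEmb]
  rw [(B.isPart_partInc (𝟙_ _) a b).comp_baseHom_left, h]
  refine (Category.assoc _ _ _).symm.trans ?_
  exact (congrArg (· ≫ Sigma.ι (fun _ : B.snd => 𝟙_ V) a) (D.counit a b)).trans
    (Category.assoc _ _ _)

/-- The morphism `(e_{a,b})_{a,b} : ∐_{a,b} X_n(a, b) ⟶ X_n`. -/
noncomputable def totalHom (B : ColaxBased.{v} V) (n : FinIntᵒᵖ) :
    (Quiv.total V B.snd).obj (B.quiver.obj n) ⟶ B.fst.toFunctor.obj n :=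
  Quiv.totalDesc (B.partInc n)

@[simp]
theorem totalInc_totalHom (B : ColaxBased.{v} V) (n : FinIntᵒᵖ) (a b : B.snd) :
    Quiv.totalInc (B.quiver.obj n) a b ≫ totalHom B n = B.partInc n a b :=
  Quiv.totalInc_totalDesc _ _ _

theorem isIso_totalHom (hV : IsDecomposing.{v} V) (B : ColaxBased.{v} V) (n : FinIntᵒᵖ) :
    IsIso (totalHom B n) := by
  obtain ⟨k, hk⟩ := (ColaxBased.isSum_partInc hV B n).exists_desc
    fun p => Quiv.totalInc (B.quiver.obj n) p.1 p.2
  refine ⟨k, Quiv.total_ext fun a b => ?_, (ColaxBased.isSum_partInc hV B n).hom_ext fun p => ?_⟩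
  · rw [← Category.assoc, totalInc_totalHom, Category.comp_id]
    exact hk (a, b)
  · rw [← Category.assoc, hk, totalInc_totalHom, Category.comp_id]

/-- The counit of the adjunction at `B`, given by `(e_{a,b})_{a,b}`. -/
noncomputable def counitHom : (comparison V).obj D.toTemplicial ⟶ B where
  fst :=
    { hom :=
        { app := totalHom B
          naturality := fun m n g => Quiv.total_ext fun a b => by
            refine (Quiv.totalInc_map_assoc (B.quiver.map g) a b (totalHom B n)).trans ?_
            refine (congrArg ((B.quiver.map g).app a b ≫ ·) (totalInc_totalHom B n a b)).trans ?_
            refine (B.quiver_map_partInc g a b).trans ?_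
            exact (congrArg (· ≫ B.fst.toFunctor.map g) (totalInc_totalHom B m a b)).symm.trans
              (Category.assoc _ _ _) }
      counit := Quiv.total_ext fun a b => by
        refine Eq.trans ?_
          (Quiv.totalInc_map_assoc (η D.toTemplicial.obj.colax.toFunctor) a b _).symm
        refine (Category.assoc _ _ _).symm.trans ?_
        refine (congrArg (· ≫ η B.fst.toFunctor) (totalInc_totalHom B (𝟙_ _) a b)).trans ?_
        exact (D.counit a b).symm.trans (congrArg (D.toTemplicial.obj.counit a b ≫ ·)
          (Quiv.totalInc_totalDesc (Q := Quiv.unit V B.snd)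
            (fun _ _ => Quiv.unitDesc fun _ => 𝟙 (𝟙_ V)) a b).symm)
      comul := fun m n => Quiv.total_ext fun a b => by
        refine Eq.trans ?_ ((congrArg (_ ≫ ·) (Category.assoc _ _ _)).trans
          (D.toTemplicial.obj.totalInc_map_δ_assoc m n a b (totalHom B m ⊗ₘ totalHom B n))).symm
        refine (Category.assoc _ _ _).symm.trans ?_
        refine (congrArg (· ≫ δ B.fst.toFunctor m n) (totalInc_totalHom B (m ⊗ n) a b)).trans ?_
        refine (D.comul m n a b).symm.trans (congrArg (D.toTemplicial.obj.comul m n a b ≫ ·) ?_)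
        refine Eq.trans ?_ (Quiv.tensorEmb_comp (Quiv.totalInc (B.quiver.obj m))
          (Quiv.totalInc (B.quiver.obj n)) (totalHom B m) (totalHom B n) a b).symm
        simp only [totalInc_totalHom]
        rfl }
  snd := 𝟙 _
  w := by
    refine Eq.trans ?_ ((congrArg (D.toTemplicial.obj.collapseφ ≫ ·)
      ((freeComon V).map_id B.snd)).trans (Category.comp_id _)).symm
    refine Comon.Hom.ext (Quiv.total_ext fun a b => ?_)
    refine (Category.assoc _ _ _).symm.trans ?_
    refine (congrArg (· ≫ B.baseHom) (totalInc_totalHom B (𝟙_ _) a b)).trans ?_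
    exact (D.counit_unitEmb a b).symm.trans
      (D.toTemplicial.obj.totalInc_collapseφHom a b).symm

theorem isIso_counitHom (hV : IsDecomposing.{v} V) : IsIso D.counitHom := by
  have : IsIso D.counitHom.fst := ColaxFunctor.isIso_of_isIso_app _ (isIso_totalHom hV B)
  have : IsIso D.counitHom.snd := inferInstanceAs (IsIso (𝟙 _))
  exact (CategoricalPullback.isIso_iff _ _ _).2 ⟨inferInstance, inferInstance⟩

/-- The morphism of templicial objects induced by a morphism of based colax monoidal functors. -/
noncomputable def map (hV : IsDecomposing.{v} V) {C : ColaxBased.{v} V} (E : Decomposition C)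
    (g : B ⟶ C) : D.toTemplicial ⟶ E.toTemplicial :=
  have := E.isIso_counitHom hV
  (TemplicialObject.fullyFaithfulComparison hV).preimage (D.counitHom ≫ g ≫ inv E.counitHom)

theorem comparison_map (hV : IsDecomposing.{v} V) {C : ColaxBased.{v} V} (E : Decomposition C)
    (g : B ⟶ C) : (comparison V).map (D.map hV E g) ≫ E.counitHom = D.counitHom ≫ g := by
  have := E.isIso_counitHom hV
  rw [map, (TemplicialObject.fullyFaithfulComparison hV).map_preimage]
  simp

/-- The conditions prescribed for `𝔡` on morphisms are the naturality square of `counitHom`, tested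
on vertices and on summands. Read one way this constructs `𝔡` from full faithfulness of `𝔠`; read
the other way it makes `counitHom` natural for every choice of `𝔡`. -/
theorem comparison_map_eq_iff {C : ColaxBased.{v} V} {E : Decomposition C} {g : B ⟶ C}
    (f : D.toTemplicial ⟶ E.toTemplicial) :
    (comparison V).map f ≫ E.counitHom = D.counitHom ≫ g ↔
      (∀ a, f.hom.base a = g.snd a) ∧ ∀ n a b, f.hom.app n a b ≫
        C.e n (f.hom.base a) (f.hom.base b) = B.e n a b ≫ g.fst.hom.app n := by
  have h : ∀ n a b, Quiv.totalInc (B.quiver.obj n) a b ≫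
      ((comparison V).map f ≫ E.counitHom).fst.hom.app n =
        f.hom.app n a b ≫ C.e n (f.hom.base a) (f.hom.base b) := fun n a b => by
    refine (reassoc_of% (QuivColax.totalInc_collapseApp f.hom n a b)) (totalHom C n) |>.trans ?_
    exact congrArg (f.hom.app n a b ≫ ·) (totalInc_totalHom C n _ _)
  have h' : ∀ n a b, Quiv.totalInc (B.quiver.obj n) a b ≫
      (D.counitHom ≫ g).fst.hom.app n = B.e n a b ≫ g.fst.hom.app n := fun n a b => by
    refine (Category.assoc _ _ _).symm.trans ?_
    exact congrArg (· ≫ g.fst.hom.app n) (totalInc_totalHom B n a b)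
  refine ⟨fun w => ⟨fun a => ?_, fun n a b => ?_⟩, fun w => CategoricalPullback.hom_ext
    (ColaxFunctor.hom_ext (NatTrans.ext (funext fun n => Quiv.total_ext fun a b => ?_))) ?_⟩
  · exact congrArg (fun k => k.snd a) w
  · exact (h n a b).symm.trans
      ((congrArg (fun k => Quiv.totalInc (B.quiver.obj n) a b ≫ k.fst.hom.app n) w).trans (h' n a b))
  · exact (h n a b).trans ((w.2 n a b).trans (h' n a b).symm)
  · ext a
    exact w.1 a

end Decomposition

theorem nonempty_decompositionFunctor (hV : IsDecomposing.{v} V) :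
    Nonempty (DecompositionFunctor.{v} V) :=
  ⟨{ onObj := fun B => B.decomposition hV
     map := fun {B C} g => (B.decomposition hV).map hV (C.decomposition hV) g
     map_base := fun g =>
       ((Decomposition.comparison_map_eq_iff _ _).1 (Decomposition.comparison_map _ hV _ g)).1
     map_e := fun g =>
       ((Decomposition.comparison_map_eq_iff _ _).1 (Decomposition.comparison_map _ hV _ g)).2 }⟩

namespace DecompositionFunctor

variable (d : DecompositionFunctor.{v} V)

/-- The morphism `(e_{a,b})_{a,b} : 𝔠 (𝔡 B) ⟶ B`. -/
noncomputable def counitHom (B : ColaxBased.{v} V) : (comparison V).obj (d.functor.obj B) ⟶ B :=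
  (d.onObj B).counitHom

theorem counitHom_naturality {B C : ColaxBased.{v} V} (g : B ⟶ C) :
    (comparison V).map (d.functor.map g) ≫ d.counitHom C = d.counitHom B ≫ g :=
  ((d.onObj B).comparison_map_eq_iff (d.map g)).2 ⟨d.map_base g, d.map_e g⟩

/-- The comparison functor is left adjoint to the decomposition functor. -/
noncomputable def adjunction (hV : IsDecomposing.{v} V) : comparison V ⊣ d.functor :=
  have h : ∀ B : ColaxBased.{v} V, IsIso (d.counitHom B) := fun B => (d.onObj B).isIso_counitHom hV
  -- The bijection composes `Hom(𝔠 X, B) ≅ Hom(𝔠 X, 𝔠 𝔡 B)`, by the isomorphism `counitHom`, with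
  -- `Hom(𝔠 X, 𝔠 𝔡 B) ≅ Hom(X, 𝔡 B)`, by full faithfulness.
  .mkOfHomEquiv
    { homEquiv := fun X B =>
        { toFun := fun g => (TemplicialObject.fullyFaithfulComparison hV).preimage
            (g ≫ inv (d.counitHom B))
          invFun := fun f => (comparison V).map f ≫ d.counitHom B
          left_inv := fun g => by
            dsimp only
            rw [(TemplicialObject.fullyFaithfulComparison hV).map_preimage, Category.assoc,
              IsIso.inv_hom_id, Category.comp_id]
          right_inv := fun f => (TemplicialObject.fullyFaithfulComparison hV).map_injective <| by
            rw [(TemplicialObject.fullyFaithfulComparison hV).map_preimage, Category.assoc,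
              IsIso.hom_inv_id, Category.comp_id] }
      homEquiv_naturality_left_symm := fun f g =>
        (congrArg (· ≫ _) ((comparison V).map_comp f g)).trans (Category.assoc _ _ _)
      homEquiv_naturality_right := fun {X B C} f g =>
        (TemplicialObject.fullyFaithfulComparison hV).map_injective <| by
          change (comparison V).map ((TemplicialObject.fullyFaithfulComparison hV).preimage _) =
            (comparison V).map ((TemplicialObject.fullyFaithfulComparison hV).preimage _ ≫ _)
          rw [(comparison V).map_comp, (TemplicialObject.fullyFaithfulComparison hV).map_preimage,
            (TemplicialObject.fullyFaithfulComparison hV).map_preimage,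
            ← cancel_mono (d.counitHom C), Category.assoc, Category.assoc, Category.assoc,
            Category.assoc, IsIso.inv_hom_id, Category.comp_id]
          refine congrArg (f ≫ ·) ?_
          exact ((@IsIso.inv_comp_eq _ _ _ _ _ _ (h B) _ _).2 (d.counitHom_naturality g)).symm }

theorem adjunction_counit_app (hV : IsDecomposing.{v} V) (B : ColaxBased.{v} V) :
    (d.adjunction hV).counit.app B = d.counitHom B :=
  (congrArg (· ≫ d.counitHom B) ((comparison V).map_id _)).trans (Category.id_comp _)

end DecompositionFunctor

end

end Templicial

theorem mainTheorem1 (V : Type u) [Category.{v} V] [MonoidalCategory V] [SymmetricCategory V]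
    [MonoidalClosed V] [HasLimits V] [HasColimits V] (hV : Templicial.IsDecomposing.{v} V) :
    Nonempty (Templicial.DecompositionFunctor.{v} V) ∧
      ∀ d : Templicial.DecompositionFunctor.{v} V,
        ∃ adj : Templicial.comparison V ⊣ d.functor,
          IsIso adj.unit ∧ IsIso adj.counit ∧
            ∀ B : Templicial.ColaxBased.{v} V,
              (∀ s : B.snd, (adj.counit.app B).snd s = s) ∧
                ∀ (n : Templicial.FinIntᵒᵖ) (a b : B.snd),
                  Templicial.Quiv.totalInc (B.quiver.obj n) a b ≫
                    (adj.counit.app B).fst.hom.app n = B.e n a b := by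
  refine ⟨Templicial.nonempty_decompositionFunctor hV, fun d => ⟨d.adjunction hV, ?_, ?_, ?_⟩⟩
  -- The unit of an adjunction is invertible when the left adjoint is fully faithful.
  · have := (Templicial.TemplicialObject.fullyFaithfulComparison hV).full
    have := (Templicial.TemplicialObject.fullyFaithfulComparison hV).faithful
    infer_instance
  · have (B : Templicial.ColaxBased.{v} V) : IsIso ((d.adjunction hV).counit.app B) := by
      rw [d.adjunction_counit_app hV]
      exact (d.onObj B).isIso_counitHom hV
    exact NatIso.isIso_of_isIso_app _
  · intro B
    rw [d.adjunction_counit_app hV]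
    exact ⟨fun _ => rfl, fun n a b => Templicial.Decomposition.totalInc_totalHom B n a b⟩
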